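/- Let $\ell\ge 3$ be an odd integer, $\xi=\exp(2\pi i/\ell)$, and write $\xi^{x}=\exp(2\pi i x/\ell)$ for $x\in\mathbb{C}$. Let $a_{11}=2$, $a_{12}=a_{21}=-1$, $a_{22}=0$, and let $d_1=0$, $d_2=1$. Let $\mathcal{U}^{\sigma}$ (the bosonization of the quotient $\mathcal U$ of $\mathcal{U}_\xi\mathfrak{sl}(2|1)$ by $e_1^\ell,f_1^\ell$) be the unital associative $\mathbb{C}$-algebra generated by $e_i,f_i,k_i^{\pm1}$ $(i=1,2)$ and $\sigma$ with relations $k_1k_2=k_2k_1$, $k_ik_i^{-1}=k_i^{-1}k_i=1$, $k_ie_jk_i^{-1}=\xi^{a_{ij}}e_j$, $k_if_jk_i^{-1}=\xi^{-a_{ij}}f_j$, $e_1f_1-f_1e_1=\frac{k_1-k_1^{-1}}{\xi-\xi^{-1}}$, $e_2f_2+f_2e_2=\frac{k_2-k_2^{-1}}{\xi-\xi^{-1}}$, $e_1f_2=f_2e_1$, $e_2f_1=f_1e_2$, $e_2^2=f_2^2=0$, $e_1^2e_2-(\xi+\xi^{-1})e_1e_2e_1+e_2e_1^2=0$, $f_1^2f_2-(\xi+\xi^{-1})f_1f_2f_1+f_2f_1^2=0$,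 $e_1^\ell=f_1^\ell=0$, $\sigma^2=1$, $\sigma k_i=k_i\sigma$, $\sigma e_i=(-1)^{d_i}e_i\sigma$, $\sigma f_i=(-1)^{d_i}f_i\sigma$. It is a Hopf algebra with $\Delta^\sigma(e_i)=e_i\otimes 1+k_i^{-1}\sigma^{d_i}\otimes e_i$, $\Delta^\sigma(f_i)=f_i\otimes k_i+\sigma^{d_i}\otimes f_i$, $\Delta^\sigma(k_i)=k_i\otimes k_i$, $\Delta^\sigma(\sigma)=\sigma\otimes\sigma$, $\varepsilon^\sigma(e_i)=\varepsilon^\sigma(f_i)=0$, $\varepsilon^\sigma(k_i)=\varepsilon^\sigma(\sigma)=1$, $S^\sigma(e_i)=-\sigma^{d_i}k_ie_i$, $S^\sigma(f_i)=-\sigma^{d_i}f_ik_i^{-1}$, $S^\sigma(k_i)=k_i^{-1}$, $S^\sigma(\sigma)=\sigma$. Let $G=\mathbb{C}/\mathbb{Z}\times\mathbb{C}/\mathbb{Z}$. For $\overline\alpha=(\overline\alpha_1,\overline\alpha_2)\in G$ let $\mathcal{U}_{\overline\alpha}$ be the quotient of $\mathcal{U}^\sigma$ by the relations $k_i^\ell=\xi^{\ell\alpha_i}$,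 $i=1,2$. The maps $\Delta^\sigma,\varepsilon^\sigma,S^\sigma$ induce algebra maps $\Delta_{\overline\alpha,\overline\beta}:\mathcal{U}_{\overline\alpha+\overline\beta}\to\mathcal{U}_{\overline\alpha}\otimes\mathcal{U}_{\overline\beta}$ and $\varepsilon:\mathcal{U}_{\overline0}\to\mathbb{C}$ and linear antihomomorphisms $S_{\overline\alpha}:\mathcal{U}_{\overline\alpha}\to\mathcal{U}_{-\overline\alpha}$, which make $\{\mathcal{U}_{\overline\alpha}\}_{\overline\alpha\in G}$ a Hopf $G$-coalgebra in the sense of Turaev. Let $\{\lambda_{\overline\alpha}:\mathcal{U}_{\overline\alpha}\to\mathbb{C}\}_{\overline\alpha\in G}$ be a right $G$-integral, that is, a family of linear forms with $$(\lambda_{\overline\alpha}\otimes\operatorname{Id})\Delta_{\overline\alpha,\overline\beta}(x)=\lambda_{\overline\alpha+\overline\beta}(x)\,1_{\overline\beta}\qquad\text{for all }\overline\alpha,\overline\beta\in G,\ x\in\mathcal{U}_{\overline\alpha+\overline\beta}.$$ Let $G_{\overline\alpha}\in\mathcal{U}_{\overline\alpha}$ be the image of $\sigma\phi_0=\sigma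 k_1^{-\ell}k_2^{-2}\in\mathcal{U}^\sigma$, and put $\operatorname{tr}^{\overline\alpha}(x)=\lambda_{\overline\alpha}(G_{\overline\alpha}x)$ for $x\in\mathcal{U}_{\overline\alpha}$. Then $\{\operatorname{tr}^{\overline\alpha}\}_{\overline\alpha\in G}$ is a $G$-trace for $\{\mathcal{U}_{\overline\alpha}\}_{\overline\alpha\in G}$: for all $\overline\alpha\in G$ and $x,y\in\mathcal{U}_{\overline\alpha}$, $$\operatorname{tr}^{\overline\alpha}(xy)=\operatorname{tr}^{\overline\alpha}(yx)\qquad\text{and}\qquad \operatorname{tr}^{-\overline\alpha}(S_{\overline\alpha}(x))=\operatorname{tr}^{\overline\alpha}(x).$$ -/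

import Mathlib

open scoped TensorProduct

noncomputable section

namespace SuperHennings

/-! ## Hopf group-coalgebras -/

/-- A Hopf `π`-coalgebra over `ℂ`, for an additively written group `π`.
The comultiplication `Δ_{a,b} : H_{a+b} → H_a ⊗ H_b` is indexed by `a`, `b` and by an index `c`
together with a proof of `c = a + b`, and the antipode `S_a : H_a → H_{-a}` by `a` and by an
index `b` together with a proof of `b = -a`; this makes it possible to write the axioms without
transporting elements along equalities such as `(a + b) + c = a + (b + c)`. -/
structure HopfGroupCoalgebra (π : Type*) [AddGroup π] (H : π → Type*)
    [∀ a, Ring (H a)] [∀ a, Algebra ℂ (H a)] where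
  comul : ∀ {a b c : π}, c = a + b → (H c →ₐ[ℂ] H a ⊗[ℂ] H b)
  counit : H 0 →ₐ[ℂ] ℂ
  antipode : ∀ {a b : π}, b = -a → (H a →ₗ[ℂ] H b)
  coassoc : ∀ {a b c ab bc abc : π} (h₁ : ab = a + b) (h₂ : abc = ab + c)
    (h₃ : bc = b + c) (h₄ : abc = a + bc) (x : H abc),
    TensorProduct.assoc ℂ (H a) (H b) (H c)
        ((comul h₁).toLinearMap.rTensor (H c) (comul h₂ x)) =
      (comul h₃).toLinearMap.lTensor (H a) (comul h₄ x)
  lTensor_counit : ∀ {a : π} (h : a = a + 0) (x : H a),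
    TensorProduct.rid ℂ (H a) (counit.toLinearMap.lTensor (H a) (comul h x)) = x
  rTensor_counit : ∀ {a : π} (h : a = 0 + a) (x : H a),
    TensorProduct.lid ℂ (H a) (counit.toLinearMap.rTensor (H a) (comul h x)) = x
  antipode_left : ∀ {a b : π} (h : a = -b) (h' : 0 = b + a) (x : H 0),
    LinearMap.mul' ℂ (H a) ((antipode h).rTensor (H a) (comul h' x)) =
      algebraMap ℂ (H a) (counit x)
  antipode_right : ∀ {a b : π} (h : a = -b) (h' : 0 = a + b) (x : H 0),
    LinearMap.mul' ℂ (H a) ((antipode h).lTensor (H a) (comul h' x)) =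
      algebraMap ℂ (H a) (counit x)

namespace HopfGroupCoalgebra

variable {π : Type*} [AddGroup π] {H : π → Type*} [∀ a, Ring (H a)] [∀ a, Algebra ℂ (H a)]

/-- A right `π`-integral: `(λ_a ⊗ id) Δ_{a,b} = λ_{a+b} 1_b` for all `a`, `b`. -/
def IsRightIntegral (C : HopfGroupCoalgebra π H) (lam : ∀ a, H a →ₗ[ℂ] ℂ) : Prop :=
  ∀ (a b : π) (x : H (a + b)),
    TensorProduct.lid ℂ (H b) ((lam a).rTensor (H b) (C.comul rfl x)) =
      lam (a + b) x • (1 : H b)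

/-- A `π`-trace: `tr^a (x y) = tr^a (y x)` and `tr^{-a} (S_a x) = tr^a x`. -/
def IsTrace (C : HopfGroupCoalgebra π H) (tr : ∀ a, H a →ₗ[ℂ] ℂ) : Prop :=
  (∀ (a : π) (x y : H a), tr a (x * y) = tr a (y * x)) ∧
    ∀ (a : π) (x : H a), tr (-a) (C.antipode rfl x) = tr a x

end HopfGroupCoalgebra

/-! ## The algebra `𝒰^σ` -/

/-- The root of unity `ξ = exp (2πi/ℓ)`. -/
def xi (ℓ : ℕ) : ℂ := Complex.exp (2 * Real.pi * Complex.I / ℓ)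

/-- The matrix `(a_ij)`; the indices `1, 2` are `0, 1 : Fin 2` here. -/
def cartan : Matrix (Fin 2) (Fin 2) ℤ := !![2, -1; -1, 0]

/-- Names of the generators `e_i, f_i, k_i, k_i⁻¹, σ`. -/
inductive Gen : Type
  | e (i : Fin 2)
  | f (i : Fin 2)
  | k (i : Fin 2)
  | kinv (i : Fin 2)
  | sigma

/-- The degree of `e_i` and of `f_i`: even for `i = 1`, odd for `i = 2`. -/
def deg : Fin 2 → ℕ := ![0, 1]

open Gen in
/-- The defining relations of `𝒰^σ`, for a family `g` of elements of an algebra `A`: those of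
`𝒰_ξ 𝔰𝔩(2|1)`, then `e₁^ℓ = f₁^ℓ = 0`, then those of the semidirect product
with `ℤ/2 = {1, σ}`. -/
inductive Rel (ℓ : ℕ) {A : Type*} [Ring A] [Algebra ℂ A] (g : Gen → A) : A → A → Prop
  | k_comm : Rel ℓ g (g (k 0) * g (k 1)) (g (k 1) * g (k 0))
  | k_kinv (i : Fin 2) : Rel ℓ g (g (k i) * g (kinv i)) 1
  | kinv_k (i : Fin 2) : Rel ℓ g (g (kinv i) * g (k i)) 1
  | k_e (i j : Fin 2) : Rel ℓ g (g (k i) * g (e j) * g (kinv i)) (xi ℓ ^ cartan i j • g (e j))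
  | k_f (i j : Fin 2) : Rel ℓ g (g (k i) * g (f j) * g (kinv i)) (xi ℓ ^ (-cartan i j) • g (f j))
  | e_f_one : Rel ℓ g (g (e 0) * g (f 0) - g (f 0) * g (e 0))
      ((xi ℓ - (xi ℓ)⁻¹)⁻¹ • (g (k 0) - g (kinv 0)))
  | e_f_two : Rel ℓ g (g (e 1) * g (f 1) + g (f 1) * g (e 1))
      ((xi ℓ - (xi ℓ)⁻¹)⁻¹ • (g (k 1) - g (kinv 1)))
  | e_f_one_two : Rel ℓ g (g (e 0) * g (f 1) - g (f 1) * g (e 0)) 0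
  | e_f_two_one : Rel ℓ g (g (e 1) * g (f 0) - g (f 0) * g (e 1)) 0
  | e_sq : Rel ℓ g (g (e 1) ^ 2) 0
  | f_sq : Rel ℓ g (g (f 1) ^ 2) 0
  | serre_e : Rel ℓ g (g (e 0) ^ 2 * g (e 1)
      - (xi ℓ + (xi ℓ)⁻¹) • (g (e 0) * g (e 1) * g (e 0)) + g (e 1) * g (e 0) ^ 2) 0
  | serre_f : Rel ℓ g (g (f 0) ^ 2 * g (f 1)
      - (xi ℓ + (xi ℓ)⁻¹) • (g (f 0) * g (f 1) * g (f 0)) + g (f 1) * g (f 0) ^ 2) 0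
  | e_pow : Rel ℓ g (g (e 0) ^ ℓ) 0
  | f_pow : Rel ℓ g (g (f 0) ^ ℓ) 0
  | sigma_sq : Rel ℓ g (g sigma ^ 2) 1
  | sigma_k (i : Fin 2) : Rel ℓ g (g sigma * g (k i)) (g (k i) * g sigma)
  | sigma_e (i : Fin 2) : Rel ℓ g (g sigma * g (e i)) ((-1 : ℂ) ^ deg i • (g (e i) * g sigma))
  | sigma_f (i : Fin 2) : Rel ℓ g (g sigma * g (f i)) ((-1 : ℂ) ^ deg i • (g (f i) * g sigma))

/-- The algebra `𝒰^σ`, the bosonization of `𝒰 = 𝒰_ξ 𝔰𝔩(2|1) / (e₁^ℓ, f₁^ℓ)`. -/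
def Usigma (ℓ : ℕ) : Type := RingQuot (Rel ℓ (FreeAlgebra.ι ℂ : Gen → FreeAlgebra ℂ Gen))

instance (ℓ : ℕ) : Ring (Usigma ℓ) :=
  inferInstanceAs (Ring (RingQuot (Rel ℓ (FreeAlgebra.ι ℂ : Gen → FreeAlgebra ℂ Gen))))

instance (ℓ : ℕ) : Algebra ℂ (Usigma ℓ) :=
  inferInstanceAs (Algebra ℂ (RingQuot (Rel ℓ (FreeAlgebra.ι ℂ : Gen → FreeAlgebra ℂ Gen))))

/-- The quotient map from the free algebra. -/
def Usigma.mk (ℓ : ℕ) : FreeAlgebra ℂ Gen →ₐ[ℂ] Usigma ℓ :=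
  RingQuot.mkAlgHom ℂ (Rel ℓ (FreeAlgebra.ι ℂ : Gen → FreeAlgebra ℂ Gen))

/-- The generators of `𝒰^σ`. -/
def gen (ℓ : ℕ) (x : Gen) : Usigma ℓ := Usigma.mk ℓ (FreeAlgebra.ι ℂ x)

/-- The family `g` satisfies the defining relations of `𝒰^σ`. -/
def Sat (ℓ : ℕ) {A : Type*} [Ring A] [Algebra ℂ A] (g : Gen → A) : Prop :=
  ∀ ⦃a b : A⦄, Rel ℓ g a b → a = b

section Universal

variable {A B : Type*} [Ring A] [Algebra ℂ A] [Ring B] [Algebra ℂ B]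

theorem Rel.map {ℓ : ℕ} {g : Gen → A} (φ : A →ₐ[ℂ] B) {a b : A} (h : Rel ℓ g a b) :
    Rel ℓ (fun x => φ (g x)) (φ a) (φ b) := by
  cases h <;>
    simp only [map_mul, map_one, map_zero, map_add, map_sub, map_pow, map_smul] <;>
    constructor

theorem sat_gen (ℓ : ℕ) : Sat ℓ (gen ℓ) := by
  have key : ∀ {a b : FreeAlgebra ℂ Gen}, Rel ℓ (FreeAlgebra.ι ℂ) a b →
      Usigma.mk ℓ a = Usigma.mk ℓ b := fun h => RingQuot.mkAlgHom_rel ℂ h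
  intro a b h
  cases h <;>
    simp only [gen, ← map_mul, ← map_one (Usigma.mk ℓ), ← map_zero (Usigma.mk ℓ), ← map_add,
      ← map_sub, ← map_pow, ← map_smul] <;>
    exact key (by constructor)

/-- The universal property of `𝒰^σ`. -/
def Usigma.lift {ℓ : ℕ} (g : Gen → A) (hg : Sat ℓ g) : Usigma ℓ →ₐ[ℂ] A :=
  RingQuot.liftAlgHom ℂ ⟨FreeAlgebra.lift ℂ g, fun x y h => hg (by
    have := h.map (FreeAlgebra.lift ℂ g)
    simpa only [FreeAlgebra.lift_ι_apply] using this)⟩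

@[simp] theorem Usigma.lift_gen {ℓ : ℕ} (g : Gen → A) (hg : Sat ℓ g) (x : Gen) :
    Usigma.lift g hg (gen ℓ x) = g x := by
  unfold Usigma.lift gen Usigma.mk
  erw [RingQuot.liftAlgHom_mkAlgHom_apply]
  simp

theorem Usigma.induction {ℓ : ℕ} {P : Usigma ℓ → Prop} (hc : ∀ c : ℂ, P (algebraMap ℂ _ c))
    (hg : ∀ x, P (gen ℓ x)) (hm : ∀ a b, P a → P b → P (a * b))
    (ha : ∀ a b, P a → P b → P (a + b)) (x : Usigma ℓ) : P x := by
  obtain ⟨y, rfl⟩ : ∃ y, Usigma.mk ℓ y = x := RingQuot.mkAlgHom_surjective ℂ _ x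
  induction y with
  | grade0 c => simpa using hc c
  | grade1 x => exact hg x
  | mul a b h1 h2 => simpa using hm _ _ h1 h2
  | add a b h1 h2 => simpa using ha _ _ h1 h2

end Universal

theorem xi_ne_zero (ℓ : ℕ) : xi ℓ ≠ 0 := Complex.exp_ne_zero _

section QBinomial

/-- Gaussian binomial coefficients. -/
def qbinom (q : ℂ) : ℕ → ℕ → ℂ
  | _, 0 => 1
  | 0, _ + 1 => 0
  | n + 1, k + 1 => qbinom q n k + q ^ (k + 1) * qbinom q n (k + 1)

theorem qbinom_absorb (q : ℂ) (n k : ℕ) :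
    (1 - q ^ (k + 1)) * qbinom q (n + 1) (k + 1) = (1 - q ^ (n + 1)) * qbinom q n k := by
  induction n generalizing k with
  | zero => cases k <;> simp [qbinom]
  | succ m ih =>
    rw [qbinom]
    have h1 := ih k
    cases k with
    | zero =>
      simp only [qbinom] at h1 ⊢
      linear_combination q ^ (0 + 1) * h1
    | succ j =>
      have h2 := ih j
      have h3 : qbinom q (m + 1) (j + 1) = qbinom q m j + q ^ (j + 1) * qbinom q m (j + 1) := rfl
      linear_combination q ^ (j + 1 + 1) * h1 + q * h2 - q * (1 - q ^ (m + 1)) * h3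

theorem qbinom_eq_zero_of_lt (q : ℂ) {n k : ℕ} (h : n < k) : qbinom q n k = 0 := by
  induction n generalizing k with
  | zero => cases k with
    | zero => omega
    | succ k => rfl
  | succ n ih => cases k with
    | zero => omega
    | succ k => rw [qbinom, ih (by omega), ih (by omega)]; simp

theorem qbinom_self (q : ℂ) (n : ℕ) : qbinom q n n = 1 := by
  induction n with
  | zero => rfl
  | succ n ih => rw [qbinom, ih, qbinom_eq_zero_of_lt q (by omega)]; simp

variable {A : Type*} [Ring A] [Algebra ℂ A]

theorem mul_pow_of_qcomm {q : ℂ} {x y : A} (h : y * x = q • (x * y)) (k : ℕ) :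
    y * x ^ k = q ^ k • (x ^ k * y) := by
  induction k with
  | zero => simp
  | succ k ih =>
    rw [pow_succ, ← mul_assoc, ih, smul_mul_assoc, mul_assoc, h, mul_smul_comm, smul_smul,
      ← pow_succ, mul_assoc]

theorem add_pow_of_qcomm {q : ℂ} {x y : A} (h : y * x = q • (x * y)) (n : ℕ) :
    (x + y) ^ n = ∑ k ∈ Finset.range (n + 1), qbinom q n k • (x ^ k * y ^ (n - k)) := by
  induction n with
  | zero => simp [qbinom]
  | succ n ih =>
    have e1 : x * (x + y) ^ n =
        ∑ k ∈ Finset.range (n + 1), qbinom q n k • (x ^ (k + 1) * y ^ (n - k)) := by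
      rw [ih, Finset.mul_sum]
      refine Finset.sum_congr rfl fun k _ => ?_
      rw [mul_smul_comm, ← mul_assoc, ← pow_succ']
    have e2 : y * (x + y) ^ n =
        ∑ k ∈ Finset.range (n + 1), (q ^ k * qbinom q n k) • (x ^ k * y ^ (n + 1 - k)) := by
      rw [ih, Finset.mul_sum]
      refine Finset.sum_congr rfl fun k hk => ?_
      have hk' : n + 1 - k = (n - k) + 1 := by
        have := Finset.mem_range.1 hk; omega
      rw [mul_smul_comm, ← mul_assoc, mul_pow_of_qcomm h, smul_mul_assoc, smul_smul, mul_assoc,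
        ← pow_succ', hk', mul_comm (qbinom q n k)]
    have e3 : ∑ k ∈ Finset.range (n + 1), (q ^ k * qbinom q n k) • (x ^ k * y ^ (n + 1 - k)) =
        ∑ k ∈ Finset.range (n + 1),
          (q ^ (k + 1) * qbinom q n (k + 1)) • (x ^ (k + 1) * y ^ (n - k)) + y ^ (n + 1) := by
      rw [Finset.sum_range_succ', Finset.sum_range_succ]
      rw [qbinom_eq_zero_of_lt q (Nat.lt_succ_self n)]
      simp [qbinom]
    rw [pow_succ', add_mul, e1, e2, e3, Finset.sum_range_succ' _ (n + 1), ← add_assoc,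
      ← Finset.sum_add_distrib]
    congr 1
    · refine Finset.sum_congr rfl fun k _ => ?_
      rw [← add_smul, Nat.add_sub_add_right]
      rfl
    · simp [qbinom]

theorem add_pow_of_primitive {q : ℂ} {ℓ : ℕ} (hq : IsPrimitiveRoot q ℓ) (hℓ : 0 < ℓ) {x y : A}
    (h : y * x = q • (x * y)) : (x + y) ^ ℓ = x ^ ℓ + y ^ ℓ := by
  obtain ⟨n, rfl⟩ : ∃ n, ℓ = n + 1 := ⟨ℓ - 1, by omega⟩
  rw [add_pow_of_qcomm h, Finset.sum_range_succ, Finset.sum_range_succ', Finset.sum_eq_zero]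
  · have h0 : qbinom q n (n + 1) = 0 := qbinom_eq_zero_of_lt q (Nat.lt_succ_self n)
    simp [qbinom, qbinom_self, h0, add_comm]
  · intro k hk
    have hk := Finset.mem_range.1 hk
    have h1 := qbinom_absorb q n k
    rw [hq.pow_eq_one, sub_self, zero_mul] at h1
    have h2 : 1 - q ^ (k + 1) ≠ 0 := fun h0 =>
      hq.pow_ne_one_of_pos_of_lt (l := k + 1) (by omega) (by omega) (sub_eq_zero.1 h0).symm
    rw [(mul_eq_zero.1 h1).resolve_left h2, zero_smul]

theorem mul_pow_eq_smul {q : ℂ} {a b : A} (h : b * a = q • (a * b)) (n : ℕ) :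
    ∃ c : ℂ, (a * b) ^ n = c • (a ^ n * b ^ n) := by
  induction n with
  | zero => exact ⟨1, by simp⟩
  | succ n ih =>
    obtain ⟨c, hc⟩ := ih
    have hb : b ^ n * a = q ^ n • (a * b ^ n) := by
      clear hc
      induction n with
      | zero => simp
      | succ n ih =>
        rw [pow_succ', mul_assoc, ih, mul_smul_comm, ← mul_assoc, h, smul_mul_assoc, smul_smul,
          mul_assoc, ← pow_succ]
    refine ⟨c * q ^ n, ?_⟩
    rw [pow_succ, hc, smul_mul_assoc, mul_assoc, ← mul_assoc (b ^ n), hb, smul_mul_assoc,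
      mul_smul_comm, smul_smul, pow_succ, pow_succ, mul_assoc, mul_assoc]

end QBinomial

section Commutation

variable {A : Type*} [Ring A] [Algebra ℂ A] {ℓ : ℕ} {g : Gen → A}

open Gen

namespace Sat

theorem kk (hg : Sat ℓ g) (i j : Fin 2) : g (k i) * g (k j) = g (k j) * g (k i) := by
  have h := hg .k_comm
  fin_cases i <;> fin_cases j <;> first | rfl | exact h | exact h.symm

theorem k_kinv_cancel (hg : Sat ℓ g) (i : Fin 2) (z : A) : g (k i) * (g (kinv i) * z) = z := by
  rw [← mul_assoc, hg (.k_kinv i), one_mul]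

theorem kinv_k_cancel (hg : Sat ℓ g) (i : Fin 2) (z : A) : g (kinv i) * (g (k i) * z) = z := by
  rw [← mul_assoc, hg (.kinv_k i), one_mul]

theorem kinv_of_k (hg : Sat ℓ g) {i : Fin 2} {x : A} {c : ℂ} (hc : c ≠ 0)
    (h : x * g (k i) = c • (g (k i) * x)) : x * g (kinv i) = c⁻¹ • (g (kinv i) * x) := by
  have h1 := congrArg (fun z => c⁻¹ • (g (kinv i) * z * g (kinv i))) h
  simp only [mul_assoc, mul_smul_comm, smul_mul_assoc, hg (.k_kinv i), mul_one,
    hg.kinv_k_cancel, smul_smul, inv_mul_cancel₀ hc, one_smul] at h1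
  exact h1.symm

theorem e_k (hg : Sat ℓ g) (i j : Fin 2) :
    g (e j) * g (k i) = xi ℓ ^ (-cartan i j) • (g (k i) * g (e j)) := by
  have h := congrArg (fun z => xi ℓ ^ (-cartan i j) • (z * g (k i))) (hg (.k_e i j))
  simp only [mul_assoc, hg (.kinv_k i), mul_one, smul_mul_assoc, smul_smul,
    ← zpow_add₀ (xi_ne_zero ℓ), neg_add_cancel, zpow_zero, one_smul] at h
  exact h.symm

theorem f_k (hg : Sat ℓ g) (i j : Fin 2) :
    g (f j) * g (k i) = xi ℓ ^ (cartan i j) • (g (k i) * g (f j)) := by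
  have h := congrArg (fun z => xi ℓ ^ (cartan i j) • (z * g (k i))) (hg (.k_f i j))
  simp only [mul_assoc, hg (.kinv_k i), mul_one, smul_mul_assoc, smul_smul,
    ← zpow_add₀ (xi_ne_zero ℓ), add_neg_cancel, zpow_zero, one_smul] at h
  exact h.symm

theorem e_kinv (hg : Sat ℓ g) (i j : Fin 2) :
    g (e j) * g (kinv i) = xi ℓ ^ (cartan i j) • (g (kinv i) * g (e j)) := by
  have := hg.kinv_of_k (zpow_ne_zero _ (xi_ne_zero ℓ)) (hg.e_k i j)
  rwa [zpow_neg, inv_inv] at this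

theorem f_kinv (hg : Sat ℓ g) (i j : Fin 2) :
    g (f j) * g (kinv i) = xi ℓ ^ (-cartan i j) • (g (kinv i) * g (f j)) := by
  have := hg.kinv_of_k (zpow_ne_zero _ (xi_ne_zero ℓ)) (hg.f_k i j)
  rwa [← zpow_neg] at this

theorem k_kinv_comm (hg : Sat ℓ g) (i j : Fin 2) : g (k j) * g (kinv i) = g (kinv i) * g (k j) := by
  simpa using hg.kinv_of_k (c := 1) one_ne_zero (by simpa using hg.kk j i)

theorem kinv_kinv (hg : Sat ℓ g) (i j : Fin 2) : g (kinv i) * g (kinv j) = g (kinv j) * g (kinv i) := by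
  simpa using hg.kinv_of_k (c := 1) (i := j) (x := g (kinv i)) one_ne_zero
    (by simpa using (hg.k_kinv_comm i j).symm)

theorem sigma_kinv (hg : Sat ℓ g) (i : Fin 2) : g sigma * g (kinv i) = g (kinv i) * g sigma := by
  simpa using hg.kinv_of_k (c := 1) one_ne_zero (by simpa using hg (.sigma_k i))

theorem sigma_sigma (hg : Sat ℓ g) : g sigma * g sigma = 1 := by
  rw [← pow_two]; exact hg .sigma_sq

theorem e_sigma (hg : Sat ℓ g) (i : Fin 2) : g (e i) * g sigma = (-1 : ℂ) ^ deg i • (g sigma * g (e i)) := by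
  rw [hg (.sigma_e i), smul_smul, ← mul_pow]; simp

theorem f_sigma (hg : Sat ℓ g) (i : Fin 2) : g (f i) * g sigma = (-1 : ℂ) ^ deg i • (g sigma * g (f i)) := by
  rw [hg (.sigma_f i), smul_smul, ← mul_pow]; simp

end Sat

theorem serre_add {x₁ y₁ x₂ y₂ : A} {q : ℂ} (hq : q ≠ 0)
    (h11 : x₁ * y₁ = q ^ 2 • (y₁ * x₁)) (h12 : x₁ * y₂ = q⁻¹ • (y₂ * x₁))
    (h21 : x₂ * y₁ = q⁻¹ • (y₁ * x₂))
    (hx : x₁ ^ 2 * x₂ - (q + q⁻¹) • (x₁ * x₂ * x₁) + x₂ * x₁ ^ 2 = 0)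
    (hy : y₁ ^ 2 * y₂ - (q + q⁻¹) • (y₁ * y₂ * y₁) + y₂ * y₁ ^ 2 = 0) :
    (x₁ + y₁) ^ 2 * (x₂ + y₂) - (q + q⁻¹) • ((x₁ + y₁) * (x₂ + y₂) * (x₁ + y₁))
      + (x₂ + y₂) * (x₁ + y₁) ^ 2 = 0 := by
  have h11' : ∀ z, x₁ * (y₁ * z) = q ^ 2 • (y₁ * (x₁ * z)) := fun z => by
    rw [← mul_assoc, h11, smul_mul_assoc, mul_assoc]
  have h12' : ∀ z, x₁ * (y₂ * z) = q⁻¹ • (y₂ * (x₁ * z)) := fun z => by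
    rw [← mul_assoc, h12, smul_mul_assoc, mul_assoc]
  have h21' : ∀ z, x₂ * (y₁ * z) = q⁻¹ • (y₁ * (x₂ * z)) := fun z => by
    rw [← mul_assoc, h21, smul_mul_assoc, mul_assoc]
  have e : (x₁ + y₁) ^ 2 * (x₂ + y₂) - (q + q⁻¹) • ((x₁ + y₁) * (x₂ + y₂) * (x₁ + y₁))
      + (x₂ + y₂) * (x₁ + y₁) ^ 2 =
      (x₁ ^ 2 * x₂ - (q + q⁻¹) • (x₁ * x₂ * x₁) + x₂ * x₁ ^ 2) +
      (y₁ ^ 2 * y₂ - (q + q⁻¹) • (y₁ * y₂ * y₁) + y₂ * y₁ ^ 2) := by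
    simp only [pow_two (x₁ + y₁), pow_two x₁, pow_two y₁, add_mul, mul_add, mul_assoc, h11, h12,
      h21, h11', h12', h21', mul_smul_comm, smul_mul_assoc, smul_smul, smul_add]
    match_scalars <;> field_simp <;> ring
  rw [e, hx, hy, add_zero]

theorem sq_add {R : Type*} [Ring R] {x y : R} (h : x * y = -(y * x)) (hx : x ^ 2 = 0) (hy : y ^ 2 = 0) :
    (x + y) ^ 2 = 0 := by
  rw [pow_two] at *
  simp [add_mul, mul_add, h, hx, hy]

end Commutation

theorem xi_sq_primitive {ℓ : ℕ} (hℓ : Odd ℓ) : IsPrimitiveRoot (xi ℓ ^ 2) ℓ :=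
  (Complex.isPrimitiveRoot_exp ℓ hℓ.pos.ne').pow_of_coprime 2 hℓ.coprime_two_left

section Comul

variable {A B : Type*} [Ring A] [Algebra ℂ A] [Ring B] [Algebra ℂ B] {ℓ : ℕ}

/-- The values `Δ^σ` takes on generators (with `A = B = 𝒰^σ`). -/
def comulGen (g : Gen → A) (h : Gen → B) : Gen → A ⊗[ℂ] B
  | .e i => g (.e i) ⊗ₜ 1 + (g (.kinv i) * g .sigma ^ deg i) ⊗ₜ h (.e i)
  | .f i => g (.f i) ⊗ₜ h (.k i) + (g .sigma ^ deg i) ⊗ₜ h (.f i)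
  | .k i => g (.k i) ⊗ₜ h (.k i)
  | .kinv i => g (.kinv i) ⊗ₜ h (.kinv i)
  | .sigma => g .sigma ⊗ₜ h .sigma

/-- The values `S^σ` takes on generators. -/
def antipodeGen (g : Gen → A) : Gen → Aᵐᵒᵖ
  | .e i => MulOpposite.op (-(g .sigma ^ deg i * g (.k i) * g (.e i)))
  | .f i => MulOpposite.op (-(g .sigma ^ deg i * g (.f i) * g (.kinv i)))
  | .k i => MulOpposite.op (g (.kinv i))
  | .kinv i => MulOpposite.op (g (.k i))
  | .sigma => MulOpposite.op (g .sigma)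

/-- The values `ε^σ` takes on generators. -/
def counitGen : Gen → ℂ
  | .e _ => 0
  | .f _ => 0
  | .k _ => 1
  | .kinv _ => 1
  | .sigma => 1

theorem sat_counitGen {ℓ : ℕ} (hℓ : ℓ ≠ 0) : Sat ℓ counitGen := by
  intro a b h
  cases h <;> simp [counitGen, hℓ]

end Comul
theorem Sat.k_mul_comm {A : Type*} [Ring A] [Algebra ℂ A] {ℓ : ℕ} {g : Gen → A} (hg : Sat ℓ g)
    (i j : Fin 2) (n : ℕ) :
    g (.k i) * (g (.kinv j) * g .sigma ^ n) = g (.kinv j) * g .sigma ^ n * g (.k i) := by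
  have h : Commute (g .sigma) (g (.k i)) := hg (.sigma_k i)
  rw [← mul_assoc, hg.k_kinv_comm, mul_assoc, mul_assoc, (h.pow_left n).eq]

section ComulSat

variable {A B : Type*} [Ring A] [Algebra ℂ A] [Ring B] [Algebra ℂ B] {ℓ : ℕ}

open Gen

theorem sat_comulGen (hℓ : Odd ℓ) {g : Gen → A} {h : Gen → B} (hg : Sat ℓ g) (hh : Sat ℓ h) :
    Sat ℓ (comulGen g h) := by
  have hx := xi_ne_zero ℓ
  intro a b r
  cases r with
  | k_comm => simp [comulGen, hg.kk 0 1, hh.kk 0 1]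
  | k_kinv i => simp [comulGen, hg (.k_kinv i), hh (.k_kinv i), Algebra.TensorProduct.one_def]
  | kinv_k i => simp [comulGen, hg (.kinv_k i), hh (.kinv_k i), Algebra.TensorProduct.one_def]
  | k_e i j =>
    have e1 := hg (.k_e i j)
    have e2 := hh (.k_e i j)
    have e3 : g (k i) * (g (kinv j) * g sigma ^ deg j) * g (kinv i) =
        g (kinv j) * g sigma ^ deg j := by
      rw [hg.k_mul_comm, mul_assoc, hg (.k_kinv i), mul_one]
    simp [comulGen, add_mul, mul_add, e1, e2, e3, hh (.k_kinv i), TensorProduct.smul_tmul']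
  | k_f i j =>
    have e1 := hg (.k_f i j)
    have e2 := hh (.k_f i j)
    have e3 : g (k i) * (g sigma ^ deg j) * g (kinv i) = g sigma ^ deg j := by
      fin_cases j <;> simp [deg, mul_assoc, hg.sigma_kinv, hg.k_kinv_cancel, hg (.k_kinv i)]
    have e4 : h (k i) * h (k j) * h (kinv i) = h (k j) := by
      rw [hh.kk i j, mul_assoc, hh (.k_kinv i), mul_one]
    simp [comulGen, add_mul, mul_add, e1, e2, e3, e4, TensorProduct.smul_tmul']
  | e_f_one =>
    have e1 := hg .e_f_one
    have e2 := hh .e_f_one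
    have e3 : (g (kinv 0) * g (f 0)) ⊗ₜ[ℂ] (h (e 0) * h (k 0)) =
        (g (f 0) * g (kinv 0)) ⊗ₜ[ℂ] (h (k 0) * h (e 0)) := by
      simp [hg.f_kinv, hh.e_k, TensorProduct.smul_tmul']
    have e4 : comulGen g h (e 0) * comulGen g h (f 0) - comulGen g h (f 0) * comulGen g h (e 0) =
        (g (e 0) * g (f 0) - g (f 0) * g (e 0)) ⊗ₜ h (k 0) +
          g (kinv 0) ⊗ₜ (h (e 0) * h (f 0) - h (f 0) * h (e 0)) := by
      simp [comulGen, deg, mul_add, add_mul, e3, TensorProduct.sub_tmul, TensorProduct.tmul_sub]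
      abel
    rw [e4, e1, e2]
    simp [comulGen, TensorProduct.sub_tmul, TensorProduct.tmul_sub, ← TensorProduct.smul_tmul',
      ← smul_add]
  | e_f_two =>
    have e1 := hg .e_f_two
    have e2 := hh .e_f_two
    have e3 : (g (kinv 1) * g sigma * g (f 1)) ⊗ₜ[ℂ] (h (e 1) * h (k 1)) =
        - (g (f 1) * (g (kinv 1) * g sigma)) ⊗ₜ[ℂ] (h (k 1) * h (e 1)) := by
      rw [← mul_assoc (g (f 1)), hg.f_kinv, hh.e_k, smul_mul_assoc, mul_assoc, mul_assoc,
        hg.f_sigma]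
      simp [deg, cartan, TensorProduct.neg_tmul]
    have e6 : g (kinv 1) * g sigma * g sigma = g (kinv 1) := by
      rw [mul_assoc, hg.sigma_sigma, mul_one]
    have e7 : g sigma * (g (kinv 1) * g sigma) = g (kinv 1) := by
      rw [← mul_assoc, hg.sigma_kinv, e6]
    have e5 : g (e 1) * g sigma = - (g sigma * g (e 1)) := by simp [hg.e_sigma, deg]
    have e4 : comulGen g h (e 1) * comulGen g h (f 1) + comulGen g h (f 1) * comulGen g h (e 1) =
        (g (e 1) * g (f 1) + g (f 1) * g (e 1)) ⊗ₜ h (k 1) +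
          g (kinv 1) ⊗ₜ (h (e 1) * h (f 1) + h (f 1) * h (e 1)) := by
      simp [comulGen, deg, mul_add, add_mul, e3, e5, e6, e7, TensorProduct.add_tmul,
        TensorProduct.tmul_add, TensorProduct.neg_tmul]
      abel
    rw [e4, e1, e2]
    simp [comulGen, TensorProduct.sub_tmul, TensorProduct.tmul_sub, ← TensorProduct.smul_tmul',
      ← smul_add]
  | e_f_one_two =>
    have e1 := sub_eq_zero.1 (hg .e_f_one_two)
    have e2 := sub_eq_zero.1 (hh .e_f_one_two)
    simp [comulGen, deg, mul_add, add_mul, e1, e2, hg.f_kinv, hh.e_k, hg.e_sigma, cartan,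
      TensorProduct.smul_tmul', hg.sigma_kinv]
    abel
  | e_f_two_one =>
    have e1 := sub_eq_zero.1 (hg .e_f_two_one)
    have e2 := sub_eq_zero.1 (hh .e_f_two_one)
    have e3 : g (f 0) * (g (kinv 1) * g sigma) = xi ℓ ^ (-cartan 1 0) •
        (g (kinv 1) * g sigma * g (f 0)) := by
      rw [← mul_assoc, hg.f_kinv, smul_mul_assoc, mul_assoc, hg.f_sigma]
      simp [deg, mul_assoc]
    simp [comulGen, deg, mul_add, add_mul, e1, e2, e3, hh.e_k, cartan,
      TensorProduct.smul_tmul']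
    abel
  | e_sq =>
    refine sq_add ?_ ?_ ?_
    · simp [deg, hg.e_kinv, cartan, ← mul_assoc]
      simp [mul_assoc, hg.e_sigma, deg, TensorProduct.neg_tmul]
    · simp [hg .e_sq]
    · simp [hh .e_sq]
  | f_sq =>
    refine sq_add ?_ ?_ ?_
    · simp [deg, hg.f_sigma, hh.f_k, cartan, TensorProduct.neg_tmul]
    · simp [hg .f_sq]
    · simp [hh .f_sq]
  | serre_e =>
    refine serre_add hx ?_ ?_ ?_ ?_ ?_
    · simp [deg, hg.e_kinv, cartan, TensorProduct.smul_tmul']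
    · have e1 : g (e 0) * (g (kinv 1) * g sigma) = (xi ℓ)⁻¹ •
          (g (kinv 1) * g sigma * g (e 0)) := by
        rw [← mul_assoc, hg.e_kinv, smul_mul_assoc, mul_assoc, hg.e_sigma]
        simp [deg, cartan, mul_assoc]
      simp [deg, e1, TensorProduct.smul_tmul']
    · simp [deg, hg.e_kinv, cartan, TensorProduct.smul_tmul']
    · have := congrArg (fun z => z ⊗ₜ[ℂ] (1 : B)) (hg .serre_e)
      simpa [TensorProduct.add_tmul, TensorProduct.sub_tmul, TensorProduct.smul_tmul'] using this
    · have := congrArg (fun z => (g (kinv 0) ^ 2 * (g (kinv 1) * g sigma)) ⊗ₜ[ℂ] z) (hh .serre_e)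
      have c0 : Commute (g (kinv 0)) (g (kinv 1) * g sigma) :=
        Commute.mul_right (hg.kinv_kinv 0 1) (hg.sigma_kinv 0).symm
      have c1 : g (kinv 0) * (g (kinv 1) * g sigma) * g (kinv 0) =
          g (kinv 0) ^ 2 * (g (kinv 1) * g sigma) := by
        rw [mul_assoc, ← c0.eq, ← mul_assoc, pow_two]
      have c2 := (c0.pow_left 2).eq
      simpa [TensorProduct.tmul_add, TensorProduct.tmul_sub, TensorProduct.smul_tmul', deg, c1,
        ← c2] using this
  | serre_f =>
    show (g (f 0) ⊗ₜ h (k 0) + (g sigma ^ deg 0) ⊗ₜ h (f 0)) ^ 2 *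
        (g (f 1) ⊗ₜ h (k 1) + (g sigma ^ deg 1) ⊗ₜ h (f 1)) - (xi ℓ + (xi ℓ)⁻¹) •
        ((g (f 0) ⊗ₜ h (k 0) + (g sigma ^ deg 0) ⊗ₜ h (f 0)) *
          (g (f 1) ⊗ₜ h (k 1) + (g sigma ^ deg 1) ⊗ₜ h (f 1)) *
          (g (f 0) ⊗ₜ h (k 0) + (g sigma ^ deg 0) ⊗ₜ h (f 0))) +
        (g (f 1) ⊗ₜ h (k 1) + (g sigma ^ deg 1) ⊗ₜ h (f 1)) *
        (g (f 0) ⊗ₜ h (k 0) + (g sigma ^ deg 0) ⊗ₜ h (f 0)) ^ 2 = 0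
    rw [add_comm (g (f 0) ⊗ₜ h (k 0)), add_comm (g (f 1) ⊗ₜ h (k 1))]
    refine serre_add hx ?_ ?_ ?_ ?_ ?_
    · simp [deg, hh.f_k, cartan, TensorProduct.smul_tmul']
    · simp [deg, hh.f_k, cartan, TensorProduct.smul_tmul']
    · have e1 : g sigma * g (f 0) = g (f 0) * g sigma := by simp [hg (.sigma_f 0), deg]
      simp [deg, hh.f_k, e1, cartan, TensorProduct.smul_tmul']
    · have := congrArg (fun z => (g sigma) ⊗ₜ[ℂ] z) (hh .serre_f)
      simpa [TensorProduct.tmul_add, TensorProduct.tmul_sub, TensorProduct.smul_tmul', deg]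
        using this
    · have := congrArg (fun z => z ⊗ₜ[ℂ] (h (k 0) ^ 2 * h (k 1))) (hg .serre_f)
      have c0 : Commute (h (k 0)) (h (k 1)) := hh .k_comm
      have c1 : h (k 0) * h (k 1) * h (k 0) = h (k 0) ^ 2 * h (k 1) := by
        rw [mul_assoc, ← c0.eq, ← mul_assoc, pow_two]
      have c2 := (c0.pow_left 2).eq
      simpa [TensorProduct.add_tmul, TensorProduct.sub_tmul, TensorProduct.smul_tmul', deg, c1,
        ← c2] using this
  | e_pow =>
    show (g (e 0) ⊗ₜ 1 + (g (kinv 0) * g sigma ^ deg 0) ⊗ₜ h (e 0)) ^ ℓ = 0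
    rw [add_comm, add_pow_of_primitive (xi_sq_primitive hℓ) hℓ.pos]
    · simp [hg .e_pow, hh .e_pow]
    · simp [deg, hg.e_kinv, cartan, TensorProduct.smul_tmul']
  | f_pow =>
    show (g (f 0) ⊗ₜ h (k 0) + (g sigma ^ deg 0) ⊗ₜ h (f 0)) ^ ℓ = 0
    rw [add_pow_of_primitive (xi_sq_primitive hℓ) hℓ.pos]
    · simp [hg .f_pow, hh .f_pow]
    · simp [deg, hh.f_k, cartan, TensorProduct.smul_tmul']
  | sigma_sq => simp [comulGen, hg .sigma_sq, hh .sigma_sq, Algebra.TensorProduct.one_def]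
  | sigma_k i => simp [comulGen, hg (.sigma_k i), hh (.sigma_k i)]
  | sigma_e i => 
    have e3 : g sigma * (g (kinv i) * g sigma ^ deg i) = (g (kinv i) * g sigma ^ deg i) * g sigma := by
      rw [← mul_assoc, hg.sigma_kinv, mul_assoc, mul_assoc, ← pow_succ, ← pow_succ']
    simp [comulGen, mul_add, add_mul, hg (.sigma_e i), hh (.sigma_e i), TensorProduct.smul_tmul', e3]
  | sigma_f i => 
    have e3 : g sigma * (g sigma ^ deg i) = (g sigma ^ deg i) * g sigma := by
      rw [← pow_succ, ← pow_succ']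
    simp [comulGen, mul_add, add_mul, hg (.sigma_f i), hh (.sigma_f i), hh (.sigma_k i), TensorProduct.smul_tmul', e3]

end ComulSat

section AntipodeSat

variable {A : Type*} [Ring A] [Algebra ℂ A] {ℓ : ℕ}

open Gen

theorem assoc_of_qcomm {x y : A} {c : ℂ} (h : x * y = c • (y * x)) (z : A) :
    x * (y * z) = c • (y * (x * z)) := by
  rw [← mul_assoc, h, smul_mul_assoc, mul_assoc]

theorem assoc_of_comm {R : Type*} [Ring R] {x y : R} (h : x * y = y * x) (z : R) :
    x * (y * z) = y * (x * z) := by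
  rw [← mul_assoc, h, mul_assoc]

theorem sat_antipodeGen {g : Gen → A} (hg : Sat ℓ g) : Sat ℓ (antipodeGen g) := by
  have hx := xi_ne_zero ℓ
  have s0 : ∀ z, g sigma * (g sigma * z) = z := fun z => by
    rw [← mul_assoc, hg.sigma_sigma, one_mul]
  have sk : ∀ i, g (k i) * g sigma = g sigma * g (k i) := fun i => (hg (.sigma_k i)).symm
  have skinv : ∀ i, g (kinv i) * g sigma = g sigma * g (kinv i) := fun i => (hg.sigma_kinv i).symm
  have hkk := hg.kk 1 0
  have hkk' := hg.kinv_kinv 1 0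
  intro a b r
  apply MulOpposite.unop_injective
  cases r with
  | k_comm => simp [antipodeGen, hg.kinv_kinv 0 1]
  | k_kinv i => simp [antipodeGen, hg (.k_kinv i)]
  | kinv_k i => simp [antipodeGen, hg (.kinv_k i)]
  | k_e i j =>
    fin_cases j <;>
    simp only [antipodeGen, deg, Fin.zero_eta, Fin.mk_one, Matrix.cons_val_zero,
      Matrix.cons_val_one, pow_zero, pow_one, one_mul, MulOpposite.unop_mul, MulOpposite.unop_op,
      MulOpposite.unop_smul, mul_assoc, hg.e_kinv, mul_neg, neg_mul, mul_smul_comm, smul_neg,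
      assoc_of_comm (hg.k_kinv_comm _ _), hg.kinv_k_cancel, assoc_of_comm (sk _)]
  | k_f i j =>
    have hs : Commute (g (k i)) (g sigma ^ deg j) := (show Commute _ _ from sk i).pow_right _
    have h1 : g (k i) * (g sigma ^ deg j * g (f j) * g (kinv j)) * g (kinv i) =
        xi ℓ ^ (-cartan i j) • (g sigma ^ deg j * g (f j) * g (kinv j)) := by
      have := congrArg (fun z => g sigma ^ deg j * z * g (kinv j)) (hg (.k_f i j))
      simpa only [mul_assoc, hg.kinv_kinv j i, assoc_of_comm hs.eq, mul_smul_comm,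
        smul_mul_assoc] using this
    simpa [antipodeGen, mul_assoc] using h1
  | e_f_one =>
    have e1 := hg .e_f_one
    have e2 : g (k 0) * (g (e 0) * (g (f 0) * g (kinv 0))) = g (e 0) * g (f 0) := by
      simp [hg.f_kinv, assoc_of_qcomm (hg.e_kinv _ _), hg.k_kinv_cancel, cartan, smul_smul, hx]
    have e3 : g (f 0) * (g (kinv 0) * (g (k 0) * g (e 0))) = g (f 0) * g (e 0) := by
      rw [hg.kinv_k_cancel]
    have e4 := congrArg (fun z => -z) e1
    simp only [neg_sub, ← smul_neg] at e4
    simpa [antipodeGen, deg, mul_assoc, e2, e3] using e4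
  | e_f_two =>
    have e1 := hg .e_f_two
    have e2 : g sigma * (g (k 1) * (g (e 1) * (g sigma * (g (f 1) * g (kinv 1))))) =
        - (g (e 1) * g (f 1)) := by
      simp [hg.f_kinv, assoc_of_qcomm (hg.e_kinv _ _), hg.k_kinv_cancel, cartan,
        assoc_of_qcomm (hg.e_sigma _), assoc_of_comm (sk _), s0, deg]
    have e3 : g sigma * (g (f 1) * (g (kinv 1) * (g sigma * (g (k 1) * g (e 1))))) =
        - (g (f 1) * g (e 1)) := by
      simp [assoc_of_comm (skinv _), assoc_of_qcomm (hg.f_sigma _), s0, deg, hg.kinv_k_cancel]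
    have e4 := congrArg (fun z => -z) e1
    simp only [neg_add_rev, ← smul_neg, neg_sub] at e4
    simpa [antipodeGen, deg, mul_assoc, e2, e3] using e4
  | e_f_one_two =>
    have e1 := sub_eq_zero.1 (hg .e_f_one_two)
    have e2 : g sigma * (g (f 1) * (g (kinv 1) * (g (k 0) * g (e 0)))) =
        g (k 0) * (g (e 0) * (g sigma * (g (f 1) * g (kinv 1)))) := by
      simp [hg.f_kinv, assoc_of_qcomm (hg.e_kinv _ _), cartan, smul_smul, deg,
        assoc_of_qcomm (hg.e_sigma _), assoc_of_comm (sk _), e1,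
        assoc_of_qcomm (hg.f_kinv _ _), assoc_of_qcomm (hg.f_k _ _),
        assoc_of_comm (hg.k_kinv_comm _ _)]
    simp [antipodeGen, deg, mul_assoc, e2]
  | e_f_two_one =>
    have e1 := sub_eq_zero.1 (hg .e_f_two_one)
    have e2 : g sigma * (g (k 1) * (g (e 1) * (g (f 0) * g (kinv 0)))) =
        g (f 0) * (g (kinv 0) * (g sigma * (g (k 1) * g (e 1)))) := by
      simp [hg.f_kinv, assoc_of_qcomm (hg.e_kinv _ _), cartan, smul_smul, deg,
        assoc_of_qcomm (hg.f_sigma _), assoc_of_comm (skinv _), e1,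
        assoc_of_qcomm (hg.f_kinv _ _), assoc_of_qcomm (hg.f_k _ _),
        assoc_of_comm (hg.k_kinv_comm _ _)]
    simp [antipodeGen, deg, mul_assoc, e2]
  | e_sq =>
    have := hg .e_sq
    rw [pow_two] at this
    simp [antipodeGen, deg, pow_two, mul_assoc, assoc_of_qcomm (hg.e_sigma _),
      assoc_of_qcomm (hg.e_k _ _), this]
  | f_sq =>
    have := hg .f_sq
    rw [pow_two] at this
    simp [antipodeGen, deg, pow_two, mul_assoc, assoc_of_qcomm (hg.f_sigma _),
      hg.f_kinv, assoc_of_comm (skinv _), this]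
  | serre_e =>
    have := congrArg (fun z => g sigma * (g (k 0) * (g (k 0) * (g (k 1) * z)))) (hg .serre_e)
    simp only [mul_add, mul_sub, mul_smul_comm, mul_zero, pow_two, mul_assoc] at this
    rw [← neg_eq_zero] at this
    simp only [MulOpposite.unop_zero]
    rw [← this]
    simp [antipodeGen, deg, pow_two, mul_assoc, assoc_of_qcomm (hg.e_sigma _), smul_smul,
      assoc_of_qcomm (hg.e_k _ _), hg.e_k, cartan, assoc_of_comm hkk, assoc_of_comm (sk _)]
    match_scalars <;> field_simp
  | serre_f =>
    have := congrArg (fun z => (xi ℓ ^ 4)⁻¹ • (g sigma * (g (kinv 0) * (g (kinv 0) * (g (kinv 1) * z)))))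
      (hg .serre_f)
    simp only [smul_zero, mul_add, mul_sub, mul_smul_comm, mul_zero, pow_two, mul_assoc] at this
    rw [← neg_eq_zero] at this
    simp only [MulOpposite.unop_zero]
    rw [← this]
    simp [antipodeGen, deg, pow_two, mul_assoc, assoc_of_qcomm (hg.f_sigma _), smul_smul,
      assoc_of_qcomm (hg.f_kinv _ _), hg.f_kinv, cartan, assoc_of_comm hkk',
      assoc_of_comm (skinv _)]
    match_scalars <;> field_simp
  | e_pow =>
    obtain ⟨c, hc⟩ := mul_pow_eq_smul (hg.e_k 0 0) ℓ
    simp [antipodeGen, deg, neg_pow (g _ * g _), hc, hg .e_pow]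
  | f_pow =>
    have h1 : g (kinv 0) * g (f 0) = xi ℓ ^ (cartan 0 0) • (g (f 0) * g (kinv 0)) := by
      rw [hg.f_kinv, smul_smul, ← zpow_add₀ hx]; simp
    obtain ⟨c, hc⟩ := mul_pow_eq_smul h1 ℓ
    simp [antipodeGen, deg, neg_pow (g _ * g _), hc, hg .f_pow]
  | sigma_sq => simp [antipodeGen, hg .sigma_sq]
  | sigma_k i => simp [antipodeGen, skinv]
  | sigma_e i =>
    fin_cases i <;>
    simp [antipodeGen, deg, mul_assoc, hg.e_sigma, assoc_of_comm (sk _)]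
  | sigma_f i =>
    fin_cases i <;>
    simp [antipodeGen, deg, mul_assoc, assoc_of_qcomm (hg.f_sigma _), skinv]

end AntipodeSat

section UsigmaHopf

variable {ℓ : ℕ}

/-- The coproduct `Δ^σ` of `𝒰^σ`. -/
def comulSigma (hℓ : Odd ℓ) : Usigma ℓ →ₐ[ℂ] Usigma ℓ ⊗[ℂ] Usigma ℓ :=
  Usigma.lift (comulGen (gen ℓ) (gen ℓ)) (sat_comulGen hℓ (sat_gen ℓ) (sat_gen ℓ))

/-- The counit `ε^σ` of `𝒰^σ`. -/
def counitSigma (hℓ : Odd ℓ) : Usigma ℓ →ₐ[ℂ] ℂ :=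
  Usigma.lift counitGen (sat_counitGen hℓ.pos.ne')

/-- The antipode `S^σ` of `𝒰^σ`, an antihomomorphism. -/
def antipodeSigma (ℓ : ℕ) : Usigma ℓ →ₐ[ℂ] (Usigma ℓ)ᵐᵒᵖ :=
  Usigma.lift (antipodeGen (gen ℓ)) (sat_antipodeGen (sat_gen ℓ))

end UsigmaHopf

/-! ## The quotients `𝒰_α` -/

/-- The group `G = ℂ/ℤ × ℂ/ℤ`. -/
abbrev G : Type := Fin 2 → ℂ ⧸ AddSubgroup.zmultiples (1 : ℂ)

/-- For `a ∈ ℂ/ℤ`, the number `ξ^{ℓ a} = exp (2πi a)`. -/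
def xiPowEll (a : ℂ ⧸ AddSubgroup.zmultiples (1 : ℂ)) : ℂ :=
  Quotient.liftOn' a (fun z => Complex.exp (2 * Real.pi * Complex.I * z)) (by
    intro z w h
    rw [QuotientAddGroup.leftRel_apply, AddSubgroup.mem_zmultiples_iff] at h
    obtain ⟨n, hn⟩ := h
    have hw : w = z + n := by
      have : (n : ℂ) = -z + w := by simpa using hn
      rw [this]; ring
    show Complex.exp _ = Complex.exp _
    rw [hw, mul_add, Complex.exp_add, mul_comm _ (n : ℂ), Complex.exp_int_mul_two_pi_mul_I,
      mul_one])

theorem xiPowEll_zero : xiPowEll 0 = 1 := by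
  show Complex.exp _ = 1
  simp

theorem xiPowEll_add (a b : ℂ ⧸ AddSubgroup.zmultiples (1 : ℂ)) :
    xiPowEll (a + b) = xiPowEll a * xiPowEll b := by
  induction a using QuotientAddGroup.induction_on with | H z => ?_
  induction b using QuotientAddGroup.induction_on with | H w => ?_
  show Complex.exp _ = Complex.exp _ * Complex.exp _
  rw [← Complex.exp_add, mul_add]

/-- The relations `k_i^ℓ = ξ^{ℓ α_i}`. -/
inductive KRel (ℓ : ℕ) (α : G) : Usigma ℓ → Usigma ℓ → Prop
  | mk (i : Fin 2) : KRel ℓ α (gen ℓ (.k i) ^ ℓ) (algebraMap ℂ (Usigma ℓ) (xiPowEll (α i)))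

/-- The algebra `𝒰_α`, the quotient of `𝒰^σ` by the relations `k_i^ℓ = ξ^{ℓ α_i}`. -/
def Ualpha (ℓ : ℕ) (α : G) : Type := RingQuot (KRel ℓ α)

instance (ℓ : ℕ) (α : G) : Ring (Ualpha ℓ α) := inferInstanceAs (Ring (RingQuot (KRel ℓ α)))

instance (ℓ : ℕ) (α : G) : Algebra ℂ (Ualpha ℓ α) :=
  inferInstanceAs (Algebra ℂ (RingQuot (KRel ℓ α)))

/-- The projection `p_α : 𝒰^σ → 𝒰_α`. -/
def proj (ℓ : ℕ) (α : G) : Usigma ℓ →ₐ[ℂ] Ualpha ℓ α := RingQuot.mkAlgHom ℂ (KRel ℓ α)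

theorem proj_surjective (ℓ : ℕ) (α : G) : Function.Surjective (proj ℓ α) :=
  RingQuot.mkAlgHom_surjective ℂ _

/-- The generators of `𝒰_α`. -/
def ugen (ℓ : ℕ) (α : G) (x : Gen) : Ualpha ℓ α := proj ℓ α (gen ℓ x)

theorem ugen_k_pow (ℓ : ℕ) (α : G) (i : Fin 2) :
    ugen ℓ α (.k i) ^ ℓ = algebraMap ℂ _ (xiPowEll (α i)) := by
  have := RingQuot.mkAlgHom_rel ℂ (KRel.mk (ℓ := ℓ) (α := α) i)
  rw [map_pow, AlgHom.commutes] at this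
  exact this

theorem Sat.map {ℓ : ℕ} {A B : Type*} [Ring A] [Algebra ℂ A] [Ring B] [Algebra ℂ B] {g : Gen → A}
    (hg : Sat ℓ g) (φ : A →ₐ[ℂ] B) : Sat ℓ (fun x => φ (g x)) := by
  intro a b h
  cases h <;>
    simp only [← map_mul, ← map_one φ, ← map_zero φ, ← map_add, ← map_sub, ← map_pow,
      ← map_smul] <;>
    exact congrArg φ (hg (by constructor))

theorem sat_ugen (ℓ : ℕ) (α : G) : Sat ℓ (ugen ℓ α) := (sat_gen ℓ).map (proj ℓ α)

theorem ugen_kinv_pow (ℓ : ℕ) (α β : G) (h : α + β = 0) (i : Fin 2) :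
    ugen ℓ β (.kinv i) ^ ℓ = algebraMap ℂ _ (xiPowEll (α i)) := by
  have hs := sat_ugen ℓ β
  have hc : Commute (ugen ℓ β (.k i)) (ugen ℓ β (.kinv i)) := hs.k_kinv_comm i i
  have h1 : ugen ℓ β (.k i) ^ ℓ * ugen ℓ β (.kinv i) ^ ℓ = 1 := by
    rw [← hc.mul_pow, hs (.k_kinv i), one_pow]
  have h2 : xiPowEll (α i) * xiPowEll (β i) = 1 := by
    rw [← xiPowEll_add, ← Pi.add_apply, h, Pi.zero_apply, xiPowEll_zero]
  have h3 := congrArg (fun z => algebraMap ℂ _ (xiPowEll (α i)) * z) h1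
  simpa only [ugen_k_pow, ← mul_assoc, ← map_mul, h2, map_one, one_mul, mul_one] using h3

/-- The universal property of `𝒰_α`. -/
def Ualpha.lift {ℓ : ℕ} {α : G} {A : Type*} [Ring A] [Algebra ℂ A] (φ : Usigma ℓ →ₐ[ℂ] A)
    (h : ∀ i, φ (gen ℓ (.k i)) ^ ℓ = algebraMap ℂ A (xiPowEll (α i))) : Ualpha ℓ α →ₐ[ℂ] A :=
  RingQuot.liftAlgHom ℂ ⟨φ, fun x y r => by
    cases r with
    | mk i => rw [map_pow, AlgHom.commutes]; exact h i⟩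

theorem Ualpha.lift_proj {ℓ : ℕ} {α : G} {A : Type*} [Ring A] [Algebra ℂ A]
    (φ : Usigma ℓ →ₐ[ℂ] A) (h : ∀ i, φ (gen ℓ (.k i)) ^ ℓ = algebraMap ℂ A (xiPowEll (α i)))
    (x : Usigma ℓ) : Ualpha.lift φ h (proj ℓ α x) = φ x :=
  RingQuot.liftAlgHom_mkAlgHom_apply ℂ _ _ _

theorem Ualpha.induction {ℓ : ℕ} {α : G} {P : Ualpha ℓ α → Prop}
    (hc : ∀ c : ℂ, P (algebraMap ℂ _ c)) (hg : ∀ x, P (ugen ℓ α x))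
    (hm : ∀ a b, P a → P b → P (a * b)) (ha : ∀ a b, P a → P b → P (a + b))
    (x : Ualpha ℓ α) : P x := by
  obtain ⟨y, rfl⟩ := proj_surjective ℓ α x
  induction y using Usigma.induction with
  | hc c => simpa using hc c
  | hg x => exact hg x
  | hm a b h1 h2 => simpa using hm _ _ h1 h2
  | ha a b h1 h2 => simpa using ha _ _ h1 h2

theorem Ualpha.algHom_ext {ℓ : ℕ} {α : G} {A : Type*} [Ring A] [Algebra ℂ A]
    {φ ψ : Ualpha ℓ α →ₐ[ℂ] A} (h : ∀ x, φ (ugen ℓ α x) = ψ (ugen ℓ α x)) : φ = ψ := by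
  ext x
  induction x using Ualpha.induction with
  | hc c => simp
  | hg x => exact h x
  | hm a b h1 h2 => simp [h1, h2]
  | ha a b h1 h2 => simp [h1, h2]

section Structure

variable {ℓ : ℕ} (hℓ : Odd ℓ)

/-- The coproduct `Δ_{α,β} : 𝒰_{α+β} → 𝒰_α ⊗ 𝒰_β` induced by `Δ^σ`. -/
def Ualpha.comul {α β γ : G} (h : γ = α + β) :
    Ualpha ℓ γ →ₐ[ℂ] Ualpha ℓ α ⊗[ℂ] Ualpha ℓ β :=
  Ualpha.lift ((Algebra.TensorProduct.map (proj ℓ α) (proj ℓ β)).comp (comulSigma hℓ)) (by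
    intro i
    have h1 : (Algebra.TensorProduct.map (proj ℓ α) (proj ℓ β)).comp (comulSigma hℓ)
        (gen ℓ (.k i)) = ugen ℓ α (.k i) ⊗ₜ ugen ℓ β (.k i) := by
      simp [comulSigma, comulGen, ugen]
    rw [h1, Algebra.TensorProduct.tmul_pow, ugen_k_pow, ugen_k_pow, h, Pi.add_apply,
      xiPowEll_add]
    simp [Algebra.algebraMap_eq_smul_one, TensorProduct.smul_tmul', TensorProduct.tmul_smul,
      smul_smul, mul_comm, Algebra.TensorProduct.one_def])

/-- The counit `𝒰_0 → ℂ` induced by `ε^σ`. -/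
def Ualpha.counit : Ualpha ℓ 0 →ₐ[ℂ] ℂ :=
  Ualpha.lift (counitSigma hℓ) (by
    intro i
    simp [counitSigma, counitGen, xiPowEll_zero])

/-- The antipode `S_α : 𝒰_α → 𝒰_{-α}` induced by `S^σ`, as an antihomomorphism. -/
def Ualpha.antipodeOp {α β : G} (h : β = -α) : Ualpha ℓ α →ₐ[ℂ] (Ualpha ℓ β)ᵐᵒᵖ :=
  Ualpha.lift ((AlgHom.op (proj ℓ β)).comp (antipodeSigma ℓ)) (by
    intro i
    have h1 : (AlgHom.op (proj ℓ β)).comp (antipodeSigma ℓ) (gen ℓ (.k i)) =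
        MulOpposite.op (ugen ℓ β (.kinv i)) := by
      simp [antipodeSigma, antipodeGen, ugen]
    rw [h1, ← MulOpposite.op_pow, ugen_kinv_pow ℓ α β (by rw [h, add_neg_cancel])]
    rfl)

/-- The antipode `S_α : 𝒰_α → 𝒰_{-α}` induced by `S^σ`, as a linear map. -/
def Ualpha.antipode {α β : G} (h : β = -α) : Ualpha ℓ α →ₗ[ℂ] Ualpha ℓ β :=
  (MulOpposite.opLinearEquiv ℂ).symm.toLinearMap ∘ₗ (Ualpha.antipodeOp h).toLinearMap


theorem Ualpha.comul_ugen {α β γ : G} (h : γ = α + β) (x : Gen) :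
    Ualpha.comul hℓ h (ugen ℓ γ x) = comulGen (ugen ℓ α) (ugen ℓ β) x := by
  rw [ugen, Ualpha.comul, Ualpha.lift_proj]
  cases x <;> simp [comulSigma, comulGen, ugen]

theorem Ualpha.counit_ugen (x : Gen) : Ualpha.counit hℓ (ugen ℓ 0 x) = counitGen x := by
  rw [ugen, Ualpha.counit, Ualpha.lift_proj]
  simp [counitSigma]

theorem Ualpha.antipode_ugen {α β : G} (h : β = -α) (x : Gen) :
    Ualpha.antipode h (ugen ℓ α x) = (antipodeGen (ugen ℓ β) x).unop := by
  show MulOpposite.unop (Ualpha.antipodeOp h (ugen ℓ α x)) = _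
  rw [ugen, Ualpha.antipodeOp, Ualpha.lift_proj]
  cases x <;> simp [antipodeSigma, antipodeGen, ugen]

theorem Ualpha.antipode_mul {α β : G} (h : β = -α) (x y : Ualpha ℓ α) :
    Ualpha.antipode h (x * y) = Ualpha.antipode h y * Ualpha.antipode h x := by
  simp [Ualpha.antipode]

theorem Ualpha.antipode_one {α β : G} (h : β = -α) :
    Ualpha.antipode h (1 : Ualpha ℓ α) = 1 := by
  simp [Ualpha.antipode]

theorem Ualpha.coassoc {a b c ab bc abc : G} (h₁ : ab = a + b) (h₂ : abc = ab + c)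
    (h₃ : bc = b + c) (h₄ : abc = a + bc) :
    ((Algebra.TensorProduct.assoc ℂ ℂ ℂ (Ualpha ℓ a) (Ualpha ℓ b) (Ualpha ℓ c)).toAlgHom.comp
      (Algebra.TensorProduct.map (Ualpha.comul hℓ h₁) (AlgHom.id ℂ (Ualpha ℓ c)))).comp
        (Ualpha.comul hℓ h₂) =
    (Algebra.TensorProduct.map (AlgHom.id ℂ (Ualpha ℓ a)) (Ualpha.comul hℓ h₃)).comp
        (Ualpha.comul hℓ h₄) := by
  refine Ualpha.algHom_ext fun x => ?_
  cases x with
  | sigma => simp [Ualpha.comul_ugen, comulGen]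
  | k i => simp [Ualpha.comul_ugen, comulGen]
  | kinv i => simp [Ualpha.comul_ugen, comulGen]
  | e i =>
    simp [Ualpha.comul_ugen, comulGen, TensorProduct.add_tmul, TensorProduct.tmul_add,
      Algebra.TensorProduct.one_def, add_assoc]
  | f i =>
    simp [Ualpha.comul_ugen, comulGen, TensorProduct.add_tmul, TensorProduct.tmul_add,
      add_assoc]

theorem Ualpha.lTensor_counit {a : G} (h : a = a + 0) :
    ((Algebra.TensorProduct.rid ℂ ℂ (Ualpha ℓ a)).toAlgHom.comp
      (Algebra.TensorProduct.map (AlgHom.id ℂ (Ualpha ℓ a)) (Ualpha.counit hℓ))).comp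
        (Ualpha.comul hℓ h) = AlgHom.id ℂ (Ualpha ℓ a) := by
  refine Ualpha.algHom_ext fun x => ?_
  cases x <;> simp [Ualpha.comul_ugen, comulGen, Ualpha.counit_ugen, counitGen]

theorem Ualpha.rTensor_counit {a : G} (h : a = 0 + a) :
    ((Algebra.TensorProduct.lid ℂ (Ualpha ℓ a)).toAlgHom.comp
      (Algebra.TensorProduct.map (Ualpha.counit hℓ) (AlgHom.id ℂ (Ualpha ℓ a)))).comp
        (Ualpha.comul hℓ h) = AlgHom.id ℂ (Ualpha ℓ a) := by
  refine Ualpha.algHom_ext fun x => ?_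
  cases x <;> simp [Ualpha.comul_ugen, comulGen, Ualpha.counit_ugen, counitGen]

/-- The map `m (S ⊗ id)`. -/
def Ualpha.convLeft {a b : G} (h : a = -b) : Ualpha ℓ b ⊗[ℂ] Ualpha ℓ a →ₗ[ℂ] Ualpha ℓ a :=
  LinearMap.mul' ℂ (Ualpha ℓ a) ∘ₗ (Ualpha.antipode h).rTensor (Ualpha ℓ a)

/-- The map `m (id ⊗ S)`. -/
def Ualpha.convRight {a b : G} (h : a = -b) : Ualpha ℓ a ⊗[ℂ] Ualpha ℓ b →ₗ[ℂ] Ualpha ℓ a :=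
  LinearMap.mul' ℂ (Ualpha ℓ a) ∘ₗ (Ualpha.antipode h).lTensor (Ualpha ℓ a)

theorem Ualpha.convLeft_tmul {a b : G} (h : a = -b) (x : Ualpha ℓ b) (y : Ualpha ℓ a) :
    Ualpha.convLeft h (x ⊗ₜ y) = Ualpha.antipode h x * y := rfl

theorem Ualpha.convRight_tmul {a b : G} (h : a = -b) (x : Ualpha ℓ a) (y : Ualpha ℓ b) :
    Ualpha.convRight h (x ⊗ₜ y) = x * Ualpha.antipode h y := rfl

theorem Ualpha.convLeft_mul {a b : G} (h : a = -b) (s : Ualpha ℓ b ⊗[ℂ] Ualpha ℓ a) (c : ℂ)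
    (hs : Ualpha.convLeft h s = algebraMap ℂ _ c) (t : Ualpha ℓ b ⊗[ℂ] Ualpha ℓ a) :
    Ualpha.convLeft h (s * t) = c • Ualpha.convLeft h t := by
  induction t with
  | zero => simp
  | add t₁ t₂ h₁ h₂ => rw [mul_add, map_add, h₁, h₂, map_add, smul_add]
  | tmul x y =>
    have key : ∀ s : Ualpha ℓ b ⊗[ℂ] Ualpha ℓ a, Ualpha.convLeft h (s * (x ⊗ₜ y)) =
        Ualpha.antipode h x * Ualpha.convLeft h s * y := by
      intro s
      induction s with
      | zero => simp
      | add s₁ s₂ h₁ h₂ => rw [add_mul, map_add, h₁, h₂, map_add, mul_add, add_mul]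
      | tmul z w =>
        simp [Ualpha.convLeft_tmul, Ualpha.antipode_mul, mul_assoc]
    rw [key, hs, Ualpha.convLeft_tmul, ← Algebra.commutes, Algebra.algebraMap_eq_smul_one]
    simp

theorem Ualpha.convRight_mul {a b : G} (h : a = -b) (s : Ualpha ℓ a ⊗[ℂ] Ualpha ℓ b) (c : ℂ)
    (hs : Ualpha.convRight h s = algebraMap ℂ _ c) (t : Ualpha ℓ a ⊗[ℂ] Ualpha ℓ b) :
    Ualpha.convRight h (t * s) = c • Ualpha.convRight h t := by
  induction t with
  | zero => simp
  | add t₁ t₂ h₁ h₂ => rw [add_mul, map_add, h₁, h₂, map_add, smul_add]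
  | tmul x y =>
    have key : ∀ s : Ualpha ℓ a ⊗[ℂ] Ualpha ℓ b, Ualpha.convRight h ((x ⊗ₜ y) * s) =
        x * Ualpha.convRight h s * Ualpha.antipode h y := by
      intro s
      induction s with
      | zero => simp
      | add s₁ s₂ h₁ h₂ => rw [mul_add, map_add, h₁, h₂, map_add, mul_add, add_mul]
      | tmul z w =>
        simp [Ualpha.convRight_tmul, Ualpha.antipode_mul, mul_assoc]
    rw [key, hs, Ualpha.convRight_tmul, ← Algebra.commutes, Algebra.algebraMap_eq_smul_one]
    simp

theorem Ualpha.antipode_left {a b : G} (h : a = -b) (h' : 0 = b + a) (x : Ualpha ℓ 0) :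
    Ualpha.convLeft h (Ualpha.comul hℓ h' x) = algebraMap ℂ _ (Ualpha.counit hℓ x) := by
  induction x using Ualpha.induction with
  | hc c =>
    simp [Algebra.algebraMap_eq_smul_one, Algebra.TensorProduct.one_def, Ualpha.convLeft_tmul,
      Ualpha.antipode_one]
  | hm x y h1 h2 =>
    rw [map_mul, Ualpha.convLeft_mul h _ _ h1, h2, map_mul, map_mul, Algebra.smul_def]
  | ha x y h1 h2 => simp [h1, h2]
  | hg x =>
    have hs := sat_ugen ℓ a
    rw [Ualpha.comul_ugen, Ualpha.counit_ugen]
    cases x with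
    | sigma => simp [comulGen, counitGen, Ualpha.convLeft_tmul, Ualpha.antipode_ugen, antipodeGen,
        hs.sigma_sigma]
    | k i => simp [comulGen, counitGen, Ualpha.convLeft_tmul, Ualpha.antipode_ugen, antipodeGen,
        hs (.kinv_k i)]
    | kinv i => simp [comulGen, counitGen, Ualpha.convLeft_tmul, Ualpha.antipode_ugen,
        antipodeGen, hs (.k_kinv i)]
    | e i =>
      fin_cases i <;>
      simp [comulGen, counitGen, Ualpha.convLeft_tmul, Ualpha.antipode_ugen, antipodeGen, deg,
        Ualpha.antipode_mul]
    | f i =>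
      fin_cases i <;>
      simp [comulGen, counitGen, Ualpha.convLeft_tmul, Ualpha.antipode_ugen, antipodeGen, deg,
        Ualpha.antipode_one, mul_assoc, hs (.kinv_k _)]

theorem Ualpha.antipode_right {a b : G} (h : a = -b) (h' : 0 = a + b) (x : Ualpha ℓ 0) :
    Ualpha.convRight h (Ualpha.comul hℓ h' x) = algebraMap ℂ _ (Ualpha.counit hℓ x) := by
  induction x using Ualpha.induction with
  | hc c =>
    simp [Algebra.algebraMap_eq_smul_one, Algebra.TensorProduct.one_def, Ualpha.convRight_tmul,
      Ualpha.antipode_one]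
  | hm x y h1 h2 =>
    rw [map_mul, Ualpha.convRight_mul h _ _ h2, h1, map_mul, map_mul, Algebra.smul_def,
      Algebra.commutes]
  | ha x y h1 h2 => simp [h1, h2]
  | hg x =>
    have hs := sat_ugen ℓ a
    have s0 : ∀ z, ugen ℓ a .sigma * (ugen ℓ a .sigma * z) = z := fun z => by
      rw [← mul_assoc, hs.sigma_sigma, one_mul]
    rw [Ualpha.comul_ugen, Ualpha.counit_ugen]
    cases x with
    | sigma => simp [comulGen, counitGen, Ualpha.convRight_tmul, Ualpha.antipode_ugen,
        antipodeGen, hs.sigma_sigma]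
    | k i => simp [comulGen, counitGen, Ualpha.convRight_tmul, Ualpha.antipode_ugen, antipodeGen,
        hs (.k_kinv i)]
    | kinv i => simp [comulGen, counitGen, Ualpha.convRight_tmul, Ualpha.antipode_ugen,
        antipodeGen, hs (.kinv_k i)]
    | e i =>
      fin_cases i <;>
      simp [comulGen, counitGen, Ualpha.convRight_tmul, Ualpha.antipode_ugen, antipodeGen, deg,
        Ualpha.antipode_one, mul_assoc, hs.kinv_k_cancel, s0]
    | f i =>
      fin_cases i <;>
      simp [comulGen, counitGen, Ualpha.convRight_tmul, Ualpha.antipode_ugen, antipodeGen, deg,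
        mul_assoc, s0]

/-- The Hopf `G`-coalgebra `{𝒰_α}_{α ∈ G}`. -/
def hopfU (ℓ : ℕ) (hℓ : Odd ℓ) : HopfGroupCoalgebra G (Ualpha ℓ) where
  comul h := Ualpha.comul hℓ h
  counit := Ualpha.counit hℓ
  antipode h := Ualpha.antipode h
  coassoc h₁ h₂ h₃ h₄ x := DFunLike.congr_fun (Ualpha.coassoc hℓ h₁ h₂ h₃ h₄) x
  lTensor_counit h x := DFunLike.congr_fun (Ualpha.lTensor_counit hℓ h) x
  rTensor_counit h x := DFunLike.congr_fun (Ualpha.rTensor_counit hℓ h) x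
  antipode_left h h' x := Ualpha.antipode_left hℓ h h' x
  antipode_right h h' x := Ualpha.antipode_right hℓ h h' x

end Structure

/-- The element `σ φ₀ = σ k₁^{-ℓ} k₂^{-2}` of `𝒰^σ`. -/
def pivotal (ℓ : ℕ) : Usigma ℓ := gen ℓ .sigma * (gen ℓ (.kinv 0) ^ ℓ * gen ℓ (.kinv 1) ^ 2)

/-- The linear form `tr^α (x) = λ_α (G_α x)`, where `G_α` is the image of `σ φ₀` in `𝒰_α`. -/
def trForm (ℓ : ℕ) (lam : ∀ α : G, Ualpha ℓ α →ₗ[ℂ] ℂ) (α : G) : Ualpha ℓ α →ₗ[ℂ] ℂ :=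
  lam α ∘ₗ LinearMap.mulLeft ℂ (proj ℓ α (pivotal ℓ))

end SuperHennings

end

/-! Everything rests on a uniqueness principle: an integral `L` on a single component `𝒰_α` is
determined by one number, its value on `E τ(E)`, where `E = e₁^{ℓ-1} e₂ e₁ e₂` (`eTop`) and `τ` is
the involutive antiautomorphism `e_i ↔ f_i k_i⁻¹`. Neither a PBW basis nor an explicit formula for
the integral is needed.

Uniqueness. The products `v τ(v')`, with `v`, `v'` monomials in the torus and the `e_i`, span `𝒰_α`
(`triangular_eq_top`), and each positive monomial is a combination of words `e₁^a w κ` with `w ∈ {1,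
e₂, e₂e₁, e₂e₁e₂}` and `κ` in the torus, of degree at most `ℓ + 2`. Applying a 3-dimensional
representation of `𝒰_0` to the second factor of `(L ⊗ id)Δ = L·1` shows that `L` kills the
off-diagonal entries of the matrix coaction. For the vector representation and a dual one, these
entries behave like derivatives in `e₂` and `e₁`. Every word below top degree is a combination of
such derivatives, so `L` vanishes on it (`IsIntegralAt.filt_le_tauKer`). As `τ` respects the
coproduct, `L ∘ τ` is again an integral, and the same vanishing holds on the other side. What
remains is `L(E κ τ(E))`; the diagonal entries force it to be zero unless `κ` is a scalar
(`torus_eq_smul_or`).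

Trace property. By uniqueness, `L` is invariant under conjugation by the torus. The form `x ↦ c_i
L(e_i x) - L(x e_i)`, with `c_i = (-1)^{d_i} ξ^{a_ii}`, is again an integral and vanishes on `E
τ(E)` for weight reasons, hence is zero. The pivotal element satisfies `G e_i = c_i e_i G`, so `L(G
·)` is cyclic for `e_i`; the case of `f_i` follows through `τ`.

Antipode. The leading term of `Δ(E τ(E))` is `E τ(E) ⊗ 1`, which forces the integrals of components
`α` and `-α` to have the same top value (`topValue_neg`). It then suffices to prove `λ_{-α}(G S(y)
G) = λ_α(y)`, since `S(G) G = 1`. Both sides vanish when either factor of `v τ(v')` lies below top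
degree. In top degree they are compared through `S(E) = u E` with `u = k₁^ℓ k₂²`, which is exactly
the element with `u G = σ`. -/

noncomputable section

namespace SuperHennings

open Gen

/-! ## Elements commuting up to a scalar -/

section QComm

variable {A : Type*} [Ring A] [Algebra ℂ A]

/-- `x` and `y` commute up to a non-zero scalar. -/
def QComm (x y : A) : Prop := ∃ c : ℂ, c ≠ 0 ∧ x * y = c • (y * x)

theorem QComm.of_commute {x y : A} (h : x * y = y * x) : QComm x y :=
  ⟨1, one_ne_zero, by rw [h, one_smul]⟩

theorem QComm.symm {x y : A} (h : QComm x y) : QComm y x := by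
  obtain ⟨c, hc, h⟩ := h
  exact ⟨c⁻¹, inv_ne_zero hc, by rw [h, smul_smul, inv_mul_cancel₀ hc, one_smul]⟩

theorem QComm.one_right (x : A) : QComm x 1 := .of_commute (by simp)

theorem QComm.mul_right {x y z : A} (hy : QComm x y) (hz : QComm x z) : QComm x (y * z) := by
  obtain ⟨c, hc, hy⟩ := hy
  obtain ⟨d, hd, hz⟩ := hz
  refine ⟨c * d, mul_ne_zero hc hd, ?_⟩
  rw [← mul_assoc, hy, smul_mul_assoc, mul_assoc, hz, mul_smul_comm, smul_smul, mul_assoc]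

theorem QComm.mul_left {x y z : A} (hx : QComm x z) (hy : QComm y z) : QComm (x * y) z :=
  (hx.symm.mul_right hy.symm).symm

end QComm

/-! ## The torus and the upper triangular part -/

section Torus

variable {A : Type*} [Ring A]

/-- The monoid generated by `k_i^{±1}` and `σ`. -/
def torus (g : Gen → A) : Submonoid A :=
  Submonoid.closure {x | (∃ i, x = g (k i)) ∨ (∃ i, x = g (kinv i)) ∨ x = g sigma}

theorem k_mem_torus (g : Gen → A) (i : Fin 2) : g (k i) ∈ torus g :=
  Submonoid.subset_closure (.inl ⟨i, rfl⟩)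

theorem kinv_mem_torus (g : Gen → A) (i : Fin 2) : g (kinv i) ∈ torus g :=
  Submonoid.subset_closure (.inr (.inl ⟨i, rfl⟩))

theorem sigma_mem_torus (g : Gen → A) : g sigma ∈ torus g :=
  Submonoid.subset_closure (.inr (.inr rfl))

/-- The monoid generated by `k_i^{±1}`, `σ` and `e_i`. -/
def positive (g : Gen → A) : Submonoid A :=
  Submonoid.closure ((torus g : Set A) ∪ {x | ∃ i, x = g (e i)})

theorem torus_le_positive (g : Gen → A) : torus g ≤ positive g :=
  fun _ hx => Submonoid.subset_closure (.inl hx)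

theorem e_mem_positive (g : Gen → A) (i : Fin 2) : g (e i) ∈ positive g :=
  Submonoid.subset_closure (.inr ⟨i, rfl⟩)

/-- The words `1, e₂, e₂e₁, e₂e₁e₂`. -/
def eWord (g : Gen → A) : Fin 4 → A :=
  ![1, g (e 1), g (e 1) * g (e 0), g (e 1) * g (e 0) * g (e 1)]

theorem eWord_mem_positive (g : Gen → A) (j : Fin 4) : eWord g j ∈ positive g := by
  have h0 := e_mem_positive g 0
  have h1 := e_mem_positive g 1
  fin_cases j
  · exact one_mem _
  · exact h1
  · exact mul_mem h1 h0
  · exact mul_mem (mul_mem h1 h0) h1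

end Torus

/-! ### Ordered monomials in the positive part -/

section Positive

variable {A : Type*} [Ring A] [Algebra ℂ A] {ℓ : ℕ} {g : Gen → A}

/-- The span of the `e₁^a w κ`, with `w` one of `1, e₂, e₂e₁, e₂e₁e₂`, with `κ` in the torus
and with at most `n` factors `e_i`. -/
def filt (g : Gen → A) (n : ℕ) : Submodule ℂ A :=
  Submodule.span ℂ {x | ∃ (a : ℕ) (j : Fin 4) (κ : A), κ ∈ torus g ∧ a + j ≤ n ∧
    x = g (e 0) ^ a * eWord g j * κ}

/-- The longest word `e₁^{ℓ-1} e₂ e₁ e₂`. -/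
def eTop (ℓ : ℕ) (g : Gen → A) : A := g (e 0) ^ (ℓ - 1) * eWord g 3

theorem mem_filt {n a : ℕ} (j : Fin 4) {κ : A} (hκ : κ ∈ torus g) (h : a + j ≤ n) :
    g (e 0) ^ a * eWord g j * κ ∈ filt g n :=
  Submodule.subset_span ⟨a, j, κ, hκ, h, rfl⟩

theorem filt_mono {m n : ℕ} (h : m ≤ n) : filt g m ≤ filt g n :=
  Submodule.span_mono fun _ ⟨a, j, κ, hκ, hn, hx⟩ => ⟨a, j, κ, hκ, hn.trans h, hx⟩

theorem torus_mem_filt {κ : A} (hκ : κ ∈ torus g) (n : ℕ) : κ ∈ filt g n := by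
  simpa [eWord] using mem_filt (n := n) (a := 0) 0 hκ (by simp)

theorem filt_le_span_positive (n : ℕ) : filt g n ≤ Submodule.span ℂ (positive g : Set A) :=
  Submodule.span_mono fun _ ⟨a, j, _, hκ, _, hx⟩ => hx ▸
    mul_mem (mul_mem (pow_mem (e_mem_positive g 0) a) (eWord_mem_positive g j))
      (torus_le_positive g hκ)

namespace Sat

theorem torus_qcomm {x κ : A} (hk : ∀ i, QComm (g (k i)) x)
    (hkinv : ∀ i, QComm (g (kinv i)) x) (hs : QComm (g sigma) x) (hκ : κ ∈ torus g) :
    QComm κ x := by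
  induction hκ using Submonoid.closure_induction with
  | mem y hy =>
    rcases hy with ⟨i, rfl⟩ | ⟨i, rfl⟩ | rfl
    · exact hk i
    · exact hkinv i
    · exact hs
  | one => exact (QComm.one_right x).symm
  | mul y z _ _ h1 h2 => exact h1.mul_left h2

theorem torus_e (hg : Sat ℓ g) {κ : A} (hκ : κ ∈ torus g) (i : Fin 2) : QComm κ (g (e i)) :=
  torus_qcomm (fun _ => QComm.symm ⟨_, zpow_ne_zero _ (xi_ne_zero ℓ), hg.e_k _ _⟩)
    (fun _ => QComm.symm ⟨_, zpow_ne_zero _ (xi_ne_zero ℓ), hg.e_kinv _ _⟩)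
    (QComm.symm ⟨_, pow_ne_zero _ (by norm_num), hg.e_sigma _⟩) hκ

theorem torus_f (hg : Sat ℓ g) {κ : A} (hκ : κ ∈ torus g) (i : Fin 2) : QComm κ (g (f i)) :=
  torus_qcomm (fun _ => QComm.symm ⟨_, zpow_ne_zero _ (xi_ne_zero ℓ), hg.f_k _ _⟩)
    (fun _ => QComm.symm ⟨_, zpow_ne_zero _ (xi_ne_zero ℓ), hg.f_kinv _ _⟩)
    (QComm.symm ⟨_, pow_ne_zero _ (by norm_num), hg.f_sigma _⟩) hκ

theorem torus_comm (hg : Sat ℓ g) {κ κ' : A} (hκ : κ ∈ torus g) (hκ' : κ' ∈ torus g) :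
    κ * κ' = κ' * κ := by
  induction hκ, hκ' using Submonoid.closure_induction₂ with
  | mem x y hx hy =>
    rcases hx with ⟨i, rfl⟩ | ⟨i, rfl⟩ | rfl <;> rcases hy with ⟨j, rfl⟩ | ⟨j, rfl⟩ | rfl
    · exact hg.kk _ _
    · exact hg.k_kinv_comm _ _
    · exact (hg (.sigma_k i)).symm
    · exact (hg.k_kinv_comm _ _).symm
    · exact hg.kinv_kinv _ _
    · exact (hg.sigma_kinv i).symm
    · exact hg (.sigma_k j)
    · exact hg.sigma_kinv j
    · rfl
  | one_left x _ => simp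
  | one_right x _ => simp
  | mul_left x y z _ _ _ h1 h2 => rw [mul_assoc, h2, ← mul_assoc, h1, mul_assoc]
  | mul_right x y z _ _ _ h1 h2 => rw [← mul_assoc, h1, mul_assoc, h2, mul_assoc]

theorem torus_positive (hg : Sat ℓ g) {κ x : A} (hκ : κ ∈ torus g) (hx : x ∈ positive g) :
    QComm κ x := by
  induction hx using Submonoid.closure_induction with
  | mem y hy =>
    rcases hy with hy | ⟨i, rfl⟩
    · exact .of_commute (hg.torus_comm hκ hy)
    · exact hg.torus_e hκ i
  | one => exact QComm.one_right κ
  | mul y z _ _ h1 h2 => exact h1.mul_right h2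

theorem e_sq_mul (hg : Sat ℓ g) (z : A) : g (e 1) * (g (e 1) * z) = 0 := by
  rw [← mul_assoc, ← pow_two, hg .e_sq, zero_mul]

theorem e_mul_self (hg : Sat ℓ g) : g (e 1) * g (e 1) = 0 := by
  rw [← pow_two, hg .e_sq]

theorem e_swap_sq (hg : Sat ℓ g) : g (e 1) * g (e 0) ^ 2 =
    (xi ℓ + (xi ℓ)⁻¹) • (g (e 0) * g (e 1) * g (e 0)) - g (e 0) ^ 2 * g (e 1) := by
  rw [← sub_eq_zero, ← hg .serre_e]; abel

/-- Multiplying the Serre relation by `e₂` on the left and on the right, with `e₂² = 0`, expresses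
both `[2] e₂e₁e₂e₁` and `[2] e₁e₂e₁e₂` as `e₂e₁²e₂`. Then `[2] = ξ + ξ⁻¹` is cancelled. -/
theorem eWord_three_comm (hg : Sat ℓ g) (h2 : xi ℓ + (xi ℓ)⁻¹ ≠ 0) :
    eWord g 3 * g (e 0) = g (e 0) * eWord g 3 := by
  have h1 := congrArg (fun z => g (e 1) * z) (hg .serre_e)
  have h3 := congrArg (fun z => z * g (e 1)) (hg .serre_e)
  simp only [mul_add, mul_sub, mul_smul_comm, mul_zero, add_mul, sub_mul, smul_mul_assoc, zero_mul,
    mul_assoc, hg.e_mul_self, hg.e_sq_mul, add_zero, zero_sub] at h1 h3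
  have h4 : (xi ℓ + (xi ℓ)⁻¹) • (g (e 1) * (g (e 0) * (g (e 1) * g (e 0))) -
      g (e 0) * (g (e 1) * (g (e 0) * g (e 1)))) = 0 := by
    rw [smul_sub, ← sub_eq_zero.1 h1]
    rw [← h3]; abel
  have := sub_eq_zero.1 ((smul_eq_zero.1 h4).resolve_left h2)
  simpa [eWord, mul_assoc] using this

/-- The Serre relation lets `e₂` move right past powers of `e₁` leaving at most one `e₁` behind it.
The coefficients obey a two-term recurrence, but their values are never used. -/
theorem e_mul_pow_succ (hg : Sat ℓ g) (a : ℕ) : ∃ p q : ℂ, g (e 1) * g (e 0) ^ (a + 1) =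
    p • (g (e 0) ^ (a + 1) * g (e 1)) + q • (g (e 0) ^ a * (g (e 1) * g (e 0))) := by
  induction a with
  | zero => exact ⟨0, 1, by simp⟩
  | succ a ih =>
    obtain ⟨p, q, h⟩ := ih
    refine ⟨-q, p + q * (xi ℓ + (xi ℓ)⁻¹), ?_⟩
    have h3 : g (e 0) ^ a * (g (e 1) * g (e 0)) * g (e 0) =
        (xi ℓ + (xi ℓ)⁻¹) • (g (e 0) ^ (a + 1) * (g (e 1) * g (e 0))) -
          g (e 0) ^ (a + 2) * g (e 1) := by
      rw [mul_assoc, mul_assoc, ← pow_two, hg.e_swap_sq, mul_sub, mul_smul_comm, pow_add _ a 2,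
        pow_succ _ a]
      simp only [mul_assoc]
    rw [pow_succ _ (a + 1), ← mul_assoc (g (e 1)), h, add_mul, smul_mul_assoc, smul_mul_assoc, h3, mul_assoc, smul_sub,
      smul_smul, add_smul, neg_smul, ← pow_succ]
    abel

theorem torus_mul_filt (hg : Sat ℓ g) {κ x : A} {n : ℕ} (hκ : κ ∈ torus g) (hx : x ∈ filt g n) :
    κ * x ∈ filt g n := by
  induction hx using Submodule.span_induction with
  | mem x hx =>
    obtain ⟨a, j, κ', hκ', hn, rfl⟩ := hx
    obtain ⟨c, _, hc⟩ := hg.torus_positive hκ (mul_mem (pow_mem (e_mem_positive g 0) a)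
      (eWord_mem_positive g j))
    rw [← mul_assoc, hc, smul_mul_assoc, mul_assoc _ κ]
    exact Submodule.smul_mem _ _ (mem_filt j (mul_mem hκ hκ') hn)
  | zero => simp
  | add x y _ _ h1 h2 => rw [mul_add]; exact add_mem h1 h2
  | smul c x _ h => rw [mul_smul_comm]; exact Submodule.smul_mem _ _ h

theorem filt_mul_torus {κ x : A} {n : ℕ} (hκ : κ ∈ torus g) (hx : x ∈ filt g n) :
    x * κ ∈ filt g n := by
  induction hx using Submodule.span_induction with
  | mem x hx =>
    obtain ⟨a, j, κ', hκ', hn, rfl⟩ := hx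
    rw [mul_assoc]
    exact mem_filt j (mul_mem hκ' hκ) hn
  | zero => simp
  | add x y _ _ h1 h2 => rw [add_mul]; exact add_mem h1 h2
  | smul c x _ h => rw [smul_mul_assoc]; exact Submodule.smul_mem _ _ h

/-- Four words suffice because, once `e₂` has passed `e₁^a`, the result is `e₂` or `e₂e₁` in front
of a listed word: `e₂² = 0` kills it or it is listed again, possibly after moving an `e₁` past
`e₂e₁e₂`, with which it commutes. -/
theorem e_mul_filt (hg : Sat ℓ g) (h2 : xi ℓ + (xi ℓ)⁻¹ ≠ 0) (i : Fin 2) {x : A} {n : ℕ}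
    (hx : x ∈ filt g n) : g (e i) * x ∈ filt g (n + 1) := by
  induction hx using Submodule.span_induction with
  | mem x hx =>
    obtain ⟨a, j, κ, hκ, hn, rfl⟩ := hx
    fin_cases i
    · show g (e 0) * _ ∈ _
      rw [← mul_assoc, ← mul_assoc, ← pow_succ']
      exact mem_filt j hκ (by omega)
    show g (e 1) * _ ∈ _
    have m := fun (a : ℕ) (j : Fin 4) (h : a + j ≤ n + 1) => mem_filt j hκ h
    have hw := hg.eWord_three_comm h2
    have e2 := hg.e_sq_mul
    have e2' := hg.e_mul_self
    rcases a with _ | a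
    · fin_cases j
      · simpa [eWord] using m 0 1 (by simp)
      · simp [eWord, ← mul_assoc, e2']
      · simp [eWord, ← mul_assoc, e2']
      · simp [eWord, ← mul_assoc, e2']
    obtain ⟨p, q, h⟩ := hg.e_mul_pow_succ a
    rw [← mul_assoc, ← mul_assoc, h]
    fin_cases j
    · have h1 := m (a + 1) 1 (by simpa using hn)
      have h2 := m a 2 (by simp at hn ⊢; omega)
      simpa [eWord, add_mul] using
        add_mem (Submodule.smul_mem _ p h1) (Submodule.smul_mem _ q h2)
    · have h1 := m a 3 (by simp at hn ⊢; omega)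
      simpa [eWord, add_mul, mul_assoc, e2', e2] using Submodule.smul_mem _ q h1
    · have h1 := m (a + 1) 3 (by simp at hn ⊢; omega)
      rw [pow_succ, mul_assoc (_ ^ a), ← hw] at h1
      simpa [eWord, add_mul, mul_assoc, e2', e2] using Submodule.smul_mem _ q h1
    -- Here `(e₂e₁e₂)e₁e₂ = e₁(e₂e₁e₂)e₂ = 0`.
    · have h3 : g (e 1) * (g (e 0) * (g (e 1) * (g (e 0) * (g (e 1) * κ)))) = 0 := by
        have := congrArg (fun z => z * (g (e 1) * κ)) hw
        simpa [eWord, mul_assoc, e2] using this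
      simp [eWord, add_mul, mul_assoc, e2, h3]
  | zero => simp
  | add x y _ _ h1 h2 => rw [mul_add]; exact add_mem h1 h2
  | smul c x _ h => rw [mul_smul_comm]; exact Submodule.smul_mem _ _ h

theorem exists_mem_filt (hg : Sat ℓ g) (h2 : xi ℓ + (xi ℓ)⁻¹ ≠ 0) {x : A} (hx : x ∈ positive g) :
    ∃ n, x ∈ filt g n := by
  have key : ∀ y : A, (∃ n, y ∈ filt g n) → ∃ n, x * y ∈ filt g n := by
    induction hx using Submonoid.closure_induction with
    | mem x hx =>
      rintro y ⟨n, hy⟩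
      rcases hx with hx | ⟨i, rfl⟩
      · exact ⟨n, hg.torus_mul_filt hx hy⟩
      · exact ⟨n + 1, hg.e_mul_filt h2 i hy⟩
    | one => simp
    | mul x z _ _ h3 h4 =>
      intro y hy
      rw [mul_assoc]
      exact h3 _ (h4 _ hy)
  simpa using key 1 ⟨0, torus_mem_filt (one_mem _) 0⟩

/-- Since `e₁^ℓ = 0`, a nonzero word has `a ≤ ℓ - 1` and `j ≤ 3`, so the only one of degree
exceeding `ℓ + 1` is `e₁^{ℓ-1} e₂e₁e₂`. -/
theorem filt_le (hg : Sat ℓ g) (n : ℕ) : filt g n ≤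
    filt g (ℓ + 1) ⊔ Submodule.span ℂ {x | ∃ κ ∈ torus g, x = eTop ℓ g * κ} := by
  refine Submodule.span_le.2 ?_
  rintro _ ⟨a, j, κ, hκ, _, rfl⟩
  by_cases ha : ℓ ≤ a
  · obtain ⟨b, rfl⟩ := Nat.exists_eq_add_of_le ha
    simp [pow_add, hg .e_pow]
  by_cases h : a + j ≤ ℓ + 1
  · exact Submodule.mem_sup_left (mem_filt j hκ h)
  · have hj : j = 3 := by omega
    have ha' : a = ℓ - 1 := by omega
    subst hj ha'
    exact Submodule.mem_sup_right (Submodule.subset_span ⟨κ, hκ, rfl⟩)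

end Sat

end Positive

/-! ## The antiautomorphism exchanging `e_i` and `f_i k_i⁻¹` -/

section TauGen

variable {A : Type*} [Ring A] [Algebra ℂ A] {ℓ : ℕ}

/-- The values on generators of the antiautomorphism `e_i ↦ f_i k_i⁻¹`, `f_i ↦ ξ^{a_ii} e_i k_i`,
`k_i ↦ k_i`, `σ ↦ σ`. -/
def tauGen (ℓ : ℕ) (g : Gen → A) : Gen → Aᵐᵒᵖ
  | .e i => MulOpposite.op (g (f i) * g (kinv i))
  | .f i => MulOpposite.op (xi ℓ ^ cartan i i • (g (e i) * g (k i)))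
  | .k i => MulOpposite.op (g (k i))
  | .kinv i => MulOpposite.op (g (kinv i))
  | .sigma => MulOpposite.op (g sigma)

theorem Sat.k_mul_e {g : Gen → A} (hg : Sat ℓ g) (i j : Fin 2) :
    g (k i) * g (e j) = xi ℓ ^ cartan i j • (g (e j) * g (k i)) := by
  rw [hg.e_k, smul_smul, ← zpow_add₀ (xi_ne_zero ℓ)]; simp

theorem Sat.kinv_mul_e {g : Gen → A} (hg : Sat ℓ g) (i j : Fin 2) :
    g (kinv i) * g (e j) = xi ℓ ^ (-cartan i j) • (g (e j) * g (kinv i)) := by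
  rw [hg.e_kinv, smul_smul, ← zpow_add₀ (xi_ne_zero ℓ)]; simp

theorem Sat.k_mul_f {g : Gen → A} (hg : Sat ℓ g) (i j : Fin 2) :
    g (k i) * g (f j) = xi ℓ ^ (-cartan i j) • (g (f j) * g (k i)) := by
  rw [hg.f_k, smul_smul, ← zpow_add₀ (xi_ne_zero ℓ)]; simp

theorem Sat.kinv_mul_f {g : Gen → A} (hg : Sat ℓ g) (i j : Fin 2) :
    g (kinv i) * g (f j) = xi ℓ ^ cartan i j • (g (f j) * g (kinv i)) := by
  rw [hg.f_kinv, smul_smul, ← zpow_add₀ (xi_ne_zero ℓ)]; simp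

/-- The normalisation `ξ^{a_ii}` of the image of `f_i` compensates for moving `k_i` past `e_i` or
`f_i`. It is forced by the relation between `e₁` and `f₁`, and it also makes `τ` an involution. -/
theorem sat_tauGen {g : Gen → A} (hg : Sat ℓ g) : Sat ℓ (tauGen ℓ g) := by
  have hx := xi_ne_zero ℓ
  have hkk := hg.kk 1 0
  have hkk' := hg.kinv_kinv 1 0
  have sk : ∀ i, g (k i) * g sigma = g sigma * g (k i) := fun i => (hg (.sigma_k i)).symm
  have skinv : ∀ i, g (kinv i) * g sigma = g sigma * g (kinv i) := fun i => (hg.sigma_kinv i).symm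
  intro a b r
  apply MulOpposite.unop_injective
  cases r with
  | k_comm => simpa [tauGen] using hkk
  | k_kinv i => simp [tauGen, hg (.kinv_k i)]
  | kinv_k i => simp [tauGen, hg (.k_kinv i)]
  | k_e i j =>
    have : g (kinv i) * (g (f j) * g (kinv j) * g (k i)) =
        xi ℓ ^ cartan i j • (g (f j) * g (kinv j)) := by
      rw [← mul_assoc, ← mul_assoc, hg.kinv_mul_f, smul_mul_assoc, smul_mul_assoc,
        mul_assoc (g (f j)), hg.kinv_kinv, mul_assoc, mul_assoc, hg (.kinv_k i), mul_one]
    simpa [tauGen] using this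
  | k_f i j =>
    have : g (kinv i) * (g (e j) * g (k j) * g (k i)) =
        xi ℓ ^ (-cartan i j) • (g (e j) * g (k j)) := by
      rw [← mul_assoc, ← mul_assoc, hg.kinv_mul_e, smul_mul_assoc, smul_mul_assoc,
        mul_assoc (g (e j)), ← hg.k_kinv_comm, mul_assoc, mul_assoc, hg (.kinv_k i), mul_one]
    simp only [tauGen, MulOpposite.unop_mul, MulOpposite.unop_op, smul_mul_assoc, mul_smul_comm,
      this, MulOpposite.unop_smul]
    rw [smul_comm]
  | e_f_one =>
    have e1 := hg .e_f_one
    have e2 : xi ℓ ^ 2 • (g (e 0) * (g (k 0) * (g (f 0) * g (kinv 0)))) = g (e 0) * g (f 0) := by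
      simp [assoc_of_qcomm (hg.k_mul_f _ _), hg (.k_kinv _), cartan, smul_smul, hx]
    have e3 : xi ℓ ^ 2 • (g (f 0) * (g (kinv 0) * (g (e 0) * g (k 0)))) = g (f 0) * g (e 0) := by
      simp [assoc_of_qcomm (hg.kinv_mul_e _ _), hg (.kinv_k _), cartan, smul_smul, hx]
    simpa [tauGen, cartan, mul_assoc, e2, e3] using e1
  | e_f_two =>
    have e1 := hg .e_f_two
    have e2 : g (e 1) * (g (k 1) * (g (f 1) * g (kinv 1))) = g (e 1) * g (f 1) := by
      simp [assoc_of_qcomm (hg.k_mul_f _ _), hg (.k_kinv _), cartan]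
    have e3 : g (f 1) * (g (kinv 1) * (g (e 1) * g (k 1))) = g (f 1) * g (e 1) := by
      simp [assoc_of_qcomm (hg.kinv_mul_e _ _), hg (.kinv_k _), cartan]
    simpa [tauGen, cartan, mul_assoc, e2, e3] using e1
  | e_f_one_two =>
    have e1 := sub_eq_zero.1 (hg .e_f_two_one)
    simp [tauGen, mul_assoc, assoc_of_qcomm (hg.k_mul_f _ _), assoc_of_qcomm (hg.kinv_mul_e _ _),
      cartan, hg.k_kinv_comm, assoc_of_comm e1]
  | e_f_two_one =>
    have e1 := sub_eq_zero.1 (hg .e_f_one_two)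
    simp [tauGen, mul_assoc, assoc_of_qcomm (hg.k_mul_f _ _), assoc_of_qcomm (hg.kinv_mul_e _ _),
      cartan, hg.k_kinv_comm, assoc_of_comm e1]
  | e_sq =>
    have := hg .f_sq
    rw [pow_two] at this
    simp [tauGen, pow_two, assoc_of_qcomm (hg.kinv_mul_f _ _), ← mul_assoc, this]
  | f_sq =>
    have := hg .e_sq
    rw [pow_two] at this
    simp [tauGen, pow_two, assoc_of_qcomm (hg.k_mul_e _ _), ← mul_assoc, this]
  | serre_e =>
    have := congrArg (fun z => z * (g (kinv 1) * (g (kinv 0) * g (kinv 0)))) (hg .serre_f)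
    simp only [add_mul, sub_mul, smul_mul_assoc, zero_mul, pow_two, mul_assoc] at this
    simp only [MulOpposite.unop_zero]
    rw [← this]
    simp [tauGen, pow_two, mul_assoc, assoc_of_qcomm (hg.kinv_mul_f _ _), smul_smul, cartan,
      hkk', assoc_of_comm hkk']
    match_scalars <;> field_simp
  | serre_f =>
    -- The factor `ξ⁴` comes from the two occurrences of `f₁`, each sent to `ξ² e₁k₁`.
    have := congrArg (fun z => xi ℓ ^ 4 • (z * (g (k 1) * (g (k 0) * g (k 0))))) (hg .serre_e)
    simp only [add_mul, sub_mul, smul_mul_assoc, zero_mul, pow_two, mul_assoc, smul_zero] at this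
    simp only [MulOpposite.unop_zero]
    rw [← this]
    simp [tauGen, pow_two, mul_assoc, assoc_of_qcomm (hg.k_mul_e _ _), smul_smul, cartan,
      hkk, assoc_of_comm hkk]
    match_scalars <;> field_simp
  | e_pow =>
    obtain ⟨c, hc⟩ := mul_pow_eq_smul (hg.kinv_mul_f 0 0) ℓ
    simp [tauGen, hc, hg .f_pow]
  | f_pow =>
    obtain ⟨c, hc⟩ := mul_pow_eq_smul (hg.k_mul_e 0 0) ℓ
    simp [tauGen, smul_pow, hc, hg .e_pow]
  | sigma_sq => simp [tauGen, hg .sigma_sq]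
  | sigma_k i => simp [tauGen, sk]
  | sigma_e i =>
    fin_cases i <;>
    simp [tauGen, deg, mul_assoc, skinv, assoc_of_qcomm (hg.f_sigma _)]
  | sigma_f i =>
    fin_cases i <;>
    simp [tauGen, deg, mul_assoc, sk, assoc_of_qcomm (hg.e_sigma _)]

end TauGen

/-! ### The involution `τ` on `𝒰_α` and its compatibility with the coproduct -/

section Lift

variable {ℓ : ℕ} {α : G} {A : Type*} [Ring A] [Algebra ℂ A]

/-- The homomorphism from `𝒰_α` with given values on the generators. -/
def Ualpha.liftGen (g : Gen → A) (hg : Sat ℓ g)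
    (hk : ∀ i, g (k i) ^ ℓ = algebraMap ℂ A (xiPowEll (α i))) : Ualpha ℓ α →ₐ[ℂ] A :=
  Ualpha.lift (Usigma.lift g hg) fun i => by rw [Usigma.lift_gen, hk]

theorem Ualpha.liftGen_ugen (g : Gen → A) (hg : Sat ℓ g)
    (hk : ∀ i, g (k i) ^ ℓ = algebraMap ℂ A (xiPowEll (α i))) (x : Gen) :
    Ualpha.liftGen g hg hk (ugen ℓ α x) = g x := by
  rw [ugen, Ualpha.liftGen, Ualpha.lift_proj, Usigma.lift_gen]

end Lift

section Tau

variable {ℓ : ℕ} {α β γ : G}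

/-- The antiautomorphism `e_i ↦ f_i k_i⁻¹` of `𝒰_α`, as a homomorphism to the opposite algebra. -/
def Ualpha.tauOp (ℓ : ℕ) (α : G) : Ualpha ℓ α →ₐ[ℂ] (Ualpha ℓ α)ᵐᵒᵖ :=
  Ualpha.liftGen (tauGen ℓ (ugen ℓ α)) (sat_tauGen (sat_ugen ℓ α)) fun i => by
    rw [tauGen, ← MulOpposite.op_pow, ugen_k_pow]; rfl

/-- The antiautomorphism `e_i ↦ f_i k_i⁻¹` of `𝒰_α`, as a linear map. -/
def Ualpha.tau (ℓ : ℕ) (α : G) : Ualpha ℓ α →ₗ[ℂ] Ualpha ℓ α :=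
  (MulOpposite.opLinearEquiv ℂ).symm.toLinearMap ∘ₗ (Ualpha.tauOp ℓ α).toLinearMap

open Ualpha

theorem tau_ugen (x : Gen) : tau ℓ α (ugen ℓ α x) = (tauGen ℓ (ugen ℓ α) x).unop := by
  show MulOpposite.unop (tauOp ℓ α (ugen ℓ α x)) = _
  rw [tauOp, liftGen_ugen]

theorem tau_mul (x y : Ualpha ℓ α) : tau ℓ α (x * y) = tau ℓ α y * tau ℓ α x := by
  simp [tau]

theorem tau_one : tau ℓ α 1 = 1 := by
  simp [tau]

theorem tau_pow (x : Ualpha ℓ α) (n : ℕ) : tau ℓ α (x ^ n) = tau ℓ α x ^ n := by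
  induction n with
  | zero => simp [tau_one]
  | succ n ih => rw [pow_succ, tau_mul, ih, pow_succ']

theorem tau_tau (x : Ualpha ℓ α) : tau ℓ α (tau ℓ α x) = x := by
  have hs := sat_ugen ℓ α
  induction x using Ualpha.induction with
  | hc c => simp [Algebra.algebraMap_eq_smul_one, tau_one]
  | hm x y h1 h2 => rw [tau_mul, tau_mul, h1, h2]
  | ha x y h1 h2 => rw [map_add, map_add, h1, h2]
  | hg x =>
    rw [tau_ugen]
    cases x with
    | e i =>
      simp [tauGen, tau_mul, tau_ugen, assoc_of_qcomm (hs.kinv_mul_e _ _), smul_smul,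
        hs (.kinv_k _), mul_inv_cancel₀ (zpow_ne_zero _ (xi_ne_zero ℓ))]
    | f i =>
      simp [tauGen, tau_mul, tau_ugen, assoc_of_qcomm (hs.k_mul_f _ _), smul_smul,
        hs (.k_kinv _), mul_inv_cancel₀ (zpow_ne_zero _ (xi_ne_zero ℓ))]
    | k i => simp [tauGen, tau_ugen]
    | kinv i => simp [tauGen, tau_ugen]
    | sigma => simp [tauGen, tau_ugen]

theorem tau_torus {κ : Ualpha ℓ α} (hκ : κ ∈ torus (ugen ℓ α)) : tau ℓ α κ = κ := by
  have hs := sat_ugen ℓ α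
  induction hκ using Submonoid.closure_induction with
  | mem x hx => rcases hx with ⟨i, rfl⟩ | ⟨i, rfl⟩ | rfl <;> simp [tau_ugen, tauGen]
  | one => exact tau_one
  | mul x y hx hy h1 h2 => rw [tau_mul, h1, h2, hs.torus_comm hx hy]

theorem map_tau_mul (s t : Ualpha ℓ α ⊗[ℂ] Ualpha ℓ β) :
    TensorProduct.map (tau ℓ α) (tau ℓ β) (s * t) =
      TensorProduct.map (tau ℓ α) (tau ℓ β) t * TensorProduct.map (tau ℓ α) (tau ℓ β) s := by
  induction s with
  | zero => simp
  | add s₁ s₂ h₁ h₂ => simp only [add_mul, mul_add, map_add, h₁, h₂]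
  | tmul x y =>
    induction t with
    | zero => simp
    | add t₁ t₂ h₁ h₂ => simp only [add_mul, mul_add, map_add, h₁, h₂]
    | tmul z w => simp [tau_mul]

/-- Although `τ` reverses products, it does not flip tensor factors: `f_i k_i⁻¹` has coproduct `f_i
k_i⁻¹ ⊗ 1 + k_i⁻¹σ^{d_i} ⊗ f_i k_i⁻¹`, of the same shape as that of `e_i`. This is what lets `τ`
carry right integrals to right integrals. -/
theorem comul_tau (hℓ : Odd ℓ) (h : γ = α + β) (x : Ualpha ℓ γ) :
    comul hℓ h (tau ℓ γ x) = TensorProduct.map (tau ℓ α) (tau ℓ β) (comul hℓ h x) := by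
  have hα := sat_ugen ℓ α
  have hβ := sat_ugen ℓ β
  induction x using Ualpha.induction with
  | hc c => simp [Algebra.algebraMap_eq_smul_one, tau_one, Algebra.TensorProduct.one_def]
  | hm x y h1 h2 => rw [tau_mul, map_mul, map_mul, map_tau_mul, h1, h2]
  | ha x y h1 h2 => simp only [map_add, h1, h2]
  | hg x =>
    cases x with
    | k i => simp [tau_ugen, tauGen, comul_ugen, comulGen]
    | kinv i => simp [tau_ugen, tauGen, comul_ugen, comulGen]
    | sigma => simp [tau_ugen, tauGen, comul_ugen, comulGen]
    | e i =>
      fin_cases i <;>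
      simp [tau_ugen, tauGen, comul_ugen, comulGen, tau_mul, tau_one, add_mul, hβ (.k_kinv _), deg]
    | f i =>
      have h1 : ugen ℓ α (kinv i) * ugen ℓ α sigma ^ deg i * ugen ℓ α (k i) =
          ugen ℓ α sigma ^ deg i := by
        rw [← hα.k_mul_comm, hα.k_kinv_cancel]
      have h2 : tau ℓ α (ugen ℓ α sigma ^ deg i) = ugen ℓ α sigma ^ deg i := by
        rw [tau_pow, tau_ugen]; rfl
      simp [tau_ugen, tauGen, comul_ugen, comulGen, add_mul, TensorProduct.smul_tmul', h1, h2]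

end Tau

open Gen Ualpha

/-! ## Triangular decomposition -/

section Triangular

variable {A : Type*} [Ring A] [Algebra ℂ A] {ℓ : ℕ} {g : Gen → A}

theorem mul_mem_span_positive {x y : A} (hx : x ∈ Submodule.span ℂ (positive g : Set A))
    (hy : y ∈ Submodule.span ℂ (positive g : Set A)) :
    x * y ∈ Submodule.span ℂ (positive g : Set A) := by
  have := Submodule.mul_mem_mul hx hy
  rwa [Submodule.span_mul_span, Submonoid.coe_mul_self_eq] at this

theorem Sat.f_mul_e (hg : Sat ℓ g) (i j : Fin 2) :
    ∃ (c : ℂ) (t : A), t ∈ Submodule.span ℂ (positive g : Set A) ∧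
      g (f i) * g (e j) = c • (g (e j) * g (f i)) + t := by
  have hk : ∀ i, (xi ℓ - (xi ℓ)⁻¹)⁻¹ • (g (k i) - g (kinv i)) ∈
      Submodule.span ℂ (positive g : Set A) := fun i =>
    Submodule.smul_mem _ _ (sub_mem
      (Submodule.subset_span (torus_le_positive g (k_mem_torus g i)))
      (Submodule.subset_span (torus_le_positive g (kinv_mem_torus g i))))
  fin_cases i <;> fin_cases j
  · exact ⟨1, _, neg_mem (hk 0), by rw [← hg .e_f_one]; simp⟩
  · exact ⟨1, 0, zero_mem _, by simp [sub_eq_zero.1 (hg .e_f_two_one)]⟩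
  · exact ⟨1, 0, zero_mem _, by simp [sub_eq_zero.1 (hg .e_f_one_two)]⟩
  · exact ⟨-1, _, hk 1, by rw [← hg .e_f_two]; simp⟩

/-- Commuting `f_i` past `e_j` costs only torus terms, so `τ(e_i) = f_i k_i⁻¹` can be carried to the
right of a positive monomial with a purely positive error. -/
theorem Sat.f_kinv_mul_positive (hg : Sat ℓ g) (i : Fin 2) {v : A} (hv : v ∈ positive g) :
    ∃ p ∈ Submodule.span ℂ (positive g : Set A), ∃ q ∈ Submodule.span ℂ (positive g : Set A),
      g (f i) * g (kinv i) * v = p + q * (g (f i) * g (kinv i)) := by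
  induction hv using Submonoid.closure_induction with
  | mem x hx =>
    rcases hx with hx | ⟨j, rfl⟩
    · obtain ⟨c, _, hc⟩ := ((hg.torus_f hx i).symm).mul_left
        (.of_commute (hg.torus_comm (kinv_mem_torus g i) hx))
      exact ⟨0, zero_mem _, c • x,
        Submodule.smul_mem _ _ (Submodule.subset_span (torus_le_positive g hx)), by
          rw [hc, zero_add, smul_mul_assoc]⟩
    · obtain ⟨c, t, ht, h⟩ := hg.f_mul_e i j
      refine ⟨xi ℓ ^ (-cartan i j) • (t * g (kinv i)), Submodule.smul_mem _ _
        (mul_mem_span_positive ht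
          (Submodule.subset_span (torus_le_positive g (kinv_mem_torus g i)))),
        (xi ℓ ^ (-cartan i j) * c) • g (e j),
        Submodule.smul_mem _ _ (Submodule.subset_span (e_mem_positive g j)), ?_⟩
      rw [mul_assoc, hg.kinv_mul_e, mul_smul_comm, ← mul_assoc, h, add_mul, smul_mul_assoc,
        smul_mul_assoc, smul_add, smul_smul, mul_assoc, add_comm]
  | one => exact ⟨0, zero_mem _, 1, Submodule.subset_span (one_mem _), by simp⟩
  | mul x y _ _ h1 h2 =>
    obtain ⟨p, hp, q, hq, h⟩ := h1
    obtain ⟨p', hp', q', hq', h'⟩ := h2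
    have hy : y ∈ Submodule.span ℂ (positive g : Set A) := Submodule.subset_span (by assumption)
    refine ⟨p * y + q * p', add_mem (mul_mem_span_positive hp hy) (mul_mem_span_positive hq hp'),
      q * q', mul_mem_span_positive hq hq', ?_⟩
    rw [← mul_assoc, h, add_mul, mul_assoc q, h', mul_add, add_assoc, mul_assoc q]

variable {α : G}

/-- The span of the products `v τ(v')`, with `v` and `v'` monomials in `k_i^{±1}`, `σ`, `e_i`. -/
def triangular (ℓ : ℕ) (α : G) : Submodule ℂ (Ualpha ℓ α) :=
  Submodule.span ℂ {x | ∃ v ∈ positive (ugen ℓ α), ∃ v' ∈ positive (ugen ℓ α), x = v * tau ℓ α v'}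

theorem mul_tau_mem_triangular {p v : Ualpha ℓ α}
    (hp : p ∈ Submodule.span ℂ (positive (ugen ℓ α) : Set (Ualpha ℓ α)))
    (hv : v ∈ positive (ugen ℓ α)) : p * tau ℓ α v ∈ triangular ℓ α := by
  induction hp using Submodule.span_induction with
  | mem x hx => exact Submodule.subset_span ⟨x, hx, v, hv, rfl⟩
  | zero => simp
  | add x y _ _ h1 h2 => rw [add_mul]; exact add_mem h1 h2
  | smul c x _ h => rw [smul_mul_assoc]; exact Submodule.smul_mem _ _ h

theorem mul_mem_triangular_of {y : Ualpha ℓ α}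
    (h : ∀ v ∈ positive (ugen ℓ α), ∀ v' ∈ positive (ugen ℓ α),
      y * (v * tau ℓ α v') ∈ triangular ℓ α) {x : Ualpha ℓ α}
    (hx : x ∈ triangular ℓ α) : y * x ∈ triangular ℓ α := by
  induction hx using Submodule.span_induction with
  | mem x hx =>
    obtain ⟨v, hv, v', hv', rfl⟩ := hx
    exact h v hv v' hv'
  | zero => simp
  | add x y _ _ h1 h2 => rw [mul_add]; exact add_mem h1 h2
  | smul c x _ h => rw [mul_smul_comm]; exact Submodule.smul_mem _ _ h

/-- The span contains `1`, so it is enough that it be a left ideal. Only `f_i = τ(e_i) k_i` needs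
work: `τ(e_i)` is carried through `v` and absorbed as `τ(e_i) τ(v') = τ(v' e_i)`. -/
theorem triangular_eq_top (ℓ : ℕ) (α : G) : triangular ℓ α = ⊤ := by
  have hs := sat_ugen ℓ α
  have hpos : ∀ y ∈ positive (ugen ℓ α), ∀ x ∈ triangular ℓ α, y * x ∈ triangular ℓ α :=
    fun y hy x => mul_mem_triangular_of fun v hv v' hv' => by
      rw [← mul_assoc]
      exact Submodule.subset_span ⟨_, mul_mem hy hv, v', hv', rfl⟩
  have key : ∀ y : Ualpha ℓ α, ∀ x ∈ triangular ℓ α, y * x ∈ triangular ℓ α := by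
    intro y
    induction y using Ualpha.induction with
    | hc c =>
      intro x hx
      rw [← Algebra.smul_def]
      exact Submodule.smul_mem _ _ hx
    | hm a b h1 h2 =>
      intro x hx
      rw [mul_assoc]
      exact h1 _ (h2 _ hx)
    | ha a b h1 h2 =>
      intro x hx
      rw [add_mul]
      exact add_mem (h1 _ hx) (h2 _ hx)
    | hg y =>
      cases y with
      | e i => exact hpos _ (e_mem_positive _ i)
      | k i => exact hpos _ (torus_le_positive _ (k_mem_torus _ i))
      | kinv i => exact hpos _ (torus_le_positive _ (kinv_mem_torus _ i))
      | sigma => exact hpos _ (torus_le_positive _ (sigma_mem_torus _))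
      | f i =>
        intro x hx
        have h1 : ugen ℓ α (f i) * x =
            ugen ℓ α (f i) * ugen ℓ α (kinv i) * (ugen ℓ α (k i) * x) := by
          rw [mul_assoc, hs.kinv_k_cancel]
        rw [h1]
        refine mul_mem_triangular_of (fun v hv v' hv' => ?_)
          (hpos _ (torus_le_positive _ (k_mem_torus _ i)) x hx)
        obtain ⟨p, hp, q, hq, h⟩ := hs.f_kinv_mul_positive i hv
        rw [← mul_assoc, h, add_mul]
        refine add_mem (mul_tau_mem_triangular hp hv') ?_
        have h2 : ugen ℓ α (f i) * ugen ℓ α (kinv i) * tau ℓ α v' =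
            tau ℓ α (v' * ugen ℓ α (e i)) := by
          rw [tau_mul, tau_ugen]; rfl
        rw [mul_assoc, h2]
        exact mul_tau_mem_triangular hq (mul_mem hv' (e_mem_positive _ i))
  refine eq_top_iff.2 fun x _ => ?_
  simpa using key x 1 (Submodule.subset_span ⟨1, one_mem _, 1, one_mem _, by simp [tau_one]⟩)

end Triangular

/-! ## Two three-dimensional representations of `𝒰_0` -/

section Rep

/-- The vector representation of `𝒰_0`, on generators. -/
def repVec (ℓ : ℕ) : Gen → Matrix (Fin 3) (Fin 3) ℂ
  | .e i => ![!![0, 1, 0; 0, 0, 0; 0, 0, 0], !![0, 0, 0; 0, 0, 1; 0, 0, 0]] i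
  | .f i => ![!![0, 0, 0; 1, 0, 0; 0, 0, 0], !![0, 0, 0; 0, 0, 0; 0, 1, 0]] i
  | .k i => ![!![xi ℓ, 0, 0; 0, (xi ℓ)⁻¹, 0; 0, 0, 1], !![1, 0, 0; 0, xi ℓ, 0; 0, 0, xi ℓ]] i
  | .kinv i => ![!![(xi ℓ)⁻¹, 0, 0; 0, xi ℓ, 0; 0, 0, 1],
      !![1, 0, 0; 0, (xi ℓ)⁻¹, 0; 0, 0, (xi ℓ)⁻¹]] i
  | .sigma => !![1, 0, 0; 0, 1, 0; 0, 0, -1]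

/-- A representation of `𝒰_0` dual to the vector representation, on generators. -/
def repCovec (ℓ : ℕ) : Gen → Matrix (Fin 3) (Fin 3) ℂ
  | .e i => ![!![0, 0, 0; 0, 0, 1; 0, 0, 0], !![0, 1, 0; 0, 0, 0; 0, 0, 0]] i
  | .f i => ![!![0, 0, 0; 0, 0, 0; 0, 1, 0], !![0, 0, 0; -1, 0, 0; 0, 0, 0]] i
  | .k i => ![!![1, 0, 0; 0, xi ℓ, 0; 0, 0, (xi ℓ)⁻¹],
      !![(xi ℓ)⁻¹, 0, 0; 0, (xi ℓ)⁻¹, 0; 0, 0, 1]] i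
  | .kinv i => ![!![1, 0, 0; 0, (xi ℓ)⁻¹, 0; 0, 0, xi ℓ], !![xi ℓ, 0, 0; 0, xi ℓ, 0; 0, 0, 1]] i
  | .sigma => !![-1, 0, 0; 0, 1, 0; 0, 0, 1]

theorem xi_pow (ℓ : ℕ) (hℓ : ℓ ≠ 0) : xi ℓ ^ ℓ = 1 :=
  (Complex.isPrimitiveRoot_exp ℓ hℓ).pow_eq_one

theorem xi_sub_inv_ne_zero {ℓ : ℕ} (hℓ : 3 ≤ ℓ) : xi ℓ - (xi ℓ)⁻¹ ≠ 0 := by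
  intro h
  have h1 : xi ℓ ^ 2 = 1 := by
    have := congrArg (xi ℓ * ·) h
    simp only [mul_sub, mul_inv_cancel₀ (xi_ne_zero ℓ), mul_zero] at this
    linear_combination this
  exact (Complex.isPrimitiveRoot_exp ℓ (by omega)).pow_ne_one_of_pos_of_lt (l := 2) (by omega)
    (by omega) h1

theorem matrix_pow_eq_zero {ℓ : ℕ} (hℓ : 3 ≤ ℓ) {M : Matrix (Fin 3) (Fin 3) ℂ} (hM : M * M = 0) :
    M ^ ℓ = 0 := by
  obtain ⟨n, rfl⟩ := Nat.exists_eq_add_of_le hℓ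
  rw [show 3 + n = 2 + (1 + n) by omega, pow_add, pow_two, hM, zero_mul]

theorem xi_sub_inv_mul {ℓ : ℕ} (hℓ : 3 ≤ ℓ) :
    (xi ℓ - (xi ℓ)⁻¹)⁻¹ * ((xi ℓ)⁻¹ - xi ℓ) = -1 := by
  rw [← neg_sub (xi ℓ), mul_neg, inv_mul_cancel₀ (xi_sub_inv_ne_zero hℓ)]

set_option maxHeartbeats 1000000 in
theorem sat_repVec {ℓ : ℕ} (hℓ : 3 ≤ ℓ) : Sat ℓ (repVec ℓ) := by
  have hx := xi_ne_zero ℓ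
  have hx' := xi_sub_inv_ne_zero hℓ
  have hx'' := xi_sub_inv_mul hℓ
  intro a b r
  cases r with
  | e_pow =>
    refine matrix_pow_eq_zero hℓ ?_
    ext a b; fin_cases a <;> fin_cases b <;> simp [repVec]
  | f_pow =>
    refine matrix_pow_eq_zero hℓ ?_
    ext a b; fin_cases a <;> fin_cases b <;> simp [repVec]
  | k_e i j | k_f i j =>
    fin_cases i <;> fin_cases j <;> ext a b <;> fin_cases a <;> fin_cases b <;>
    simp [repVec, cartan, pow_two, hx]
  | k_kinv i | kinv_k i | sigma_k i | sigma_e i | sigma_f i =>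
    fin_cases i <;> ext a b <;> fin_cases a <;> fin_cases b <;>
    simp [repVec, deg, hx]
  | serre_e =>
    have h1 : repVec ℓ (e 0) * repVec ℓ (e 0) = 0 := by
      ext a b; fin_cases a <;> fin_cases b <;> simp [repVec]
    have h2 : repVec ℓ (e 0) * repVec ℓ (e 1) * repVec ℓ (e 0) = 0 := by
      ext a b; fin_cases a <;> fin_cases b <;> simp [repVec]
    simp [pow_two, h1, h2]
  | serre_f =>
    have h1 : repVec ℓ (f 0) * repVec ℓ (f 0) = 0 := by
      ext a b; fin_cases a <;> fin_cases b <;> simp [repVec]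
    have h2 : repVec ℓ (f 0) * repVec ℓ (f 1) * repVec ℓ (f 0) = 0 := by
      ext a b; fin_cases a <;> fin_cases b <;> simp [repVec]
    simp [pow_two, h1, h2]
  | e_sq | f_sq | sigma_sq =>
    ext a b; fin_cases a <;> fin_cases b <;> simp [repVec, pow_two]
  | _ =>
    ext a b; fin_cases a <;> fin_cases b <;> simp [repVec, hx, hx', hx'']

set_option maxHeartbeats 1000000 in
theorem sat_repCovec {ℓ : ℕ} (hℓ : 3 ≤ ℓ) : Sat ℓ (repCovec ℓ) := by
  have hx := xi_ne_zero ℓ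
  have hx' := xi_sub_inv_ne_zero hℓ
  have hx'' := xi_sub_inv_mul hℓ
  intro a b r
  cases r with
  | e_pow =>
    refine matrix_pow_eq_zero hℓ ?_
    ext a b; fin_cases a <;> fin_cases b <;> simp [repCovec]
  | f_pow =>
    refine matrix_pow_eq_zero hℓ ?_
    ext a b; fin_cases a <;> fin_cases b <;> simp [repCovec]
  | k_e i j | k_f i j =>
    fin_cases i <;> fin_cases j <;> ext a b <;> fin_cases a <;> fin_cases b <;>
    simp [repCovec, cartan, pow_two, hx]
  | k_kinv i | kinv_k i | sigma_k i | sigma_e i | sigma_f i =>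
    fin_cases i <;> ext a b <;> fin_cases a <;> fin_cases b <;>
    simp [repCovec, deg, hx]
  | serre_e =>
    have h1 : repCovec ℓ (e 0) * repCovec ℓ (e 0) = 0 := by
      ext a b; fin_cases a <;> fin_cases b <;> simp [repCovec]
    have h2 : repCovec ℓ (e 0) * repCovec ℓ (e 1) * repCovec ℓ (e 0) = 0 := by
      ext a b; fin_cases a <;> fin_cases b <;> simp [repCovec]
    simp [pow_two, h1, h2]
  | serre_f =>
    have h1 : repCovec ℓ (f 0) * repCovec ℓ (f 0) = 0 := by
      ext a b; fin_cases a <;> fin_cases b <;> simp [repCovec]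
    have h2 : repCovec ℓ (f 0) * repCovec ℓ (f 1) * repCovec ℓ (f 0) = 0 := by
      ext a b; fin_cases a <;> fin_cases b <;> simp [repCovec]
    simp [pow_two, h1, h2]
  | e_sq | f_sq | sigma_sq =>
    ext a b; fin_cases a <;> fin_cases b <;> simp [repCovec, pow_two]
  | _ =>
    ext a b; fin_cases a <;> fin_cases b <;> simp [repCovec, hx, hx', hx'']

theorem repVec_k_pow {ℓ : ℕ} (hℓ : 3 ≤ ℓ) (i : Fin 2) : repVec ℓ (k i) ^ ℓ =
    algebraMap ℂ _ (xiPowEll ((0 : G) i)) := by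
  have h : repVec ℓ (k i) =
      Matrix.diagonal (![![xi ℓ, (xi ℓ)⁻¹, 1], ![1, xi ℓ, xi ℓ]] i) := by
    fin_cases i <;> ext a b <;> fin_cases a <;> fin_cases b <;> simp [repVec]
  rw [h, Matrix.diagonal_pow, Pi.zero_apply, xiPowEll_zero, map_one, ← Matrix.diagonal_one]
  congr 1
  ext a
  fin_cases i <;> fin_cases a <;> simp [xi_pow ℓ (by omega)]

theorem repCovec_k_pow {ℓ : ℕ} (hℓ : 3 ≤ ℓ) (i : Fin 2) : repCovec ℓ (k i) ^ ℓ =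
    algebraMap ℂ _ (xiPowEll ((0 : G) i)) := by
  have h : repCovec ℓ (k i) =
      Matrix.diagonal (![![1, xi ℓ, (xi ℓ)⁻¹], ![(xi ℓ)⁻¹, (xi ℓ)⁻¹, 1]] i) := by
    fin_cases i <;> ext a b <;> fin_cases a <;> fin_cases b <;> simp [repCovec]
  rw [h, Matrix.diagonal_pow, Pi.zero_apply, xiPowEll_zero, map_one, ← Matrix.diagonal_one]
  congr 1
  ext a
  fin_cases i <;> fin_cases a <;> simp [xi_pow ℓ (by omega)]

end Rep

/-! ## Integrals and matrix coefficients -/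

section Coaction

variable {ℓ : ℕ} (hℓ : Odd ℓ) {α : G}

/-- `(L ⊗ id) Δ_{α,0} = L 1_0`. -/
def IsIntegralAt (L : Ualpha ℓ α →ₗ[ℂ] ℂ) : Prop :=
  ∀ x, TensorProduct.lid ℂ (Ualpha ℓ 0) (L.rTensor (Ualpha ℓ 0)
    (comul hℓ (add_zero α).symm x)) = L x • (1 : Ualpha ℓ 0)

/-- The coaction `(id ⊗ ρ) Δ_{α,0}` by a matrix representation `ρ` of `𝒰_0`. -/
def coact (α : G) (ρ : Ualpha ℓ 0 →ₐ[ℂ] Matrix (Fin 3) (Fin 3) ℂ) :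
    Ualpha ℓ α →ₐ[ℂ] Matrix (Fin 3) (Fin 3) (Ualpha ℓ α) :=
  ((matrixEquivTensor (Fin 3) ℂ (Ualpha ℓ α)).symm.toAlgHom.comp
    (Algebra.TensorProduct.map (AlgHom.id ℂ _) ρ)).comp (comul hℓ (add_zero α).symm)

variable {hℓ} {ρ : Ualpha ℓ 0 →ₐ[ℂ] Matrix (Fin 3) (Fin 3) ℂ}

/-- Applying `ρ` to the integral identity turns its right side into `L(x)` times the identity
matrix. Off-diagonal entries yield vanishing statements, diagonal ones yield eigenvalue constraints.
-/
theorem IsIntegralAt.apply_coact {L : Ualpha ℓ α →ₗ[ℂ] ℂ} (hL : IsIntegralAt hℓ L) (x : Ualpha ℓ α)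
    (a b : Fin 3) : L (coact hℓ α ρ x a b) = if a = b then L x else 0 := by
  have key : ∀ s : Ualpha ℓ α ⊗[ℂ] Ualpha ℓ 0,
      L ((matrixEquivTensor (Fin 3) ℂ (Ualpha ℓ α)).symm
        (Algebra.TensorProduct.map (AlgHom.id ℂ _) ρ s) a b) =
      ρ (TensorProduct.lid ℂ (Ualpha ℓ 0) (L.rTensor (Ualpha ℓ 0) s)) a b := by
    intro s
    induction s with
    | zero => simp
    | add s t h1 h2 => simp [h1, h2]
    | tmul y z =>
      simp [← Algebra.commutes, ← Algebra.smul_def, mul_comm]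
  rw [coact, AlgHom.comp_apply, AlgHom.comp_apply]
  refine (key _).trans ?_
  rw [hL x]
  simp [Matrix.one_apply]

theorem coact_e (i : Fin 2) (a b : Fin 3) : coact hℓ α ρ (ugen ℓ α (e i)) a b =
    (if a = b then ugen ℓ α (e i) else 0) +
      ρ (ugen ℓ 0 (e i)) a b • (ugen ℓ α (kinv i) * ugen ℓ α sigma ^ deg i) := by
  simp [coact, comul_ugen, comulGen, Matrix.one_apply, ← Algebra.commutes, ← Algebra.smul_def,
    apply_ite]

theorem coact_f (i : Fin 2) (a b : Fin 3) : coact hℓ α ρ (ugen ℓ α (f i)) a b =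
    ρ (ugen ℓ 0 (k i)) a b • ugen ℓ α (f i) +
      ρ (ugen ℓ 0 (f i)) a b • ugen ℓ α sigma ^ deg i := by
  simp [coact, comul_ugen, comulGen, ← Algebra.commutes, ← Algebra.smul_def]

theorem coact_k (i : Fin 2) (a b : Fin 3) : coact hℓ α ρ (ugen ℓ α (k i)) a b =
    ρ (ugen ℓ 0 (k i)) a b • ugen ℓ α (k i) := by
  simp [coact, comul_ugen, comulGen, ← Algebra.commutes, ← Algebra.smul_def]

theorem coact_kinv (i : Fin 2) (a b : Fin 3) : coact hℓ α ρ (ugen ℓ α (kinv i)) a b =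
    ρ (ugen ℓ 0 (kinv i)) a b • ugen ℓ α (kinv i) := by
  simp [coact, comul_ugen, comulGen, ← Algebra.commutes, ← Algebra.smul_def]

theorem coact_sigma (a b : Fin 3) : coact hℓ α ρ (ugen ℓ α sigma) a b =
    ρ (ugen ℓ 0 sigma) a b • ugen ℓ α sigma := by
  simp [coact, comul_ugen, comulGen, ← Algebra.commutes, ← Algebra.smul_def]

end Coaction

/-! ## Vanishing of integrals below the top degree -/

section Vanishing

variable {ℓ : ℕ} {hℓ : Odd ℓ} {α : G}

/-- The part of a matrix used below: the last two columns of a block upper triangular matrix with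
`v` on the diagonal and `d` above it. -/
structure UpperEntries (R : Ualpha ℓ α →ₐ[ℂ] Matrix (Fin 3) (Fin 3) (Ualpha ℓ α))
    (v d : Ualpha ℓ α) : Prop where
  h10 : R v 1 0 = 0
  h11 : R v 1 1 = v
  h12 : R v 1 2 = d
  h20 : R v 2 0 = 0
  h21 : R v 2 1 = 0
  h22 : R v 2 2 = v

/-- The last column of `R y` is `(0, 0, c y)`. -/
structure LowerColumn (R : Ualpha ℓ α →ₐ[ℂ] Matrix (Fin 3) (Fin 3) (Ualpha ℓ α))
    (y : Ualpha ℓ α) (c : ℂ) : Prop where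
  h02 : R y 0 2 = 0
  h12 : R y 1 2 = 0
  h22 : R y 2 2 = c • y

variable {R : Ualpha ℓ α →ₐ[ℂ] Matrix (Fin 3) (Fin 3) (Ualpha ℓ α)}

/-- The entry `d` obeys the Leibniz rule without twist, because both diagonal entries are `v`
itself. It plays the role of a derivative of `v` in `e_p`. -/
theorem UpperEntries.mul {v d v' d' : Ualpha ℓ α} (h : UpperEntries R v d)
    (h' : UpperEntries R v' d') : UpperEntries R (v * v') (v * d' + d * v') := by
  constructor <;>
  simp [Matrix.mul_apply, Fin.sum_univ_three, h.h10, h.h11, h.h12, h.h20, h.h21, h.h22, h'.h10,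
    h'.h11, h'.h12, h'.h20, h'.h21, h'.h22]

theorem UpperEntries.one : UpperEntries R 1 0 := by
  constructor <;> simp

theorem LowerColumn.mul {y y' : Ualpha ℓ α} {c c' : ℂ} (h : LowerColumn R y c)
    (h' : LowerColumn R y' c') : LowerColumn R (y * y') (c * c') := by
  constructor <;>
  simp [Matrix.mul_apply, Fin.sum_univ_three, h.h02, h.h12, h.h22, h'.h02, h'.h12, h'.h22,
    smul_smul, mul_comm]

theorem LowerColumn.one : LowerColumn R 1 1 := by
  constructor <;> simp

theorem LowerColumn.pow {y : Ualpha ℓ α} {c : ℂ} (h : LowerColumn R y c) (n : ℕ) :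
    LowerColumn R (y ^ n) (c ^ n) := by
  induction n with
  | zero => simpa using LowerColumn.one
  | succ n ih => rw [pow_succ, pow_succ]; exact ih.mul h

/-- A matrix representation whose last basis vector is a lowest weight vector, on which `e_o`
acts by zero and `e_p` does not. -/
structure IsLowest (g : Gen → Matrix (Fin 3) (Fin 3) ℂ) (p o : Fin 2) : Prop where
  e_p : g (e p) = !![0, 0, 0; 0, 0, 1; 0, 0, 0]
  e_o : g (e o) = !![0, 1, 0; 0, 0, 0; 0, 0, 0]
  f (i : Fin 2) : g (f i) 0 2 = 0 ∧ g (f i) 1 2 = 0 ∧ g (f i) 2 2 = 0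
  k (i : Fin 2) : g (k i) 0 2 = 0 ∧ g (k i) 1 2 = 0
  kinv (i : Fin 2) : g (kinv i) 0 2 = 0 ∧ g (kinv i) 1 2 = 0
  kinv_mul (i : Fin 2) : g (.k i) 2 2 * g (.kinv i) 2 2 = 1
  sigma : g sigma 0 2 = 0 ∧ g sigma 1 2 = 0 ∧ g sigma 2 2 ≠ 0

/-- The vector representation differentiates in `e₂`, its companion `repCovec` in `e₁`. On the last
basis vector `(k₁, k₂, σ)` acts by `(1, ξ, -1)` in the former and by `(ξ⁻¹, 1, 1)` in the latter;
together these separate torus elements modulo scalars. -/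
theorem isLowest_repVec : IsLowest (repVec ℓ) 1 0 := by
  constructor
  any_goals intro i; fin_cases i
  all_goals simp [repVec, xi_ne_zero]

theorem isLowest_repCovec : IsLowest (repCovec ℓ) 0 1 := by
  constructor
  any_goals intro i; fin_cases i
  all_goals simp [repCovec, xi_ne_zero]

variable {ρ : Ualpha ℓ 0 →ₐ[ℂ] Matrix (Fin 3) (Fin 3) ℂ} {p o : Fin 2}

namespace IsLowest

variable (h : IsLowest (fun x => ρ (ugen ℓ 0 x)) p o)
include h

theorem upper_p : UpperEntries (coact hℓ α ρ) (ugen ℓ α (e p))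
    (ugen ℓ α (Gen.kinv p) * ugen ℓ α Gen.sigma ^ deg p) := by
  have := h.e_p
  constructor <;> simp [coact_e, this]

theorem upper_o : UpperEntries (coact hℓ α ρ) (ugen ℓ α (e o)) 0 := by
  have := h.e_o
  constructor <;> simp [coact_e, this]

theorem lower_k (i : Fin 2) : LowerColumn (coact hℓ α ρ) (ugen ℓ α (Gen.k i))
    (ρ (ugen ℓ 0 (Gen.k i)) 2 2) := by
  have := h.k i
  constructor <;> simp [coact_k, this]

theorem lower_kinv (i : Fin 2) : LowerColumn (coact hℓ α ρ) (ugen ℓ α (Gen.kinv i))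
    (ρ (ugen ℓ 0 (Gen.kinv i)) 2 2) := by
  have := h.kinv i
  constructor <;> simp [coact_kinv, this]

theorem lower_sigma : LowerColumn (coact hℓ α ρ) (ugen ℓ α Gen.sigma)
    (ρ (ugen ℓ 0 Gen.sigma) 2 2) := by
  have := h.sigma
  constructor <;> simp [coact_sigma, this]

theorem lower_f (i : Fin 2) : LowerColumn (coact hℓ α ρ) (ugen ℓ α (Gen.f i))
    (ρ (ugen ℓ 0 (Gen.k i)) 2 2) := by
  have := h.k i
  have := h.f i
  constructor <;> simp_all [coact_f]

/-- In `f_i k_i⁻¹` the two eigenvalues, of `k_i` and of `k_i⁻¹` on the lowest vector, cancel. -/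
theorem lower_tau_e (i : Fin 2) :
    LowerColumn (coact hℓ α ρ) (tau ℓ α (ugen ℓ α (e i))) 1 := by
  have := (h.lower_f (hℓ := hℓ) (α := α) i).mul (h.lower_kinv i)
  rw [h.kinv_mul] at this
  rw [tau_ugen]
  exact this

theorem lower_torus {κ : Ualpha ℓ α} (hκ : κ ∈ torus (ugen ℓ α)) :
    ∃ c : ℂ, c ≠ 0 ∧ LowerColumn (coact hℓ α ρ) κ c := by
  induction hκ using Submonoid.closure_induction with
  | mem x hx =>
    rcases hx with ⟨i, rfl⟩ | ⟨i, rfl⟩ | rfl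
    · exact ⟨_, left_ne_zero_of_mul_eq_one (h.kinv_mul i), h.lower_k i⟩
    · exact ⟨_, right_ne_zero_of_mul_eq_one (h.kinv_mul i), h.lower_kinv i⟩
    · exact ⟨_, h.sigma.2.2, h.lower_sigma⟩
  | one => exact ⟨1, one_ne_zero, .one⟩
  | mul x y _ _ h1 h2 =>
    obtain ⟨c, hc, h1⟩ := h1
    obtain ⟨d, hd, h2⟩ := h2
    exact ⟨_, mul_ne_zero hc hd, h1.mul h2⟩

theorem lower_tau {v : Ualpha ℓ α} (hv : v ∈ positive (ugen ℓ α)) :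
    ∃ c : ℂ, c ≠ 0 ∧ LowerColumn (coact hℓ α ρ) (tau ℓ α v) c := by
  induction hv using Submonoid.closure_induction with
  | mem x hx =>
    rcases hx with hx | ⟨i, rfl⟩
    · rw [tau_torus hx]; exact h.lower_torus hx
    · exact ⟨1, one_ne_zero, h.lower_tau_e i⟩
  | one => rw [tau_one]; exact ⟨1, one_ne_zero, .one⟩
  | mul x y _ _ h1 h2 =>
    obtain ⟨c, hc, h1⟩ := h1
    obtain ⟨d, hd, h2⟩ := h2
    rw [tau_mul]
    exact ⟨_, mul_ne_zero hd hc, h2.mul h1⟩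

theorem lower_tau_eTop : LowerColumn (coact hℓ α ρ) (tau ℓ α (eTop ℓ (ugen ℓ α))) 1 := by
  have h0 := h.lower_tau_e (hℓ := hℓ) (α := α) 0
  have h1 := h.lower_tau_e (hℓ := hℓ) (α := α) 1
  have := (h1.mul (h0.mul h1)).mul (h0.pow (ℓ - 1))
  simpa [eTop, eWord, tau_mul, tau_pow] using this

end IsLowest

/-- In the `(1, 2)` entry of the coaction on `v y`, the only surviving term is `d · (c y)`. -/
theorem IsIntegralAt.eq_zero_of_upper {L : Ualpha ℓ α →ₗ[ℂ] ℂ} (hL : IsIntegralAt hℓ L)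
    {v d y : Ualpha ℓ α} {c : ℂ} (hv : UpperEntries (coact hℓ α ρ) v d) (hc : c ≠ 0)
    (hy : LowerColumn (coact hℓ α ρ) y c) : L (d * y) = 0 := by
  have := hL.apply_coact (ρ := ρ) (v * y) 1 2
  simpa [Matrix.mul_apply, Fin.sum_univ_three, hv.h10, hv.h11, hv.h12, hy.h02, hy.h12, hy.h22,
    hc] using this

/-- Here the `(2, 2)` entry is used, which is `v · (c y)`. -/
theorem IsIntegralAt.eq_smul_of_upper {L : Ualpha ℓ α →ₗ[ℂ] ℂ} (hL : IsIntegralAt hℓ L)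
    {v d y : Ualpha ℓ α} {c : ℂ} (hv : UpperEntries (coact hℓ α ρ) v d)
    (hy : LowerColumn (coact hℓ α ρ) y c) : c * L (v * y) = L (v * y) := by
  have := hL.apply_coact (ρ := ρ) (v * y) 2 2
  simpa [Matrix.mul_apply, Fin.sum_univ_three, hv.h20, hv.h21, hv.h22, hy.h02, hy.h12, hy.h22]
    using this

/-- The `z` with `L (z τ(v)) = 0` for all monomials `v` in `k_i^{±1}`, `σ`, `e_i`. -/
def tauKer (L : Ualpha ℓ α →ₗ[ℂ] ℂ) : Submodule ℂ (Ualpha ℓ α) where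
  carrier := {z | ∀ v ∈ positive (ugen ℓ α), L (z * tau ℓ α v) = 0}
  zero_mem' := by simp
  add_mem' h1 h2 v hv := by rw [add_mul, map_add, h1 v hv, h2 v hv, add_zero]
  smul_mem' c x h v hv := by rw [smul_mul_assoc, map_smul, h v hv, smul_zero]

theorem mul_torus_mem_tauKer {L : Ualpha ℓ α →ₗ[ℂ] ℂ} {z κ : Ualpha ℓ α} (hz : z ∈ tauKer L)
    (hκ : κ ∈ torus (ugen ℓ α)) : z * κ ∈ tauKer L := fun v hv => by
  have := hz (v * κ) (mul_mem hv (torus_le_positive _ hκ))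
  rwa [tau_mul, tau_torus hκ, ← mul_assoc] at this

theorem IsIntegralAt.mem_tauKer {L : Ualpha ℓ α →ₗ[ℂ] ℂ} (hL : IsIntegralAt hℓ L)
    (h : IsLowest (fun x => ρ (ugen ℓ 0 x)) p o) {v d : Ualpha ℓ α}
    (hv : UpperEntries (coact hℓ α ρ) v d) : d ∈ tauKer L := fun v' hv' => by
  obtain ⟨c, hc, hy⟩ := h.lower_tau (hℓ := hℓ) hv'
  exact hL.eq_zero_of_upper hv hc hy

/-- The vector representation of `𝒰_0`. -/
def rhoVec (h3 : 3 ≤ ℓ) : Ualpha ℓ 0 →ₐ[ℂ] Matrix (Fin 3) (Fin 3) ℂ :=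
  liftGen (repVec ℓ) (sat_repVec h3) (repVec_k_pow h3)

/-- The representation `repCovec` of `𝒰_0`. -/
def rhoCovec (h3 : 3 ≤ ℓ) : Ualpha ℓ 0 →ₐ[ℂ] Matrix (Fin 3) (Fin 3) ℂ :=
  liftGen (repCovec ℓ) (sat_repCovec h3) (repCovec_k_pow h3)

theorem rhoVec_ugen (h3 : 3 ≤ ℓ) (x : Gen) : rhoVec h3 (ugen ℓ 0 x) = repVec ℓ x :=
  liftGen_ugen _ _ _ _

theorem rhoCovec_ugen (h3 : 3 ≤ ℓ) (x : Gen) : rhoCovec h3 (ugen ℓ 0 x) = repCovec ℓ x :=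
  liftGen_ugen _ _ _ _

theorem isLowest_rhoVec (h3 : 3 ≤ ℓ) : IsLowest (fun x => rhoVec h3 (ugen ℓ 0 x)) 1 0 := by
  simp only [rhoVec_ugen]; exact isLowest_repVec

theorem isLowest_rhoCovec (h3 : 3 ≤ ℓ) : IsLowest (fun x => rhoCovec h3 (ugen ℓ 0 x)) 0 1 := by
  simp only [rhoCovec_ugen]; exact isLowest_repCovec

/-- The coefficient in `∂ (e₁ⁿ) = [n] e₁ⁿ⁻¹ k₁⁻¹`. -/
def qnum (ℓ n : ℕ) : ℂ := ∑ i ∈ Finset.range n, ((xi ℓ ^ 2)⁻¹) ^ i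

theorem qnum_ne_zero (hℓ : Odd ℓ) {n : ℕ} (h0 : 0 < n) (hn : n < ℓ) : qnum ℓ n ≠ 0 := by
  intro h
  have h1 := geom_sum_mul ((xi ℓ ^ 2)⁻¹) n
  rw [← qnum, h, zero_mul, eq_comm, sub_eq_zero] at h1
  exact (xi_sq_primitive hℓ).inv.pow_ne_one_of_pos_of_lt h0.ne' hn h1

/-- The full geometric sum over a primitive `ℓ`-th root of unity vanishes, and the omitted term is
`ξ^{-2(ℓ-1)} = ξ²`. -/
theorem qnum_pred (hℓ : Odd ℓ) (h3 : 3 ≤ ℓ) : qnum ℓ (ℓ - 1) = -xi ℓ ^ 2 := by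
  have h := (xi_sq_primitive hℓ).inv
  have h1 := h.geom_sum_eq_zero (by omega)
  have h2 := h.pow_eq_one
  obtain ⟨n, rfl⟩ := Nat.exists_eq_add_of_le' (show 1 ≤ ℓ by omega)
  rw [Finset.sum_range_succ] at h1
  have hx := xi_ne_zero (n + 1)
  rw [pow_succ] at h2
  have h4 : ((xi (n + 1) ^ 2)⁻¹) ^ n = xi (n + 1) ^ 2 :=
    (mul_inv_eq_one₀ (pow_ne_zero 2 hx)).1 h2
  simp only [qnum, Nat.add_sub_cancel]
  rw [h4] at h1
  linear_combination h1

theorem upper_pow_succ (h : IsLowest (fun x => ρ (ugen ℓ 0 x)) 0 1) (n : ℕ) :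
    UpperEntries (coact hℓ α ρ) (ugen ℓ α (e 0) ^ (n + 1))
      (qnum ℓ (n + 1) • (ugen ℓ α (e 0) ^ n * ugen ℓ α (kinv 0))) := by
  have hs := sat_ugen ℓ α
  have h0 := h.upper_p (hℓ := hℓ) (α := α)
  induction n with
  | zero => simpa [qnum, deg] using h0
  | succ n ih =>
    have := h0.mul ih
    rw [← pow_succ'] at this
    convert this using 1
    obtain ⟨c, hc⟩ : ∃ c, c = ((xi ℓ ^ 2)⁻¹ : ℂ) := ⟨_, rfl⟩
    have h1 : ugen ℓ α (kinv 0) * ugen ℓ α (e 0) = c • (ugen ℓ α (e 0) * ugen ℓ α (kinv 0)) := by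
      rw [hs.kinv_mul_e, hc]; simp [cartan]
    rw [qnum, Finset.sum_range_succ, add_smul, ← qnum, ← hc]
    simp only [deg, Matrix.cons_val_zero, pow_zero, mul_one, mul_pow_of_qcomm h1, mul_smul_comm]
    rw [← mul_assoc, ← pow_succ']

theorem upper_pow (h : IsLowest (fun x => ρ (ugen ℓ 0 x)) 1 0) (n : ℕ) :
    UpperEntries (coact hℓ α ρ) (ugen ℓ α (e 0) ^ n) 0 := by
  induction n with
  | zero => simpa using UpperEntries.one
  | succ n ih => simpa [pow_succ] using ih.mul h.upper_o

theorem IsIntegralAt.mem_tauKer_of_smul {L : Ualpha ℓ α →ₗ[ℂ] ℂ} {c : ℂ} (hc : c ≠ 0)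
    {z κ κ' : Ualpha ℓ α} (hκ : κ' ∈ torus (ugen ℓ α)) (hκ' : κ * κ' = 1)
    (h : c • (z * κ) ∈ tauKer L) : z ∈ tauKer L := by
  have := mul_torus_mem_tauKer ((Submodule.smul_mem_iff _ hc).1 h) hκ
  rwa [mul_assoc, hκ', mul_one] at this

/-- Each word of degree at most `ℓ + 1` is, up to an invertible torus factor, a combination of
derivatives of longer words: `A` refers to the derivative in `e₂`, `B` to that in `e₁`. The top word
escapes because the coefficient `[ℓ]` of the derivative in `e₁` is zero. -/
theorem IsIntegralAt.filt_le_tauKer {L : Ualpha ℓ α →ₗ[ℂ] ℂ} (hL : IsIntegralAt hℓ L)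
    (h3 : 3 ≤ ℓ) : filt (ugen ℓ α) (ℓ + 1) ≤ tauKer L := by
  have hs := sat_ugen ℓ α
  have hx := xi_ne_zero ℓ
  have hA := isLowest_rhoVec h3
  have hB := isLowest_rhoCovec h3
  have A0 := upper_pow (hℓ := hℓ) (α := α) hA
  have A1 := hA.upper_p (hℓ := hℓ) (α := α)
  have A0' := hA.upper_o (hℓ := hℓ) (α := α)
  have B0 := upper_pow_succ (hℓ := hℓ) (α := α) hB
  have B1 := hB.upper_o (hℓ := hℓ) (α := α)
  have B0' := hB.upper_p (hℓ := hℓ) (α := α)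
  simp only [deg, Matrix.cons_val_zero, Matrix.cons_val_one, pow_zero, pow_one, mul_one] at A1 B0'
  have hcσ : ugen ℓ α (kinv 1) * ugen ℓ α sigma * (ugen ℓ α sigma * ugen ℓ α (k 1)) = 1 := by
    rw [mul_assoc, ← mul_assoc (ugen ℓ α sigma), hs.sigma_sigma, one_mul, hs (.kinv_k 1)]
  have mσ := mul_mem (sigma_mem_torus (ugen ℓ α)) (k_mem_torus (ugen ℓ α) 1)
  have mk := k_mem_torus (ugen ℓ α) 0
  have hk := hs (.kinv_k 0)
  -- `e₁^a` arises from differentiating `e₁^a e₂` in `e₂`.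
  have w0 : ∀ a, ugen ℓ α (e 0) ^ a ∈ tauKer L := fun a => by
    have := hL.mem_tauKer hA ((A0 a).mul A1)
    rw [zero_mul, add_zero, ← one_smul ℂ (_ * _)] at this
    exact mem_tauKer_of_smul one_ne_zero mσ hcσ this
  -- `e₁^a e₂` arises from differentiating `e₁^{a+1} e₂` in `e₁`, with coefficient `[a+1]`, nonzero
  -- only while `a + 1 < ℓ`.
  have w1' : ∀ a, a + 1 < ℓ → ugen ℓ α (e 0) ^ a * ugen ℓ α (e 1) ∈ tauKer L := fun a ha => by
    have := hL.mem_tauKer hB ((B0 a).mul B1)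
    rw [mul_zero, zero_add, smul_mul_assoc, mul_assoc, hs.kinv_mul_e, mul_smul_comm, smul_smul,
      ← mul_assoc] at this
    exact mem_tauKer_of_smul (mul_ne_zero (qnum_ne_zero hℓ a.succ_pos ha)
      (zpow_ne_zero _ hx)) mk hk this
  -- This is the derivative of `e₁^a e₂e₁e₂` in `e₂`; the minus sign comes from `σ e₂ = -e₂ σ`.
  have w12 : ∀ a, ugen ℓ α (e 0) ^ a * (ugen ℓ α (e 1) * ugen ℓ α (e 0)) -
      xi ℓ • (ugen ℓ α (e 0) ^ (a + 1) * ugen ℓ α (e 1)) ∈ tauKer L := fun a => by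
    have := hL.mem_tauKer hA ((A0 a).mul ((A1.mul A0').mul A1))
    refine mem_tauKer_of_smul one_ne_zero mσ hcσ ?_
    convert this using 1
    simp [sub_mul, mul_add, mul_assoc, assoc_of_qcomm (hs.kinv_mul_e _ _), hs (.sigma_e _), deg,
      cartan, pow_succ]
    abel
  have w1 : ∀ a, ugen ℓ α (e 0) ^ a * ugen ℓ α (e 1) ∈ tauKer L := fun a => by
    by_cases ha : ℓ ≤ a
    · obtain ⟨b, rfl⟩ := Nat.exists_eq_add_of_le ha
      simp [pow_add, hs .e_pow]
    by_cases ha' : a + 1 < ℓ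
    · exact w1' a ha'
    -- In the remaining case `a = ℓ - 1`, the derivative of `e₁^{ℓ-1} e₂e₁` in `e₁` supplies a
    -- second relation between `e₁^{ℓ-1} e₂` and `e₁^{ℓ-2} e₂e₁`. The two relations are independent
    -- because `ξ² ≠ 1`.
    obtain ⟨n, rfl⟩ := Nat.exists_eq_add_of_le' (show 1 ≤ a by omega)
    have hn : ℓ - 1 = n + 1 := by omega
    have h1 := w12 n
    have h2 := hL.mem_tauKer hB ((B0 n).mul (B1.mul B0'))
    have h4 : -xi ℓ • (ugen ℓ α (e 0) ^ n * (ugen ℓ α (e 1) * ugen ℓ α (e 0))) +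
        ugen ℓ α (e 0) ^ (n + 1) * ugen ℓ α (e 1) ∈ tauKer L := by
      refine mem_tauKer_of_smul one_ne_zero mk hk ?_
      convert h2 using 1
      rw [← hn, qnum_pred hℓ h3]
      simp [add_mul, mul_assoc, assoc_of_qcomm (hs.kinv_mul_e _ _), hs.kinv_mul_e,
        cartan, smul_smul, add_comm]
      field_simp
    have h5 := add_mem h4 (Submodule.smul_mem _ (xi ℓ) h1)
    have h6 : (1 - xi ℓ ^ 2) • (ugen ℓ α (e 0) ^ (n + 1) * ugen ℓ α (e 1)) ∈ tauKer L := by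
      convert h5 using 1
      module
    refine (Submodule.smul_mem_iff _ fun h7 => ?_).1 h6
    exact (xi_sq_primitive hℓ).ne_one (by omega) (sub_eq_zero.1 h7).symm
  have w2 : ∀ a, ugen ℓ α (e 0) ^ a * (ugen ℓ α (e 1) * ugen ℓ α (e 0)) ∈ tauKer L := fun a => by
    have := add_mem (w12 a) (Submodule.smul_mem _ (xi ℓ) (w1 (a + 1)))
    rwa [sub_add_cancel] at this
  -- Differentiating `e₁^{a+1} e₂e₁e₂` in `e₁` leaves one term, since removing the inner `e₁`
  -- produces `e₂² = 0`.
  have w3 : ∀ a, a + 1 < ℓ → ugen ℓ α (e 0) ^ a *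
      (ugen ℓ α (e 1) * ugen ℓ α (e 0) * ugen ℓ α (e 1)) ∈ tauKer L := fun a ha => by
    have := hL.mem_tauKer hB ((B0 a).mul ((B1.mul B0').mul B1))
    have h0 : qnum ℓ (a + 1) ≠ 0 := qnum_ne_zero hℓ a.succ_pos ha
    refine mem_tauKer_of_smul h0 mk hk ?_
    convert this using 1
    simp [mul_assoc, assoc_of_qcomm (hs.kinv_mul_e _ _), hs.kinv_mul_e,
        cartan, smul_smul, hs.e_sq_mul]
    congr 1
    field_simp
  refine Submodule.span_le.2 ?_
  rintro _ ⟨a, j, κ, hκ, hn, rfl⟩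
  refine mul_torus_mem_tauKer ?_ hκ
  fin_cases j
  · simpa [eWord] using w0 a
  · exact w1 a
  · exact w2 a
  · exact w3 a (by simp at hn; omega)

end Vanishing

/-! ## Uniqueness of integrals -/

section Uniqueness

variable {ℓ : ℕ} {hℓ : Odd ℓ} {α : G}

theorem xi_add_inv_ne_zero (hℓ : Odd ℓ) (h3 : 3 ≤ ℓ) : xi ℓ + (xi ℓ)⁻¹ ≠ 0 := fun h => by
  have h1 : (xi ℓ ^ 2) ^ 2 = 1 := by
    have := congrArg (xi ℓ * ·) h
    simp only [mul_add, mul_inv_cancel₀ (xi_ne_zero ℓ), mul_zero] at this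
    linear_combination (xi ℓ ^ 2 - 1) * this
  exact (xi_sq_primitive hℓ).pow_ne_one_of_pos_of_lt (by omega) (by omega) h1

theorem xiPowEll_ne_zero (a : ℂ ⧸ AddSubgroup.zmultiples (1 : ℂ)) : xiPowEll a ≠ 0 := fun h => by
  have := xiPowEll_add a (-a)
  rw [add_neg_cancel, xiPowEll_zero, h, zero_mul] at this
  exact one_ne_zero this

theorem ugen_kinv_eq (h0 : 0 < ℓ) (i : Fin 2) : ugen ℓ α (kinv i) =
    (xiPowEll (α i))⁻¹ • ugen ℓ α (k i) ^ (ℓ - 1) := by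
  have h := ugen_k_pow ℓ α i
  rw [← Nat.sub_add_cancel h0, pow_succ, Nat.sub_add_cancel h0, Algebra.algebraMap_eq_smul_one] at h
  have h1 := congrArg (fun z => (xiPowEll (α i))⁻¹ • (z * ugen ℓ α (kinv i))) h
  simp only [mul_assoc, sat_ugen ℓ α (.k_kinv i), mul_one, smul_mul_assoc, one_mul, smul_smul,
    inv_mul_cancel₀ (xiPowEll_ne_zero _), one_smul] at h1
  exact h1.symm

theorem torus_normal_form (h0 : 0 < ℓ) {κ : Ualpha ℓ α} (hκ : κ ∈ torus (ugen ℓ α)) :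
    ∃ (c : ℂ) (a b s : ℕ),
      κ = c • (ugen ℓ α (k 0) ^ a * ugen ℓ α (k 1) ^ b * ugen ℓ α sigma ^ s) := by
  have hs := sat_ugen ℓ α
  have h01 : Commute (ugen ℓ α (k 0)) (ugen ℓ α (k 1)) := hs .k_comm
  have hσ : ∀ i, Commute (ugen ℓ α sigma) (ugen ℓ α (k i)) := fun i => hs (.sigma_k i)
  induction hκ using Submonoid.closure_induction with
  | mem x hx =>
    rcases hx with ⟨i, rfl⟩ | ⟨i, rfl⟩ | rfl
    · fin_cases i
      · exact ⟨1, 1, 0, 0, by simp⟩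
      · exact ⟨1, 0, 1, 0, by simp⟩
    · rw [ugen_kinv_eq h0]
      fin_cases i
      · exact ⟨(xiPowEll (α 0))⁻¹, ℓ - 1, 0, 0, by simp⟩
      · exact ⟨(xiPowEll (α 1))⁻¹, 0, ℓ - 1, 0, by simp⟩
    · exact ⟨1, 0, 0, 1, by simp⟩
  | one => exact ⟨1, 0, 0, 0, by simp⟩
  | mul x y _ _ h1 h2 =>
    obtain ⟨c, a, b, s, rfl⟩ := h1
    obtain ⟨c', a', b', s', rfl⟩ := h2
    refine ⟨c * c', a + a', b + b', s + s', ?_⟩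
    rw [smul_mul_smul_comm, pow_add, pow_add, pow_add]
    congr 1
    have e1 := ((hσ 0).pow_pow s a').eq
    have e2 := ((hσ 1).pow_pow s b').eq
    have e3 := (h01.pow_pow a' b).eq
    simp only [mul_assoc]
    rw [← mul_assoc (_ ^ s) (_ ^ a'), e1, mul_assoc, ← mul_assoc (_ ^ s) (_ ^ b'), e2, mul_assoc,
      ← mul_assoc (_ ^ b) (_ ^ a'), ← e3, mul_assoc]

theorem exists_upper_eTop {ρ : Ualpha ℓ 0 →ₐ[ℂ] Matrix (Fin 3) (Fin 3) ℂ}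
    (h : ∀ i, ∃ d, UpperEntries (coact hℓ α ρ) (ugen ℓ α (e i)) d) :
    ∃ d, UpperEntries (coact hℓ α ρ) (eTop ℓ (ugen ℓ α)) d := by
  obtain ⟨d0, h0⟩ := h 0
  obtain ⟨d1, h1⟩ := h 1
  have hp : ∀ n, ∃ d, UpperEntries (coact hℓ α ρ) (ugen ℓ α (e 0) ^ n) d := fun n => by
    induction n with
    | zero => exact ⟨0, by simpa using UpperEntries.one⟩
    | succ n ih =>
      obtain ⟨d, ih⟩ := ih
      exact ⟨_, by rw [pow_succ]; exact ih.mul h0⟩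
  obtain ⟨d, hd⟩ := hp (ℓ - 1)
  exact ⟨_, hd.mul ((h1.mul h0).mul h1)⟩

theorem IsIntegralAt.top_eq_smul {L : Ualpha ℓ α →ₗ[ℂ] ℂ} (hL : IsIntegralAt hℓ L)
    {ρ : Ualpha ℓ 0 →ₐ[ℂ] Matrix (Fin 3) (Fin 3) ℂ} {p : Fin 2}
    (h : IsLowest (fun x => ρ (ugen ℓ 0 x)) p (1 - p)) {κ : Ualpha ℓ α} {c : ℂ}
    (hκ : LowerColumn (coact hℓ α ρ) κ c) :
    c * L (eTop ℓ (ugen ℓ α) * κ * tau ℓ α (eTop ℓ (ugen ℓ α))) =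
      L (eTop ℓ (ugen ℓ α) * κ * tau ℓ α (eTop ℓ (ugen ℓ α))) := by
  obtain ⟨d, hd⟩ := exists_upper_eTop (hℓ := hℓ) (α := α) (ρ := ρ) fun i => by
    have h1 := h.upper_p (hℓ := hℓ) (α := α)
    have h2 := h.upper_o (hℓ := hℓ) (α := α)
    fin_cases p <;> fin_cases i
    exacts [⟨_, h1⟩, ⟨_, h2⟩, ⟨_, h2⟩, ⟨_, h1⟩]
  rw [mul_assoc]
  have := hκ.mul (h.lower_tau_eTop)
  rw [mul_one] at this
  exact hL.eq_smul_of_upper hd this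

/-- For `κ` proportional to `k₁^a k₂^b σ^s`, the diagonal constraint in the two representations
reads `ξ^b (-1)^s = 1` and `ξ^{-a} = 1` unless `L` vanishes. These conditions force `ℓ ∣ a`, `ℓ ∣ b`
and `s` even, and then `κ` is a scalar because `k_i^ℓ` is one in `𝒰_α` and `σ² = 1`. -/
theorem torus_eq_smul_or (h3 : 3 ≤ ℓ) (hℓ : Odd ℓ) {κ : Ualpha ℓ α}
    (hκ : κ ∈ torus (ugen ℓ α)) : (∃ c : ℂ, κ = c • 1) ∨ ∀ L, IsIntegralAt hℓ L →
      L (eTop ℓ (ugen ℓ α) * κ * tau ℓ α (eTop ℓ (ugen ℓ α))) = 0 := by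
  have hs := sat_ugen ℓ α
  have hprim : IsPrimitiveRoot (xi ℓ) ℓ := Complex.isPrimitiveRoot_exp ℓ (by omega)
  obtain ⟨c, a, b, s, rfl⟩ := torus_normal_form (by omega) hκ
  have hpow : ∀ i n, ℓ ∣ n → ∃ c : ℂ, ugen ℓ α (k i) ^ n = c • 1 := by
    rintro i _ ⟨m, rfl⟩
    exact ⟨xiPowEll (α i) ^ m, by
      rw [pow_mul, ugen_k_pow, Algebra.algebraMap_eq_smul_one, smul_pow, one_pow]⟩
  by_cases h : xi ℓ ^ b * (-1) ^ s = 1 ∧ ((xi ℓ)⁻¹) ^ a = 1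
  · obtain ⟨hb, ha⟩ := h
    have ha' : ℓ ∣ a := hprim.inv.dvd_of_pow_eq_one _ ha
    have hb' : ℓ ∣ b := by
      -- Squaring removes the sign, and `ξ²` is still primitive because `ℓ` is odd.
      refine (xi_sq_primitive hℓ).dvd_of_pow_eq_one _ ?_
      have := congrArg (· ^ 2) hb
      simp only [mul_pow, one_pow] at this
      rwa [← pow_mul (-1 : ℂ), mul_comm s 2, pow_mul, neg_one_sq, one_pow, mul_one, ← pow_mul,
        mul_comm, pow_mul] at this
    have hs' : Even s := by
      rw [← neg_one_pow_eq_one_iff_even (R := ℂ) (by norm_num)]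
      rwa [(hprim.pow_eq_one_iff_dvd b).2 hb', one_mul] at hb
    obtain ⟨c1, h1⟩ := hpow 0 a ha'
    obtain ⟨c2, h2⟩ := hpow 1 b hb'
    obtain ⟨t, rfl⟩ := hs'
    left
    refine ⟨c * (c1 * c2), ?_⟩
    rw [h1, h2, ← two_mul, pow_mul, hs .sigma_sq, one_pow, smul_mul_smul_comm, one_mul, mul_one,
      smul_smul]
  · right
    intro L hL
    rw [mul_smul_comm, smul_mul_assoc, map_smul]
    have hA := isLowest_rhoVec h3
    have hB := isLowest_rhoCovec h3
    have h1 := hL.top_eq_smul hA ((((hA.lower_k 0).pow a).mul ((hA.lower_k 1).pow b)).mul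
      (hA.lower_sigma.pow s))
    have h2 := hL.top_eq_smul hB ((((hB.lower_k 0).pow a).mul ((hB.lower_k 1).pow b)).mul
      (hB.lower_sigma.pow s))
    simp only [rhoVec_ugen, rhoCovec_ugen] at h1 h2
    simp only [repVec, repCovec, Matrix.cons_val, Matrix.of_apply, one_pow, one_mul, mul_one]
      at h1 h2
    by_contra hne
    have hne' := right_ne_zero_of_mul hne
    exact h ⟨mul_right_cancel₀ hne' (by simpa using h1), mul_right_cancel₀ hne' (by simpa using h2)⟩

/-- A linear form is determined by its values on the products `v τ(v')`, split according to
degree. -/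
theorem linearMap_eq_zero (h3 : 3 ≤ ℓ) (hℓ : Odd ℓ) {L : Ualpha ℓ α →ₗ[ℂ] ℂ}
    (h1 : ∀ v ∈ filt (ugen ℓ α) (ℓ + 1), ∀ v' ∈ positive (ugen ℓ α), L (v * tau ℓ α v') = 0)
    (h2 : ∀ v ∈ positive (ugen ℓ α), ∀ v' ∈ filt (ugen ℓ α) (ℓ + 1), L (v * tau ℓ α v') = 0)
    (h : ∀ κ ∈ torus (ugen ℓ α),
      L (eTop ℓ (ugen ℓ α) * κ * tau ℓ α (eTop ℓ (ugen ℓ α))) = 0) : L = 0 := by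
  have hs := sat_ugen ℓ α
  have hxi := xi_add_inv_ne_zero hℓ h3
  have top : eTop ℓ (ugen ℓ α) ∈ positive (ugen ℓ α) :=
    mul_mem (pow_mem (e_mem_positive _ 0) _) (eWord_mem_positive _ 3)
  have key : ∀ v ∈ positive (ugen ℓ α), v ∈ filt (ugen ℓ α) (ℓ + 1) ⊔
      Submodule.span ℂ {x | ∃ κ ∈ torus (ugen ℓ α), x = eTop ℓ (ugen ℓ α) * κ} := fun v hv => by
    obtain ⟨n, hn⟩ := hs.exists_mem_filt hxi hv
    exact hs.filt_le n hn
  have step : ∀ κ ∈ torus (ugen ℓ α), ∀ v' ∈ positive (ugen ℓ α),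
      L (eTop ℓ (ugen ℓ α) * κ * tau ℓ α v') = 0 := by
    intro κ hκ v' hv'
    -- The right-hand factor is split into its part below top degree and its `E κ'` part; the
    -- left-hand factor is split likewise in `all`.
    obtain ⟨y, hy, z, hz, rfl⟩ := Submodule.mem_sup.1 (key v' hv')
    rw [map_add, mul_add, map_add, h2 _ (mul_mem top (torus_le_positive _ hκ)) y hy, zero_add]
    clear hv'
    induction hz using Submodule.span_induction with
    | mem z hz =>
      obtain ⟨κ', hκ', rfl⟩ := hz
      rw [tau_mul, tau_torus hκ', ← mul_assoc, mul_assoc _ κ]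
      exact h _ (mul_mem hκ hκ')
    | zero => simp
    | add z w _ _ h3 h4 => rw [map_add, mul_add, map_add, h3, h4, add_zero]
    | smul c z _ h3 => rw [map_smul, mul_smul_comm, map_smul, h3, smul_zero]
  have all : triangular ℓ α ≤ LinearMap.ker L := by
    refine Submodule.span_le.2 ?_
    rintro _ ⟨v, hv, v', hv', rfl⟩
    obtain ⟨y, hy, z, hz, rfl⟩ := Submodule.mem_sup.1 (key v hv)
    rw [SetLike.mem_coe, LinearMap.mem_ker, add_mul, map_add, h1 y hy v' hv', zero_add]
    clear hv
    induction hz using Submodule.span_induction with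
    | mem z hz =>
      obtain ⟨κ', hκ', rfl⟩ := hz
      exact step κ' hκ' v' hv'
    | zero => simp
    | add z w _ _ h3 h4 => rw [add_mul, map_add, h3, h4, add_zero]
    | smul c z _ h3 => rw [smul_mul_assoc, map_smul, h3, smul_zero]
  rw [triangular_eq_top, top_le_iff] at all
  exact LinearMap.ker_eq_top.1 all

theorem IsIntegralAt.comp_tau {L : Ualpha ℓ α →ₗ[ℂ] ℂ} (hL : IsIntegralAt hℓ L) :
    IsIntegralAt hℓ (L ∘ₗ tau ℓ α) := fun x => by
  have key : ∀ s : Ualpha ℓ α ⊗[ℂ] Ualpha ℓ 0,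
      TensorProduct.lid ℂ _ ((L ∘ₗ tau ℓ α).rTensor _ s) =
        tau ℓ 0 (TensorProduct.lid ℂ _ (L.rTensor _
          (TensorProduct.map (tau ℓ α) (tau ℓ 0) s))) := fun s => by
    induction s with
    | zero => simp
    | add s t h1 h2 => simp only [map_add, h1, h2]
    | tmul y z => simp [tau_tau]
  rw [key, ← comul_tau, hL, map_smul, tau_one]
  rfl

theorem IsIntegralAt.apply_filt_mul {L : Ualpha ℓ α →ₗ[ℂ] ℂ} (hL : IsIntegralAt hℓ L) (h3 : 3 ≤ ℓ)
    {v v' : Ualpha ℓ α} (hv : v ∈ filt (ugen ℓ α) (ℓ + 1)) (hv' : v' ∈ positive (ugen ℓ α)) :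
    L (v * tau ℓ α v') = 0 :=
  hL.filt_le_tauKer h3 hv v' hv'

theorem IsIntegralAt.apply_mul_filt {L : Ualpha ℓ α →ₗ[ℂ] ℂ} (hL : IsIntegralAt hℓ L) (h3 : 3 ≤ ℓ)
    {v v' : Ualpha ℓ α} (hv : v ∈ positive (ugen ℓ α)) (hv' : v' ∈ filt (ugen ℓ α) (ℓ + 1)) :
    L (v * tau ℓ α v') = 0 := by
  simpa [tau_mul, tau_tau] using hL.comp_tau.filt_le_tauKer h3 hv' v hv

/-- This is the uniqueness principle: every later identity between integrals is checked at `E τ(E)`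
alone. -/
theorem IsIntegralAt.eq_zero {L : Ualpha ℓ α →ₗ[ℂ] ℂ} (hL : IsIntegralAt hℓ L) (h3 : 3 ≤ ℓ)
    (h : L (eTop ℓ (ugen ℓ α) * tau ℓ α (eTop ℓ (ugen ℓ α))) = 0) : L = 0 := by
  refine linearMap_eq_zero h3 hℓ (fun v hv v' hv' => hL.apply_filt_mul h3 hv hv')
    (fun v hv v' hv' => hL.apply_mul_filt h3 hv hv') fun κ hκ => ?_
  rcases torus_eq_smul_or h3 hℓ hκ with ⟨c, rfl⟩ | h1
  · rw [mul_smul_comm, mul_one, smul_mul_assoc, map_smul, h, smul_zero]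
  · exact h1 L hL

end Uniqueness

/-! ## The trace property -/

section Trace

variable {ℓ : ℕ} {hℓ : Odd ℓ} {α β : G}

/-- The map `L ⊗ id`. -/
def slice (β : G) (L : Ualpha ℓ α →ₗ[ℂ] ℂ) : Ualpha ℓ α ⊗[ℂ] Ualpha ℓ β →ₗ[ℂ] Ualpha ℓ β :=
  (TensorProduct.lid ℂ (Ualpha ℓ β)).toLinearMap ∘ₗ L.rTensor (Ualpha ℓ β)

theorem slice_tmul (L : Ualpha ℓ α →ₗ[ℂ] ℂ) (x : Ualpha ℓ α) (y : Ualpha ℓ β) :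
    slice β L (x ⊗ₜ y) = L x • y := by
  simp [slice]

theorem slice_tmul_mul (L : Ualpha ℓ α →ₗ[ℂ] ℂ) (x : Ualpha ℓ α) (y : Ualpha ℓ β)
    (s : Ualpha ℓ α ⊗[ℂ] Ualpha ℓ β) :
    slice β L ((x ⊗ₜ y) * s) = y * slice β (L ∘ₗ LinearMap.mulLeft ℂ x) s := by
  induction s with
  | zero => simp
  | add s t h1 h2 => simp only [mul_add, map_add, h1, h2]
  | tmul z w => simp [slice_tmul]

theorem slice_mul_tmul (L : Ualpha ℓ α →ₗ[ℂ] ℂ) (x : Ualpha ℓ α) (y : Ualpha ℓ β)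
    (s : Ualpha ℓ α ⊗[ℂ] Ualpha ℓ β) :
    slice β L (s * (x ⊗ₜ y)) = slice β (L ∘ₗ LinearMap.mulRight ℂ x) s * y := by
  induction s with
  | zero => simp
  | add s t h1 h2 => simp only [add_mul, map_add, h1, h2]
  | tmul z w => simp [slice_tmul]

theorem slice_sub (L M : Ualpha ℓ α →ₗ[ℂ] ℂ) (s : Ualpha ℓ α ⊗[ℂ] Ualpha ℓ β) :
    slice β (L - M) s = slice β L s - slice β M s := by
  simp [slice, LinearMap.rTensor_sub]

theorem slice_smul (c : ℂ) (L : Ualpha ℓ α →ₗ[ℂ] ℂ) (s : Ualpha ℓ α ⊗[ℂ] Ualpha ℓ β) :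
    slice β (c • L) s = c • slice β L s := by
  simp [slice, LinearMap.rTensor_smul]

theorem isIntegralAt_iff {L : Ualpha ℓ α →ₗ[ℂ] ℂ} : IsIntegralAt hℓ L ↔
    ∀ x, slice 0 L (comul hℓ (add_zero α).symm x) = L x • 1 := Iff.rfl

theorem IsIntegralAt.sub {L M : Ualpha ℓ α →ₗ[ℂ] ℂ} (hL : IsIntegralAt hℓ L)
    (hM : IsIntegralAt hℓ M) : IsIntegralAt hℓ (L - M) := by
  rw [isIntegralAt_iff] at *
  intro x
  rw [slice_sub, hL, hM, LinearMap.sub_apply, sub_smul]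

theorem eTop_mem_positive : eTop ℓ (ugen ℓ α) ∈ positive (ugen ℓ α) :=
  mul_mem (pow_mem (e_mem_positive _ 0) _) (eWord_mem_positive _ 3)

/-- The element `e_top τ(e_top)` has weight zero. -/
theorem torus_top_comm {κ v : Ualpha ℓ α} (hκ : κ ∈ torus (ugen ℓ α))
    (hv : v ∈ positive (ugen ℓ α)) : κ * (v * tau ℓ α v) = v * tau ℓ α v * κ := by
  obtain ⟨c, _, h⟩ := (sat_ugen ℓ α).torus_positive hκ hv
  have h1 := congrArg (tau ℓ α) h
  rw [map_smul, tau_mul, tau_mul, tau_torus hκ] at h1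
  rw [← mul_assoc, h, smul_mul_assoc, mul_assoc, mul_assoc, h1, mul_smul_comm]

/-- Conjugation by an element with group-like coproduct turns an integral into an integral, and it
fixes `E τ(E)`, which commutes with the torus. Uniqueness concludes. -/
theorem IsIntegralAt.conj {L : Ualpha ℓ α →ₗ[ℂ] ℂ} (hL : IsIntegralAt hℓ L) (h3 : 3 ≤ ℓ)
    {u u' : Ualpha ℓ α} {w w' : Ualpha ℓ 0} (hu : u ∈ torus (ugen ℓ α)) (huu : u * u' = 1)
    (hw : comul hℓ (add_zero α).symm u = u ⊗ₜ w) (hw' : comul hℓ (add_zero α).symm u' = u' ⊗ₜ w')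
    (hww : w' * w = 1) (x : Ualpha ℓ α) : L (u * x * u') = L x := by
  rw [isIntegralAt_iff] at hL
  have hM : IsIntegralAt hℓ (L ∘ₗ LinearMap.mulRight ℂ u' ∘ₗ LinearMap.mulLeft ℂ u) := by
    rw [isIntegralAt_iff]
    intro x
    have h1 := hL (u * x * u')
    rw [map_mul (comul hℓ _), map_mul (comul hℓ _), hw, hw', slice_mul_tmul, slice_tmul_mul] at h1
    have h2 := congrArg (fun z => w' * z * w) h1
    simp only [mul_assoc, hww, mul_one, mul_smul_comm, smul_mul_assoc] at h2
    rw [← mul_assoc, hww, one_mul] at h2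
    exact h2.trans (by simp [mul_assoc])
  have h0 := (hM.sub hL).eq_zero h3 (by
    have h2 := torus_top_comm hu (eTop_mem_positive (ℓ := ℓ) (α := α))
    simp [h2, mul_assoc, huu])
  simpa [sub_eq_zero] using LinearMap.congr_fun h0 x

theorem IsIntegralAt.torus_comm {L : Ualpha ℓ α →ₗ[ℂ] ℂ} (hL : IsIntegralAt hℓ L) (h3 : 3 ≤ ℓ)
    {κ : Ualpha ℓ α} (hκ : κ ∈ torus (ugen ℓ α)) (x : Ualpha ℓ α) : L (x * κ) = L (κ * x) := by
  have hs := sat_ugen ℓ α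
  have hs0 := sat_ugen ℓ 0
  induction hκ using Submonoid.closure_induction generalizing x with
  | mem y hy =>
    rcases hy with ⟨i, rfl⟩ | ⟨i, rfl⟩ | rfl
    · have := hL.conj h3 (k_mem_torus _ i) (hs (.k_kinv i)) (comul_ugen _ _ _) (comul_ugen _ _ _)
        (hs0 (.kinv_k i)) (x * ugen ℓ α (k i))
      rw [← this, mul_assoc, mul_assoc, hs (.k_kinv i), mul_one]
    · have := hL.conj h3 (kinv_mem_torus _ i) (hs (.kinv_k i)) (comul_ugen _ _ _) (comul_ugen _ _ _)
        (hs0 (.k_kinv i)) (x * ugen ℓ α (kinv i))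
      rw [← this, mul_assoc, mul_assoc, hs (.kinv_k i), mul_one]
    · have := hL.conj h3 (sigma_mem_torus _) hs.sigma_sigma (comul_ugen _ _ _) (comul_ugen _ _ _)
        hs0.sigma_sigma (x * ugen ℓ α sigma)
      rw [← this, mul_assoc, mul_assoc, hs.sigma_sigma, mul_one]
  | one => simp
  | mul y z _ _ h1 h2 => rw [← mul_assoc, h2, ← mul_assoc, h1, mul_assoc]

theorem IsIntegralAt.eq_zero_of_weight {L : Ualpha ℓ α →ₗ[ℂ] ℂ} (hL : IsIntegralAt hℓ L)
    (h3 : 3 ≤ ℓ) {x : Ualpha ℓ α} {j : Fin 2} {c : ℂ} (hc : c ≠ 1)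
    (h : ugen ℓ α (k j) * x = c • (x * ugen ℓ α (k j))) : L x = 0 := by
  have hs := sat_ugen ℓ α
  have h1 : L x = c * L x := by
    calc L x = L (x * ugen ℓ α (kinv j) * ugen ℓ α (k j)) := by
          rw [mul_assoc, hs (.kinv_k j), mul_one]
      _ = c * L x := by
          rw [hL.torus_comm h3 (k_mem_torus _ j), ← mul_assoc, h, smul_mul_assoc, mul_assoc,
            hs (.k_kinv j), mul_one, map_smul, smul_eq_mul]
  by_contra hne
  exact hc (mul_right_cancel₀ hne (by rw [← h1, one_mul]))

/-- The scalar in `G_α e_i = (-1)^{d_i} ξ^{a_ii} e_i G_α`. -/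
def pivotScalar (ℓ : ℕ) (i : Fin 2) : ℂ := (-1) ^ deg i * xi ℓ ^ cartan i i

theorem pivotScalar_ne_zero (i : Fin 2) : pivotScalar ℓ i ≠ 0 :=
  mul_ne_zero (pow_ne_zero _ (by norm_num)) (zpow_ne_zero _ (xi_ne_zero ℓ))

theorem comul_kinv_sigma (i : Fin 2) {γ : G} (h : γ = α + β) :
    comul hℓ h (ugen ℓ γ (kinv i) * ugen ℓ γ sigma ^ deg i) =
      (ugen ℓ α (kinv i) * ugen ℓ α sigma ^ deg i) ⊗ₜ
        (ugen ℓ β (kinv i) * ugen ℓ β sigma ^ deg i) := by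
  simp [comul_ugen, comulGen]

theorem sigma_pow_deg (i : Fin 2) : ugen ℓ α sigma ^ deg i * ugen ℓ α sigma ^ deg i = 1 := by
  fin_cases i <;> simp [deg, (sat_ugen ℓ α).sigma_sigma]

theorem sigma_pow_mul_k (i : Fin 2) : ugen ℓ α sigma ^ deg i * ugen ℓ α (k i) =
    ugen ℓ α (k i) * ugen ℓ α sigma ^ deg i :=
  ((show Commute _ _ from (sat_ugen ℓ α) (.sigma_k i)).pow_left _).eq

theorem k_sigma_mul_e (i : Fin 2) : ugen ℓ α sigma ^ deg i * ugen ℓ α (k i) * ugen ℓ α (e i) =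
    pivotScalar ℓ i • (ugen ℓ α (e i) * (ugen ℓ α sigma ^ deg i * ugen ℓ α (k i))) := by
  have hs := sat_ugen ℓ α
  rw [mul_assoc, hs.k_mul_e, mul_smul_comm, ← mul_assoc]
  have : ugen ℓ α sigma ^ deg i * ugen ℓ α (e i) =
      (-1 : ℂ) ^ deg i • (ugen ℓ α (e i) * ugen ℓ α sigma ^ deg i) := by
    fin_cases i <;> simp [deg, hs (.sigma_e _)]
  rw [this, smul_mul_assoc, smul_smul, mul_assoc, mul_comm (_ ^ _ : ℂ)]
  rfl

theorem xi_inv_ne_one (h3 : 3 ≤ ℓ) : xi ℓ ^ (-1 : ℤ) ≠ 1 := by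
  rw [zpow_neg_one, ne_eq, inv_eq_one]
  exact (Complex.isPrimitiveRoot_exp ℓ (show ℓ ≠ 0 by omega)).ne_one (by omega)

/-- Write `Δ(e_i) = e_i ⊗ 1 + h ⊗ e_i`. Expanding the integral identity at `e_i x` and at `x e_i`
produces the error terms `L(hx) e_i σ^{d_i}k_i` and `L(hx) σ^{d_i}k_i e_i`, which differ by the
factor `pivotScalar`. The combination in which they cancel is therefore an integral, and it vanishes
at `E τ(E)` by weight. -/
theorem IsIntegralAt.e_comm {L : Ualpha ℓ α →ₗ[ℂ] ℂ} (hL : IsIntegralAt hℓ L) (h3 : 3 ≤ ℓ)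
    (i : Fin 2) (x : Ualpha ℓ α) :
    L (x * ugen ℓ α (e i)) = pivotScalar ℓ i * L (ugen ℓ α (e i) * x) := by
  have hs := sat_ugen ℓ α
  have hs0 := sat_ugen ℓ 0
  have hL' := isIntegralAt_iff.1 hL
  obtain ⟨h, hh⟩ : ∃ h, h = ugen ℓ α (kinv i) * ugen ℓ α sigma ^ deg i := ⟨_, rfl⟩
  have ht : h ∈ torus (ugen ℓ α) :=
    hh ▸ mul_mem (kinv_mem_torus _ i) (pow_mem (sigma_mem_torus _) _)
  have hMr : L ∘ₗ LinearMap.mulRight ℂ h = L ∘ₗ LinearMap.mulLeft ℂ h := by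
    ext x; exact hL.torus_comm h3 ht x
  have hMs : ∀ x, slice 0 (L ∘ₗ LinearMap.mulLeft ℂ h) (comul hℓ (add_zero α).symm x) =
      L (h * x) • (ugen ℓ 0 sigma ^ deg i * ugen ℓ 0 (k i)) := fun x => by
    have h1 := hL' (h * x)
    rw [map_mul, hh, comul_kinv_sigma, slice_tmul_mul, ← hh] at h1
    have h2 := congrArg (fun z => ugen ℓ 0 sigma ^ deg i * ugen ℓ 0 (k i) * z) h1
    simp only [mul_smul_comm, mul_one] at h2
    rw [← h2, ← mul_assoc, mul_assoc (_ ^ _), ← mul_assoc (ugen ℓ 0 (k i)), hs0 (.k_kinv i),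
      one_mul, sigma_pow_deg, one_mul]
  have hΔ : comul hℓ (add_zero α).symm (ugen ℓ α (e i)) =
      ugen ℓ α (e i) ⊗ₜ 1 + h ⊗ₜ ugen ℓ 0 (e i) := by
    rw [hh, comul_ugen]; rfl
  have hF : IsIntegralAt hℓ (pivotScalar ℓ i • (L ∘ₗ LinearMap.mulLeft ℂ (ugen ℓ α (e i))) -
      L ∘ₗ LinearMap.mulRight ℂ (ugen ℓ α (e i))) := by
    rw [isIntegralAt_iff]
    intro x
    have h1 := hL' (ugen ℓ α (e i) * x)
    have h2 := hL' (x * ugen ℓ α (e i))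
    rw [map_mul, hΔ, add_mul, map_add, slice_tmul_mul, slice_tmul_mul, one_mul, hMs,
      ← eq_sub_iff_add_eq] at h1
    rw [map_mul, hΔ, mul_add, map_add, slice_mul_tmul, slice_mul_tmul, mul_one, hMr, hMs,
      smul_mul_assoc, k_sigma_mul_e, ← eq_sub_iff_add_eq] at h2
    rw [slice_sub, slice_smul, h1, h2]
    simp only [LinearMap.sub_apply, LinearMap.smul_apply, LinearMap.comp_apply,
      LinearMap.mulLeft_apply, LinearMap.mulRight_apply, mul_smul_comm, smul_eq_mul]
    module
  have h0 := hF.eq_zero h3 (by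
    have ht := torus_top_comm (k_mem_torus (ugen ℓ α) (1 - i))
      (eTop_mem_positive (ℓ := ℓ) (α := α))
    -- The weight of `e_i` is tested with the other torus generator: `a₂₂ = 0`, so `k₂` does not
    -- detect `e₂`, whereas both off-diagonal entries are `-1`.
    have hc : cartan (1 - i) i = -1 := by fin_cases i <;> simp [cartan]
    have he := hs.k_mul_e (1 - i) i
    rw [hc] at he
    have h1 : L (ugen ℓ α (e i) * (eTop ℓ (ugen ℓ α) * tau ℓ α (eTop ℓ (ugen ℓ α)))) = 0 :=
      hL.eq_zero_of_weight h3 (j := 1 - i) (xi_inv_ne_one h3) (by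
        rw [← mul_assoc, he, smul_mul_assoc, mul_assoc, ht, mul_assoc (ugen ℓ α (e i))])
    have h2 : L (eTop ℓ (ugen ℓ α) * tau ℓ α (eTop ℓ (ugen ℓ α)) * ugen ℓ α (e i)) = 0 :=
      hL.eq_zero_of_weight h3 (j := 1 - i) (xi_inv_ne_one h3) (by
        rw [← mul_assoc, ht, mul_assoc, he, mul_smul_comm, mul_assoc (_ * _)])
    simp [h1, h2])
  have := LinearMap.congr_fun h0 x
  simp only [LinearMap.sub_apply, LinearMap.smul_apply, LinearMap.comp_apply,
      LinearMap.mulLeft_apply, LinearMap.mulRight_apply, smul_eq_mul, LinearMap.zero_apply] at this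
  exact (sub_eq_zero.1 this).symm

theorem IsIntegralAt.tau_e_comm {L : Ualpha ℓ α →ₗ[ℂ] ℂ} (hL : IsIntegralAt hℓ L) (h3 : 3 ≤ ℓ)
    (i : Fin 2) (x : Ualpha ℓ α) :
    L (tau ℓ α (ugen ℓ α (e i)) * x) = pivotScalar ℓ i * L (x * tau ℓ α (ugen ℓ α (e i))) := by
  simpa [tau_mul, tau_tau] using hL.comp_tau.e_comm h3 i (tau ℓ α x)

/-- The image `G_α` of the pivotal element in `𝒰_α`. -/
def pivot (ℓ : ℕ) (α : G) : Ualpha ℓ α := proj ℓ α (pivotal ℓ)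

theorem pivot_eq : pivot ℓ α = ugen ℓ α sigma * (ugen ℓ α (kinv 0) ^ ℓ * ugen ℓ α (kinv 1) ^ 2) := by
  simp [pivot, pivotal, ugen]

theorem pivot_mem_torus : pivot ℓ α ∈ torus (ugen ℓ α) := by
  rw [pivot_eq]
  exact mul_mem (sigma_mem_torus _) (mul_mem (pow_mem (kinv_mem_torus _ 0) _)
    (pow_mem (kinv_mem_torus _ 1) _))

/-- In `𝒰_α` the factor `k₁^{-ℓ}` is a scalar, so only `σ k₂⁻²` matters. It contributes `ξ²` for
`e₁` and `-1` for `e₂`. -/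
theorem pivot_mul_e (i : Fin 2) : pivot ℓ α * ugen ℓ α (e i) =
    pivotScalar ℓ i • (ugen ℓ α (e i) * pivot ℓ α) := by
  have hs := sat_ugen ℓ α
  rw [pivot_eq, ugen_kinv_pow ℓ (-α) α (by simp)]
  fin_cases i <;>
  simp [pow_two, mul_assoc, hs.kinv_mul_e, assoc_of_qcomm (hs.kinv_mul_e _ _), smul_smul, cartan,
    pivotScalar, deg, assoc_of_qcomm (hs (.sigma_e _)), Algebra.algebraMap_eq_smul_one]
  congr 1
  ring

/-- The elements `x` that can be moved cyclically are closed under sums and products, so generators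
suffice. For `e_i`, the scalar from passing `G` is the one by which `L` fails to be cyclic. -/
theorem IsIntegralAt.trace {L : Ualpha ℓ α →ₗ[ℂ] ℂ} (hL : IsIntegralAt hℓ L) (h3 : 3 ≤ ℓ)
    (x y : Ualpha ℓ α) : L (pivot ℓ α * (x * y)) = L (pivot ℓ α * (y * x)) := by
  have hs := sat_ugen ℓ α
  have hp := pivot_mem_torus (ℓ := ℓ) (α := α)
  have tor : ∀ κ ∈ torus (ugen ℓ α), ∀ y,
      L (pivot ℓ α * (κ * y)) = L (pivot ℓ α * (y * κ)) := fun κ hκ y => by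
    rw [← mul_assoc, hs.torus_comm hp hκ, mul_assoc, ← hL.torus_comm h3 hκ, mul_assoc]
  have mul : ∀ a b : Ualpha ℓ α,
      (∀ y, L (pivot ℓ α * (a * y)) = L (pivot ℓ α * (y * a))) →
      (∀ y, L (pivot ℓ α * (b * y)) = L (pivot ℓ α * (y * b))) →
      ∀ y, L (pivot ℓ α * (a * b * y)) = L (pivot ℓ α * (y * (a * b))) := fun a b h1 h2 y => by
    rw [mul_assoc a, h1, mul_assoc b, h2, mul_assoc y]
  revert y
  induction x using Ualpha.induction with
  | hc c => intro y; rw [Algebra.commutes]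
  | hm a b h1 h2 => exact mul a b h1 h2
  | ha a b h1 h2 => intro y; simp only [add_mul, mul_add, map_add, h1, h2]
  | hg x =>
    cases x with
    | k i => exact tor _ (k_mem_torus _ i)
    | kinv i => exact tor _ (kinv_mem_torus _ i)
    | sigma => exact tor _ (sigma_mem_torus _)
    | e i =>
      intro y
      rw [← mul_assoc, pivot_mul_e, smul_mul_assoc, map_smul, smul_eq_mul, mul_assoc,
        ← hL.e_comm h3, mul_assoc]
    | f i =>
      have h1 : ugen ℓ α (f i) = tau ℓ α (ugen ℓ α (e i)) * ugen ℓ α (k i) := by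
        rw [tau_ugen]
        simp [tauGen, mul_assoc, hs (.kinv_k i)]
      rw [h1]
      refine mul _ _ (fun y => ?_) (tor _ (k_mem_torus _ i))
      have h2 := congrArg (tau ℓ α) (pivot_mul_e (ℓ := ℓ) (α := α) i)
      rw [tau_mul, map_smul, tau_mul, tau_torus hp] at h2
      have h3' := hL.tau_e_comm h3 i (pivot ℓ α * y)
      rw [← mul_assoc, h2, smul_mul_assoc, map_smul, smul_eq_mul] at h3'
      have := mul_left_cancel₀ (pivotScalar_ne_zero i) h3'
      rw [← mul_assoc, this, mul_assoc]

end Trace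

/-! ## Comparison of the integrals of different components -/

section Components

variable {ℓ : ℕ} {hℓ : Odd ℓ} {α β γ : G}

/-- The image of `filt n ⊗ 𝒰_β`. -/
def tensorFilt (ℓ : ℕ) (α β : G) (n : ℕ) : Submodule ℂ (Ualpha ℓ α ⊗[ℂ] Ualpha ℓ β) :=
  Submodule.span ℂ {s | ∃ m ∈ filt (ugen ℓ α) n, ∃ b, s = m ⊗ₜ b}

theorem tmul_mem_tensorFilt {n : ℕ} {m : Ualpha ℓ α} (hm : m ∈ filt (ugen ℓ α) n)
    (b : Ualpha ℓ β) : m ⊗ₜ b ∈ tensorFilt ℓ α β n :=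
  Submodule.subset_span ⟨m, hm, b, rfl⟩

theorem tensorFilt_mono {m n : ℕ} (h : m ≤ n) : tensorFilt ℓ α β m ≤ tensorFilt ℓ α β n :=
  Submodule.span_mono fun _ ⟨x, hx, b, hs⟩ => ⟨x, filt_mono h hx, b, hs⟩

theorem tmul_mul_mem_tensorFilt {m n : ℕ} {x : Ualpha ℓ α}
    (hx : ∀ y ∈ filt (ugen ℓ α) m, x * y ∈ filt (ugen ℓ α) n) (b : Ualpha ℓ β)
    {s : Ualpha ℓ α ⊗[ℂ] Ualpha ℓ β} (hs : s ∈ tensorFilt ℓ α β m) :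
    (x ⊗ₜ b) * s ∈ tensorFilt ℓ α β n := by
  induction hs using Submodule.span_induction with
  | mem s hs =>
    obtain ⟨y, hy, c, rfl⟩ := hs
    rw [Algebra.TensorProduct.tmul_mul_tmul]
    exact tmul_mem_tensorFilt (hx y hy) _
  | zero => simp
  | add s t _ _ h1 h2 => rw [mul_add]; exact add_mem h1 h2
  | smul c s _ h => rw [mul_smul_comm]; exact Submodule.smul_mem _ _ h

/-- `Δ x = x' ⊗ 1` up to terms of lower degree in the first factor. -/
def LeadingTerm (hℓ : Odd ℓ) (h : γ = α + β) (n : ℕ) (x : Ualpha ℓ γ) (x' : Ualpha ℓ α) : Prop :=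
  x' ∈ filt (ugen ℓ α) (n + 1) ∧ comul hℓ h x - x' ⊗ₜ 1 ∈ tensorFilt ℓ α β n

theorem kinv_sigma_mem_torus (α : G) (i : Fin 2) :
    ugen ℓ α (kinv i) * ugen ℓ α sigma ^ deg i ∈ torus (ugen ℓ α) :=
  mul_mem (kinv_mem_torus _ i) (pow_mem (sigma_mem_torus _) _)

theorem leadingTerm_e (h : γ = α + β) (i : Fin 2) :
    LeadingTerm hℓ h 0 (ugen ℓ γ (e i)) (ugen ℓ α (e i)) := by
  constructor
  · fin_cases i
    · simpa [eWord] using mem_filt (g := ugen ℓ α) (n := 1) (a := 1) 0 (one_mem _) (by simp)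
    · simpa [eWord] using mem_filt (g := ugen ℓ α) (n := 1) (a := 0) 1 (one_mem _) (by simp)
  · rw [comul_ugen, comulGen, add_sub_cancel_left]
    exact tmul_mem_tensorFilt (torus_mem_filt (kinv_sigma_mem_torus α i) 0) _

/-- In `Δ(e_i) = e_i ⊗ 1 + k_i⁻¹σ^{d_i} ⊗ e_i` the second term puts a torus element in the first
factor and does not raise the degree there. -/
theorem LeadingTerm.e_mul (h3 : 3 ≤ ℓ) {h : γ = α + β} {n : ℕ} {x : Ualpha ℓ γ} {x' : Ualpha ℓ α}
    (hx : LeadingTerm hℓ h n x x') (i : Fin 2) :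
    LeadingTerm hℓ h (n + 1) (ugen ℓ γ (e i) * x) (ugen ℓ α (e i) * x') := by
  have hs := sat_ugen ℓ α
  have he := fun y m => hs.e_mul_filt (xi_add_inv_ne_zero hℓ h3) i (x := y) (n := m)
  obtain ⟨h1, h2⟩ := hx
  refine ⟨he _ _ h1, ?_⟩
  have hΔ : comul hℓ h x ∈ tensorFilt ℓ α β (n + 1) := by
    have := add_mem (tensorFilt_mono n.le_succ h2) (tmul_mem_tensorFilt (β := β) h1 1)
    rwa [sub_add_cancel] at this
  have h4 := tmul_mul_mem_tensorFilt (β := β) (fun y hy => he y n hy) 1 h2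
  have h5 := tmul_mul_mem_tensorFilt (fun y hy => hs.torus_mul_filt (kinv_sigma_mem_torus α i) hy)
    (ugen ℓ β (e i)) hΔ
  convert add_mem h4 h5 using 1
  rw [map_mul, comul_ugen, comulGen, add_mul, mul_sub, Algebra.TensorProduct.tmul_mul_tmul, one_mul]
  abel

theorem leadingTerm_eTop (h3 : 3 ≤ ℓ) (h : γ = α + β) :
    LeadingTerm hℓ h (ℓ + 1) (eTop ℓ (ugen ℓ γ)) (eTop ℓ (ugen ℓ α)) := by
  have h1 : LeadingTerm hℓ h 2 (eWord (ugen ℓ γ) 3) (eWord (ugen ℓ α) 3) := by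
    have := ((leadingTerm_e (hℓ := hℓ) h 1).e_mul h3 0).e_mul h3 1
    simpa [eWord, mul_assoc] using this
  have h2 : ∀ a, LeadingTerm hℓ h (a + 2) (ugen ℓ γ (e 0) ^ a * eWord (ugen ℓ γ) 3)
      (ugen ℓ α (e 0) ^ a * eWord (ugen ℓ α) 3) := fun a => by
    induction a with
    | zero => simpa using h1
    | succ a ih =>
      have := ih.e_mul h3 0
      rwa [← mul_assoc, ← mul_assoc, ← pow_succ', ← pow_succ', add_right_comm] at this
  have := h2 (ℓ - 1)
  rwa [show ℓ - 1 + 2 = ℓ + 1 by omega] at this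

theorem IsIntegralAt.apply_filt_mul' {L : Ualpha ℓ α →ₗ[ℂ] ℂ} (hL : IsIntegralAt hℓ L)
    (h3 : 3 ≤ ℓ) {v v' : Ualpha ℓ α} {n : ℕ} (hv : v ∈ filt (ugen ℓ α) (ℓ + 1))
    (hv' : v' ∈ filt (ugen ℓ α) n) : L (v * tau ℓ α v') = 0 := by
  have hv'' := filt_le_span_positive n hv'
  clear hv'
  induction hv'' using Submodule.span_induction with
  | mem x hx => exact hL.apply_filt_mul h3 hv hx
  | zero => simp
  | add x y _ _ h1 h2 => rw [map_add, mul_add, map_add, h1, h2, add_zero]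
  | smul c x _ h => rw [map_smul, mul_smul_comm, map_smul, h, smul_zero]

theorem IsIntegralAt.slice_mul_map_tau {L : Ualpha ℓ α →ₗ[ℂ] ℂ} (hL : IsIntegralAt hℓ L)
    (h3 : 3 ≤ ℓ) {n : ℕ} {s t : Ualpha ℓ α ⊗[ℂ] Ualpha ℓ β} (hs : s ∈ tensorFilt ℓ α β (ℓ + 1))
    (ht : t ∈ tensorFilt ℓ α β n) :
    slice β L (s * TensorProduct.map (tau ℓ α) (tau ℓ β) t) = 0 := by
  induction hs using Submodule.span_induction with
  | mem s hs =>
    obtain ⟨x, hx, b, rfl⟩ := hs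
    induction ht using Submodule.span_induction with
    | mem t ht =>
      obtain ⟨y, hy, c, rfl⟩ := ht
      rw [TensorProduct.map_tmul, Algebra.TensorProduct.tmul_mul_tmul, slice_tmul,
        hL.apply_filt_mul' h3 hx hy, zero_smul]
    | zero => simp
    | add s t _ _ h1 h2 => rw [map_add, mul_add, map_add, h1, h2, add_zero]
    | smul c s _ h => rw [map_smul, mul_smul_comm, map_smul, h, smul_zero]
  | zero => simp
  | add s t _ _ h1 h2 => rw [add_mul, map_add, h1, h2, add_zero]
  | smul c s _ h => rw [smul_mul_assoc, map_smul, h, smul_zero]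

/-- The value of an integral on `e_top τ(e_top)`. -/
def topValue (L : Ualpha ℓ α →ₗ[ℂ] ℂ) : ℂ := L (eTop ℓ (ugen ℓ α) * tau ℓ α (eTop ℓ (ugen ℓ α)))

/-- With `Δ(E) = E ⊗ 1 + r`, where `r` is below top degree in the first factor, `Δ(E τ(E)) = Δ(E) (τ
⊗ τ)Δ(E)` has four terms. Each term containing `r` is killed by `L ⊗ id`. -/
theorem IsIntegralAt.slice_top {L : Ualpha ℓ α →ₗ[ℂ] ℂ} (hL : IsIntegralAt hℓ L) (h3 : 3 ≤ ℓ)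
    (h : γ = α + β) :
    slice β L (comul hℓ h (eTop ℓ (ugen ℓ γ) * tau ℓ γ (eTop ℓ (ugen ℓ γ)))) =
      topValue L • 1 := by
  have hE : eTop ℓ (ugen ℓ α) ∈ positive (ugen ℓ α) := eTop_mem_positive
  obtain ⟨h1, h2⟩ := leadingTerm_eTop (hℓ := hℓ) h3 h
  obtain ⟨r, hr⟩ : ∃ r, r = comul hℓ h (eTop ℓ (ugen ℓ γ)) - eTop ℓ (ugen ℓ α) ⊗ₜ 1 := ⟨_, rfl⟩
  rw [← hr] at h2
  have hr' : comul hℓ h (eTop ℓ (ugen ℓ γ)) = eTop ℓ (ugen ℓ α) ⊗ₜ 1 + r := by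
    rw [hr, add_sub_cancel]
  have h4 : slice β L ((eTop ℓ (ugen ℓ α) ⊗ₜ 1) *
      TensorProduct.map (tau ℓ α) (tau ℓ β) r) = 0 := by
    clear hr hr'
    induction h2 using Submodule.span_induction with
    | mem s hs =>
      obtain ⟨x, hx, b, rfl⟩ := hs
      rw [TensorProduct.map_tmul, Algebra.TensorProduct.tmul_mul_tmul, slice_tmul,
        hL.apply_mul_filt h3 hE hx, zero_smul]
    | zero => simp
    | add s t _ _ h1 h2 => rw [map_add, mul_add, map_add, h1, h2, add_zero]
    | smul c s _ h => rw [map_smul, mul_smul_comm, map_smul, h, smul_zero]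
  have h5 : eTop ℓ (ugen ℓ α) ⊗ₜ 1 + r ∈ tensorFilt ℓ α β (ℓ + 1 + 1) :=
    add_mem (tmul_mem_tensorFilt h1 1) (tensorFilt_mono (Nat.le_succ _) h2)
  rw [map_mul, comul_tau, hr', add_mul, map_add, hL.slice_mul_map_tau h3 h2 h5, add_zero, map_add,
    mul_add, map_add, h4, add_zero, TensorProduct.map_tmul, Algebra.TensorProduct.tmul_mul_tmul,
    slice_tmul, tau_one, mul_one, topValue]

end Components

/-! ## Compatibility with the antipode -/

section Antipode

variable {ℓ : ℕ} {hℓ : Odd ℓ} {α β : G} (h : β = -α)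

theorem antipode_pow (x : Ualpha ℓ α) (n : ℕ) : antipode h (x ^ n) = antipode h x ^ n := by
  induction n with
  | zero => simp [antipode_one]
  | succ n ih => rw [pow_succ, antipode_mul, ih, pow_succ']

theorem antipode_torus {κ : Ualpha ℓ α} (hκ : κ ∈ torus (ugen ℓ α)) :
    antipode h κ ∈ torus (ugen ℓ β) := by
  induction hκ using Submonoid.closure_induction with
  | mem x hx =>
    rcases hx with ⟨i, rfl⟩ | ⟨i, rfl⟩ | rfl <;> rw [antipode_ugen]
    · exact kinv_mem_torus _ i
    · exact k_mem_torus _ i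
    · exact sigma_mem_torus _
  | one => rw [antipode_one]; exact one_mem _
  | mul x y _ _ h1 h2 => rw [antipode_mul]; exact mul_mem h2 h1

theorem antipode_antipode_torus (h' : α = -β) {κ : Ualpha ℓ α} (hκ : κ ∈ torus (ugen ℓ α)) :
    antipode h' (antipode h κ) = κ := by
  induction hκ using Submonoid.closure_induction with
  | mem x hx =>
    rcases hx with ⟨i, rfl⟩ | ⟨i, rfl⟩ | rfl <;> simp [antipode_ugen, antipodeGen]
  | one => simp [antipode_one]
  | mul x y _ _ h1 h2 => rw [antipode_mul, antipode_mul, h1, h2]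

theorem antipode_e (i : Fin 2) : antipode h (ugen ℓ α (e i)) =
    -(ugen ℓ β sigma ^ deg i * ugen ℓ β (k i) * ugen ℓ β (e i)) := by
  rw [antipode_ugen]; rfl

theorem sigma_k_mem_torus (β : G) (i : Fin 2) :
    ugen ℓ β sigma ^ deg i * ugen ℓ β (k i) ∈ torus (ugen ℓ β) :=
  mul_mem (pow_mem (sigma_mem_torus _) _) (k_mem_torus _ i)

theorem antipode_e_mul_filt (hℓ : Odd ℓ) (h3 : 3 ≤ ℓ) (i : Fin 2) {n : ℕ} {x : Ualpha ℓ β}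
    (hx : x ∈ filt (ugen ℓ β) n) :
    antipode h (ugen ℓ α (e i)) * x ∈ filt (ugen ℓ β) (n + 1) := by
  have hs := sat_ugen ℓ β
  rw [antipode_e, neg_mul, mul_assoc]
  exact neg_mem (hs.torus_mul_filt (sigma_k_mem_torus β i)
    (hs.e_mul_filt (xi_add_inv_ne_zero hℓ h3) i hx))

theorem antipode_filt (hℓ : Odd ℓ) (h3 : 3 ≤ ℓ) {n : ℕ} {x : Ualpha ℓ α}
    (hx : x ∈ filt (ugen ℓ α) n) : antipode h x ∈ filt (ugen ℓ β) n := by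
  induction hx using Submodule.span_induction with
  | mem x hx =>
    obtain ⟨a, j, κ, hκ, hn, rfl⟩ := hx
    rw [antipode_mul, antipode_mul, antipode_pow]
    refine (sat_ugen ℓ β).torus_mul_filt (antipode_torus h hκ) (filt_mono hn ?_)
    have h0 : antipode h (ugen ℓ α (e 0)) ^ a ∈ filt (ugen ℓ β) a := by
      clear hn
      induction a with
      | zero => exact torus_mem_filt (by simp) 0
      | succ a ih =>
        rw [pow_succ']
        exact antipode_e_mul_filt h hℓ h3 0 ih
    have he := fun i n x => antipode_e_mul_filt h hℓ h3 i (n := n) (x := x)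
    fin_cases j
    · simpa [eWord, antipode_one] using h0
    · simpa [eWord] using he 1 _ _ h0
    · simpa [eWord, antipode_mul, mul_assoc] using he 0 _ _ (he 1 _ _ h0)
    · simpa [eWord, antipode_mul, mul_assoc] using he 1 _ _ (he 0 _ _ (he 1 _ _ h0))
  | zero => simp
  | add x y _ _ h1 h2 => rw [map_add]; exact add_mem h1 h2
  | smul c x _ h => rw [map_smul]; exact Submodule.smul_mem _ _ h

theorem antipode_positive {v : Ualpha ℓ α} (hv : v ∈ positive (ugen ℓ α)) :
    ∃ c : ℂ, ∃ w ∈ positive (ugen ℓ β), antipode h v = c • w := by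
  induction hv using Submonoid.closure_induction with
  | mem x hx =>
    rcases hx with hx | ⟨i, rfl⟩
    · exact ⟨1, _, torus_le_positive _ (antipode_torus h hx), by simp⟩
    · exact ⟨-1, _, mul_mem (torus_le_positive _ (sigma_k_mem_torus β i)) (e_mem_positive _ i), by
        rw [antipode_e]; simp⟩
  | one => exact ⟨1, 1, one_mem _, by simp [antipode_one]⟩
  | mul x y _ _ h1 h2 =>
    obtain ⟨c, w, hw, h1⟩ := h1
    obtain ⟨c', w', hw', h2⟩ := h2
    exact ⟨c' * c, w' * w, mul_mem hw' hw, by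
      rw [antipode_mul, h1, h2, smul_mul_smul_comm]⟩

theorem tau_antipode_e (i : Fin 2) : tau ℓ β (antipode h (ugen ℓ α (e i))) =
    pivotScalar ℓ i • antipode h (tau ℓ α (ugen ℓ α (e i))) := by
  have hs := sat_ugen ℓ β
  have h1 := congrArg (tau ℓ β) (k_sigma_mul_e (ℓ := ℓ) (α := β) i)
  rw [map_smul, tau_mul (ugen ℓ β sigma ^ deg i * ugen ℓ β (k i)), tau_mul (ugen ℓ β (e i)),
    tau_torus (sigma_k_mem_torus β i)] at h1
  rw [antipode_e, map_neg, tau_mul, tau_torus (sigma_k_mem_torus β i), h1, ← smul_neg]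
  congr 1
  rw [tau_ugen, tau_ugen]
  simp [tauGen, antipode_mul, antipode_ugen, antipodeGen, ← mul_assoc, sigma_pow_mul_k]

theorem antipode_tau_torus {κ : Ualpha ℓ α} (hκ : κ ∈ torus (ugen ℓ α)) :
    antipode h (tau ℓ α κ) = tau ℓ β (antipode h κ) := by
  rw [tau_torus hκ, tau_torus (antipode_torus h hκ)]

/-- The scalar is a product of inverse `pivotScalar`s and depends on the monomial. For spans,
`antipode_tau_filt` therefore provides a preimage under `τ` instead of a common scalar. -/
theorem antipode_tau_positive {v : Ualpha ℓ α} (hv : v ∈ positive (ugen ℓ α)) :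
    ∃ c : ℂ, antipode h (tau ℓ α v) = c • tau ℓ β (antipode h v) := by
  induction hv using Submonoid.closure_induction with
  | mem x hx =>
    rcases hx with hx | ⟨i, rfl⟩
    · exact ⟨1, by rw [antipode_tau_torus h hx, one_smul]⟩
    · exact ⟨(pivotScalar ℓ i)⁻¹, by
        rw [tau_antipode_e, smul_smul, inv_mul_cancel₀ (pivotScalar_ne_zero i), one_smul]⟩
  | one => exact ⟨1, by simp [antipode_one, tau_one]⟩
  | mul x y _ _ h1 h2 =>
    obtain ⟨c, h1⟩ := h1
    obtain ⟨c', h2⟩ := h2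
    exact ⟨c * c', by
      rw [tau_mul, antipode_mul, h1, h2, antipode_mul, tau_mul, smul_mul_smul_comm]⟩

theorem antipode_tau_filt (hℓ : Odd ℓ) (h3 : 3 ≤ ℓ) {n : ℕ} {v : Ualpha ℓ α}
    (hv : v ∈ filt (ugen ℓ α) n) :
    ∃ u ∈ filt (ugen ℓ β) n, antipode h (tau ℓ α v) = tau ℓ β u := by
  induction hv using Submodule.span_induction with
  | mem x hx =>
    have hx' := antipode_filt h hℓ h3 (Submodule.subset_span hx)
    obtain ⟨a, j, κ, hκ, hn, rfl⟩ := hx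
    obtain ⟨c, hc⟩ := antipode_tau_positive h (mul_mem (mul_mem (pow_mem (e_mem_positive _ 0) a)
      (eWord_mem_positive _ j)) (torus_le_positive _ hκ))
    exact ⟨_, Submodule.smul_mem _ c hx', by rw [hc, map_smul]⟩
  | zero => exact ⟨0, zero_mem _, by simp⟩
  | add x y _ _ h1 h2 =>
    obtain ⟨u, hu, h1⟩ := h1
    obtain ⟨u', hu', h2⟩ := h2
    exact ⟨u + u', add_mem hu hu', by simp only [map_add, h1, h2]⟩
  | smul c x _ h1 =>
    obtain ⟨u, hu, h1⟩ := h1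
    exact ⟨c • u, Submodule.smul_mem _ _ hu, by simp only [map_smul, h1]⟩

theorem pivotScalar_zero_pow (h0 : ℓ ≠ 0) : pivotScalar ℓ 0 ^ ℓ = 1 := by
  have h1 : pivotScalar ℓ 0 = xi ℓ ^ 2 := by simp [pivotScalar, deg, cartan]
  rw [h1, ← pow_mul, mul_comm, pow_mul, xi_pow ℓ h0, one_pow]

theorem pivotScalar_one : pivotScalar ℓ 1 = -1 := by simp [pivotScalar, deg, cartan]

/-- `E` contains `ℓ` factors `e₁` and two factors `e₂`, so the total scalar is `(ξ²)^ℓ (-1)² = 1`.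
The same count makes `G` commute with `E` below. -/
theorem tau_antipode_eTop (h0 : ℓ ≠ 0) : tau ℓ β (antipode h (eTop ℓ (ugen ℓ α))) =
    antipode h (tau ℓ α (eTop ℓ (ugen ℓ α))) := by
  have hp : pivotScalar ℓ 0 ^ (ℓ - 1) * (pivotScalar ℓ 1 * pivotScalar ℓ 0 * pivotScalar ℓ 1) =
      1 := by
    have := pivotScalar_zero_pow h0
    rw [← Nat.sub_add_cancel (Nat.one_le_iff_ne_zero.2 h0), pow_succ,
      Nat.sub_add_cancel (Nat.one_le_iff_ne_zero.2 h0)] at this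
    rw [pivotScalar_one]
    linear_combination this
  simp only [eTop, eWord, Matrix.cons_val, antipode_mul, tau_mul, antipode_pow, tau_pow,
    tau_antipode_e, smul_pow, smul_mul_smul_comm, hp, one_smul]

theorem pivot_mul_eTop (h0 : ℓ ≠ 0) : pivot ℓ β * eTop ℓ (ugen ℓ β) =
    eTop ℓ (ugen ℓ β) * pivot ℓ β := by
  have h1 := fun n => mul_pow_of_qcomm (pivot_mul_e (ℓ := ℓ) (α := β) 0) n
  have hp : pivotScalar ℓ 0 ^ (ℓ - 1) * (pivotScalar ℓ 1 * (pivotScalar ℓ 0 * pivotScalar ℓ 1)) =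
      1 := by
    have := pivotScalar_zero_pow h0
    rw [← Nat.sub_add_cancel (Nat.one_le_iff_ne_zero.2 h0), pow_succ,
      Nat.sub_add_cancel (Nat.one_le_iff_ne_zero.2 h0)] at this
    rw [pivotScalar_one]
    linear_combination this
  simp only [eTop, eWord, Matrix.cons_val, mul_assoc, assoc_of_qcomm (h1 _),
    assoc_of_qcomm (pivot_mul_e _), pivot_mul_e, mul_smul_comm, smul_smul, hp, one_smul]

/-- Reordering costs `ξ^{-n(n-1)}` in total; the exponent is split between the two sides to stay in
natural powers. -/
theorem smul_k_mul_e_pow (n : ℕ) : xi ℓ ^ (n * n) • (ugen ℓ β (k 0) * ugen ℓ β (e 0)) ^ n =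
    xi ℓ ^ n • (ugen ℓ β (k 0) ^ n * ugen ℓ β (e 0) ^ n) := by
  have hs := sat_ugen ℓ β
  have h1 : ugen ℓ β (k 0) * ugen ℓ β (e 0) = xi ℓ ^ 2 • (ugen ℓ β (e 0) * ugen ℓ β (k 0)) := by
    rw [hs.k_mul_e]; simp [cartan]
  have h2 : ∀ n, ugen ℓ β (k 0) * ugen ℓ β (e 0) ^ n =
      (xi ℓ ^ 2) ^ n • (ugen ℓ β (e 0) ^ n * ugen ℓ β (k 0)) := mul_pow_of_qcomm h1
  induction n with
  | zero => simp
  | succ n ih =>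
    have e1 : (n + 1) * (n + 1) = n * n + (2 * n + 1) := by ring
    rw [e1, pow_add, pow_succ _ n, mul_comm (_ ^ (n * n)), mul_smul, ← smul_mul_assoc, ih,
      smul_mul_assoc, mul_assoc, ← mul_assoc (_ ^ n) (ugen ℓ β (k 0)), pow_succ (ugen ℓ β (k 0)),
      pow_succ (ugen ℓ β (e 0)), ← mul_assoc (_ * _), mul_assoc (_ ^ n) _ (_ ^ n), h2,
      mul_smul_comm, smul_mul_assoc, smul_smul, smul_smul, ← mul_assoc, ← mul_assoc]
    congr 1
    ring

theorem antipode_eWord_three : antipode h (eWord (ugen ℓ α) 3) =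
    xi ℓ ^ 2 • (ugen ℓ β (k 0) * ugen ℓ β (k 1) ^ 2 * eWord (ugen ℓ β) 3) := by
  have hs := sat_ugen ℓ β
  have h1 := hs.e_k 0 1
  have h2 := hs.e_k 1 0
  have h3 := hs.e_k 1 1
  have h4 := hs.e_sigma 0
  have h5 := hs.e_sigma 1
  have h7 := fun i => (hs (.sigma_k i)).symm
  have h8 := hs.kk 1 0
  have a8 : ∀ z, ugen ℓ β (k 1) * (ugen ℓ β (k 0) * z) = ugen ℓ β (k 0) * (ugen ℓ β (k 1) * z) :=
    fun z => by rw [← mul_assoc, h8, mul_assoc]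
  have a7 : ∀ i z, ugen ℓ β (k i) * (ugen ℓ β sigma * z) = ugen ℓ β sigma * (ugen ℓ β (k i) * z) :=
    fun i z => by rw [← mul_assoc, h7, mul_assoc]
  have a6 : ∀ z, ugen ℓ β sigma * (ugen ℓ β sigma * z) = z :=
    fun z => by rw [← mul_assoc, hs.sigma_sigma, one_mul]
  simp only [eWord, Matrix.cons_val, antipode_mul, antipode_e, deg, pow_zero, pow_one, one_mul,
    neg_mul, mul_neg, neg_neg, mul_assoc, assoc_of_qcomm h1, assoc_of_qcomm h2, assoc_of_qcomm h3,
    assoc_of_qcomm h4, assoc_of_qcomm h5, mul_smul_comm, smul_mul_assoc, smul_smul, a6, a7, a8,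
    cartan, pow_two]
  simp

theorem eWord_three_k_zero : eWord (ugen ℓ β) 3 * ugen ℓ β (k 0) =
    ugen ℓ β (k 0) * eWord (ugen ℓ β) 3 := by
  have hs := sat_ugen ℓ β
  have hx := xi_ne_zero ℓ
  have h0 := hs.e_k 0 0
  have h1 := hs.e_k 0 1
  simp only [eWord, Matrix.cons_val, mul_assoc, h1, mul_smul_comm, assoc_of_qcomm h0,
    assoc_of_qcomm h1, smul_smul]
  simp only [← zpow_add₀ hx]
  simp [cartan]

/-- The sign `(-1)^{ℓ-1}` is trivial for odd `ℓ`, and the `ξ²` from `S(e₂e₁e₂)` is absorbed by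
reordering `(k₁e₁)^{ℓ-1}`. The resulting factor `k₁^ℓ k₂²` is what dictates the exponents in the
pivotal element. -/
theorem antipode_eTop (h3 : 3 ≤ ℓ) (hℓ : Odd ℓ) : antipode h (eTop ℓ (ugen ℓ α)) =
    ugen ℓ β (k 0) ^ ℓ * ugen ℓ β (k 1) ^ 2 * eTop ℓ (ugen ℓ β) := by
  have hs := sat_ugen ℓ β
  have hx := xi_ne_zero ℓ
  have hw := antipode_eWord_three (ℓ := ℓ) h
  have hc := hs.eWord_three_comm (xi_add_inv_ne_zero hℓ h3)
  have hk := eWord_three_k_zero (ℓ := ℓ) (β := β)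
  have hp := smul_k_mul_e_pow (ℓ := ℓ) (β := β) (ℓ - 1)
  obtain ⟨m, rfl⟩ : ∃ m, ℓ = m + 1 := ⟨ℓ - 1, by omega⟩
  simp only [Nat.add_sub_cancel] at hp
  have hm : Even m := by
    rcases Nat.even_or_odd m with h | h
    · exact h
    · exact absurd hℓ (Nat.not_odd_iff_even.2 (h.add_odd odd_one))
  have hx1 : xi (m + 1) ^ (m + 1) = 1 := xi_pow _ (by omega)
  have hp' : xi (m + 1) ^ 2 • (ugen (m + 1) β (k 0) * ugen (m + 1) β (e 0)) ^ m =
      ugen (m + 1) β (k 0) ^ m * ugen (m + 1) β (e 0) ^ m := by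
    have h1 := congrArg (xi (m + 1) • ·) hp
    simp only [smul_smul, ← pow_succ', hx1, one_smul] at h1
    rw [← h1]
    congr 1
    obtain ⟨j, rfl⟩ : ∃ j, m = j + 1 := ⟨m - 1, by omega⟩
    -- With `m = ℓ - 1`, one has `m² + 1 = ℓ(m - 1) + 2`, so `ξ^{m²+1} = ξ²`.
    rw [show (j + 1) * (j + 1) + 1 = (j + 1 + 1) * j + 2 by ring, pow_add, pow_mul, hx1, one_pow,
      one_mul]
  rw [eTop, antipode_mul, hw, antipode_pow, antipode_e, eTop, Nat.add_sub_cancel]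
  simp only [deg, Matrix.cons_val, pow_zero, one_mul, hm.neg_pow]
  rw [smul_mul_assoc, ← mul_smul_comm, hp', mul_assoc, ← mul_assoc (eWord _ 3),
    ((show Commute _ _ from hk).pow_right m).eq, mul_assoc, mul_assoc (_ ^ m),
    ((show Commute _ _ from hc).pow_right m).eq]
  simp only [← mul_assoc]
  congr 2
  rw [mul_assoc (ugen _ β (k 0)), (((show Commute _ _ from hs.kk 1 0).pow_left 2).pow_right m).eq,
    ← mul_assoc, ← pow_succ']

theorem antipode_pivot : antipode h (pivot ℓ α) * pivot ℓ β = 1 := by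
  have hs := sat_ugen ℓ β
  have c0 : Commute (ugen ℓ β (k 0)) (ugen ℓ β (kinv 0)) := hs.k_kinv_comm _ _
  have c1 : Commute (ugen ℓ β (k 1)) (ugen ℓ β (kinv 1)) := hs.k_kinv_comm _ _
  have h0 : ugen ℓ β (k 0) ^ ℓ * ugen ℓ β (kinv 0) ^ ℓ = 1 := by
    rw [← c0.mul_pow, hs (.k_kinv 0), one_pow]
  have h1 : ugen ℓ β (k 1) ^ 2 * ugen ℓ β (kinv 1) ^ 2 = 1 := by
    rw [← c1.mul_pow, hs (.k_kinv 1), one_pow]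
  rw [pivot_eq, pivot_eq]
  simp only [antipode_mul, antipode_pow, antipode_ugen, antipodeGen, MulOpposite.unop_op]
  rw [mul_assoc, ← mul_assoc (ugen ℓ β sigma), hs.sigma_sigma, one_mul, mul_assoc,
    ← mul_assoc (_ ^ ℓ), h0, one_mul, h1]

theorem k_pow_mul_pivot : ugen ℓ β (k 0) ^ ℓ * ugen ℓ β (k 1) ^ 2 * pivot ℓ β =
    ugen ℓ β sigma := by
  have hs := sat_ugen ℓ β
  have c0 : Commute (ugen ℓ β (k 0)) (ugen ℓ β (kinv 0)) := hs.k_kinv_comm _ _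
  have c1 : Commute (ugen ℓ β (k 1)) (ugen ℓ β (kinv 1)) := hs.k_kinv_comm _ _
  have c2 : Commute (ugen ℓ β (kinv 0)) (ugen ℓ β (kinv 1)) := hs.kinv_kinv _ _
  have s0 : Commute (ugen ℓ β sigma) (ugen ℓ β (k 0)) := hs (.sigma_k 0)
  have s1 : Commute (ugen ℓ β sigma) (ugen ℓ β (k 1)) := hs (.sigma_k 1)
  have h0 : ugen ℓ β (k 0) ^ ℓ * ugen ℓ β (kinv 0) ^ ℓ = 1 := by
    rw [← c0.mul_pow, hs (.k_kinv 0), one_pow]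
  have h1 : ugen ℓ β (k 1) ^ 2 * ugen ℓ β (kinv 1) ^ 2 = 1 := by
    rw [← c1.mul_pow, hs (.k_kinv 1), one_pow]
  rw [pivot_eq, ← mul_assoc, ← ((s0.pow_right ℓ).mul_right (s1.pow_right 2)).eq, mul_assoc,
    (c2.pow_pow ℓ 2).eq, mul_assoc, ← mul_assoc (_ ^ 2), h1, one_mul, h0, mul_one]

end Antipode

/-! ### Antipode invariance of the twisted form -/

section Main

variable {ℓ : ℕ} {hℓ : Odd ℓ} {α β : G}

theorem antipode_top (h : β = -α) (h3 : 3 ≤ ℓ) (hℓ : Odd ℓ) (κ : Ualpha ℓ α) :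
    antipode h (eTop ℓ (ugen ℓ α) * κ * tau ℓ α (eTop ℓ (ugen ℓ α))) =
      tau ℓ β (eTop ℓ (ugen ℓ β)) * (ugen ℓ β (k 0) ^ ℓ * ugen ℓ β (k 1) ^ 2) *
        (antipode h κ * (ugen ℓ β (k 0) ^ ℓ * ugen ℓ β (k 1) ^ 2 * eTop ℓ (ugen ℓ β))) := by
  have hh : ugen ℓ β (k 0) ^ ℓ * ugen ℓ β (k 1) ^ 2 ∈ torus (ugen ℓ β) :=
    mul_mem (pow_mem (k_mem_torus _ 0) _) (pow_mem (k_mem_torus _ 1) _)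
  rw [antipode_mul, antipode_mul, ← tau_antipode_eTop h (by omega), antipode_eTop h h3 hℓ,
    tau_mul _ (eTop ℓ _), tau_torus hh]

theorem IsIntegralAt.apply_antipode_top {M : Ualpha ℓ β →ₗ[ℂ] ℂ} (hM : IsIntegralAt hℓ M)
    (h : β = -α) (h3 : 3 ≤ ℓ) {κ : Ualpha ℓ α} (hκ : κ ∈ torus (ugen ℓ α)) :
    M (pivot ℓ β * antipode h (eTop ℓ (ugen ℓ α) * κ * tau ℓ α (eTop ℓ (ugen ℓ α))) *
      pivot ℓ β) = M (antipode h κ * (eTop ℓ (ugen ℓ β) * tau ℓ β (eTop ℓ (ugen ℓ β)))) := by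
  have hs := sat_ugen ℓ β
  have hp := pivot_mem_torus (ℓ := ℓ) (α := β)
  have hκ' := antipode_torus h hκ
  rw [antipode_top h h3 hℓ]
  obtain ⟨u, hu⟩ : ∃ u, u = ugen ℓ β (k 0) ^ ℓ * ugen ℓ β (k 1) ^ 2 := ⟨_, rfl⟩
  have hut : u ∈ torus (ugen ℓ β) := hu ▸
    mul_mem (pow_mem (k_mem_torus _ 0) _) (pow_mem (k_mem_torus _ 1) _)
  have hup : u * pivot ℓ β = ugen ℓ β sigma := by rw [hu, k_pow_mul_pivot]
  have hpu : pivot ℓ β * u = ugen ℓ β sigma := by rw [hs.torus_comm hp hut, hup]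
  have hEp := pivot_mul_eTop (ℓ := ℓ) (β := β) (by omega)
  have ht := torus_top_comm (mul_mem hut hκ') (eTop_mem_positive (ℓ := ℓ) (α := β))
  -- The trace property turns `G τ(E) u S(κ) · u E G` into `G u E G τ(E) u S(κ)`. As `G` commutes
  -- with `E`, and `u S(κ)` with `E τ(E)`, this equals `(G u)(G u) S(κ) E τ(E)`, and `(G u)² = σ² =
  -- 1`.
  have h1 := hM.trace h3 (tau ℓ β (eTop ℓ (ugen ℓ β)) * u * antipode h κ)
    (u * eTop ℓ (ugen ℓ β) * pivot ℓ β)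
  rw [← hu]
  simp only [mul_assoc] at h1 ht ⊢
  rw [h1, ← mul_assoc (eTop ℓ _) (pivot ℓ β), ← hEp, mul_assoc, ← ht, ← mul_assoc (pivot ℓ β) u,
    ← mul_assoc (pivot ℓ β) u, hpu, ← mul_assoc, hs.sigma_sigma, one_mul]

/-- Placing `G` on both sides lets the trace property restore the order reversed by `S`, so that
`S(v)` again precedes `S(τ(v'))`. Since `S` preserves the degree filtration and commutes with `τ` up
to scalars on monomials, both forms vanish below top degree, and only the torus-twisted top terms
have to be compared. -/
theorem apply_antipode_twist {L : Ualpha ℓ α →ₗ[ℂ] ℂ} {M : Ualpha ℓ β →ₗ[ℂ] ℂ}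
    (hL : IsIntegralAt hℓ L) (hM : IsIntegralAt hℓ M) (h : β = -α) (h3 : 3 ≤ ℓ)
    (hLM : topValue L = topValue M) (y : Ualpha ℓ α) :
    M (pivot ℓ β * antipode h y * pivot ℓ β) = L y := by
  have hs := sat_ugen ℓ β
  have hp := pivot_mem_torus (ℓ := ℓ) (α := β)
  have hcomm : ∀ v v' : Ualpha ℓ α,
      M (pivot ℓ β * antipode h (v * tau ℓ α v') * pivot ℓ β) =
        M (pivot ℓ β * antipode h v * pivot ℓ β * antipode h (tau ℓ α v')) := fun v v' => by
    have := hM.trace h3 (antipode h (tau ℓ α v')) (antipode h v * pivot ℓ β)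
    rw [antipode_mul]
    simpa only [mul_assoc] using this
  obtain ⟨D, hD⟩ : ∃ D : Ualpha ℓ α →ₗ[ℂ] ℂ,
      ∀ y, D y = M (pivot ℓ β * antipode h y * pivot ℓ β) - L y :=
    ⟨M ∘ₗ LinearMap.mulRight ℂ (pivot ℓ β) ∘ₗ LinearMap.mulLeft ℂ (pivot ℓ β) ∘ₗ antipode h - L,
      fun y => rfl⟩
  have hD0 : D = 0 := by
    refine linearMap_eq_zero h3 hℓ ?_ ?_ ?_
    · intro v hv v' hv'
      obtain ⟨c, hc⟩ := antipode_tau_positive h hv'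
      obtain ⟨c', w, hw, hc'⟩ := antipode_positive h hv'
      rw [hD, hcomm, hc, hc', map_smul, hL.apply_filt_mul h3 hv hv', mul_smul_comm, mul_smul_comm,
        map_smul, map_smul, hM.apply_filt_mul h3 (Sat.filt_mul_torus hp
          (hs.torus_mul_filt hp (antipode_filt h hℓ h3 hv))) hw]
      simp
    · intro v hv v' hv'
      obtain ⟨u, hu, hc⟩ := antipode_tau_filt h hℓ h3 hv'
      obtain ⟨c, w, hw, hc'⟩ := antipode_positive h hv
      rw [hD, hcomm, hc, hc', hL.apply_mul_filt h3 hv hv', mul_smul_comm, smul_mul_assoc,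
        smul_mul_assoc, map_smul, hM.apply_mul_filt h3 (mul_mem (mul_mem (torus_le_positive _ hp)
          hw) (torus_le_positive _ hp)) hu]
      simp
    · intro κ hκ
      rw [hD, hM.apply_antipode_top h h3 hκ]
      rcases torus_eq_smul_or h3 hℓ hκ with ⟨c, rfl⟩ | h0
      · rw [topValue, topValue] at hLM
        simp [antipode_one, hLM]
      · rw [h0 L hL, sub_zero]
        have hκ' := antipode_torus h hκ
        -- The two alternatives are not exclusive. If `S(κ)` is a scalar then so is `κ`, as `S² =
        -- id` on the torus, and the vanishing of `L` carries over to `M` through equality of top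
        -- values.
        rcases torus_eq_smul_or h3 hℓ hκ' with ⟨c, hc⟩ | h1
        · have h' : α = -β := by rw [h, neg_neg]
          have h2 := antipode_antipode_torus h h' hκ
          rw [hc, map_smul, antipode_one] at h2
          have h3' := h0 L hL
          rw [← h2] at h3'
          rw [hc]
          rw [topValue, topValue] at hLM
          simpa [← hLM] using h3'
        · obtain ⟨c, _, hc⟩ := hs.torus_positive hκ' (eTop_mem_positive (ℓ := ℓ) (α := β))
          rw [← mul_assoc, hc, smul_mul_assoc, map_smul, h1 M hM, smul_zero]
  have := hD y
  rw [hD0, LinearMap.zero_apply] at this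
  exact (sub_eq_zero.1 this.symm)

theorem apply_pivot_antipode {L : Ualpha ℓ α →ₗ[ℂ] ℂ} {M : Ualpha ℓ β →ₗ[ℂ] ℂ}
    (hL : IsIntegralAt hℓ L) (hM : IsIntegralAt hℓ M) (h : β = -α) (h3 : 3 ≤ ℓ)
    (hLM : topValue L = topValue M) (x : Ualpha ℓ α) :
    M (pivot ℓ β * antipode h x) = L (pivot ℓ α * x) := by
  rw [← apply_antipode_twist hL hM h h3 hLM, antipode_mul, mul_assoc, mul_assoc, antipode_pivot,
    mul_one]

/-! ### Top values across the components of the integral -/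

section Family

variable {lam : ∀ α : G, Ualpha ℓ α →ₗ[ℂ] ℂ} (hlam : (hopfU ℓ hℓ).IsRightIntegral lam)
include hlam

theorem slice_comul {α β γ : G} (h : γ = α + β) (x : Ualpha ℓ γ) :
    slice β (lam α) (comul hℓ h x) = lam γ x • 1 := by
  subst h
  exact hlam α β x

theorem isIntegralAt_of_isRightIntegral (α : G) : IsIntegralAt hℓ (lam α) :=
  isIntegralAt_iff.2 (slice_comul hlam (add_zero α).symm)

/-- `(λ_α ⊗ id)Δ_{α,β}` at `E τ(E)` is computed once by the integral property and once by the
leading term. Both are multiples of `1_β`, whose coefficients can be compared once `1_β ≠ 0`. -/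
theorem topValue_eq (h3 : 3 ≤ ℓ) {α β γ : G} (h : γ = α + β) [Nontrivial (Ualpha ℓ β)] :
    topValue (lam γ) = topValue (lam α) := by
  have h1 := (isIntegralAt_of_isRightIntegral hlam α).slice_top h3 h
  rw [slice_comul hlam h] at h1
  exact smul_left_injective ℂ one_ne_zero h1

/-- The passage goes through the component `0`, using `0 = α + β` and `β = 0 + β`. If `𝒰_β` were
zero, the antipode would give `1 = 0` in `𝒰_α` as well; treating this case separately avoids proving
that the components are nonzero. -/
theorem topValue_neg (h3 : 3 ≤ ℓ) (h : β = -α) : topValue (lam α) = topValue (lam β) := by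
  rcases subsingleton_or_nontrivial (Ualpha ℓ β) with hβ | hβ
  · have h1 : (1 : Ualpha ℓ α) = 0 := by
      have h' : α = -β := by rw [h, neg_neg]
      rw [← antipode_one (ℓ := ℓ) h', Subsingleton.elim (1 : Ualpha ℓ β) 0, map_zero]
    have := subsingleton_of_zero_eq_one h1.symm
    rw [topValue, topValue, Subsingleton.elim (_ * _ : Ualpha ℓ α) 0,
      Subsingleton.elim (_ * _ : Ualpha ℓ β) 0, map_zero, map_zero]
  · rw [← topValue_eq hlam h3 (α := α) (β := β) (γ := 0) (by rw [h, add_neg_cancel]),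
      ← topValue_eq hlam h3 (α := 0) (β := β) (γ := β) (zero_add β).symm]

end Family

end Main

end SuperHennings

end

theorem mainTheorem6 (ℓ : ℕ) (hℓ : 3 ≤ ℓ) (hodd : Odd ℓ)
    (lam : ∀ α : SuperHennings.G, SuperHennings.Ualpha ℓ α →ₗ[ℂ] ℂ)
    (hlam : (SuperHennings.hopfU ℓ hodd).IsRightIntegral lam) :
    (SuperHennings.hopfU ℓ hodd).IsTrace (SuperHennings.trForm ℓ lam) :=
  have hL := SuperHennings.isIntegralAt_of_isRightIntegral hlam
  ⟨fun α => (hL α).trace hℓ, fun α => SuperHennings.apply_pivot_antipode (hL α) (hL (-α)) rfl hℓ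
    (SuperHennings.topValue_neg hlam hℓ rfl)⟩
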